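/- **Language.** Types are $\sigma,\tau ::= \mathsf R\mid\sigma\times\tau\mid\sigma\Rightarrow\tau\mid\sigma^*$, with $\Omega\sigma:=\sigma\Rightarrow\sigma^*$, $\mathsf R^1=\mathsf R$ and $\mathsf R^{n+1}=\mathsf R^n\times\mathsf R$ ($n\ge1$). Fix a collection $\mathcal F$ of smooth functions $f:\mathbb R^n\to\mathbb R^m$ ($n,m\ge 1$). Terms are those of the simply typed $\lambda$-calculus with pairs and projections, real constants, $0$, sums, $f(P):\mathsf R^m$ and $\mathcal Jf\cdot S:\mathsf R^n\Rightarrow\mathsf R^m$ for $P,S:\mathsf R^n$ and $f\in\mathcal F$ (the latter standing for $x\mapsto \mathcal J(f)(x)(S)$), functionals $\underline{r}^*:(\mathsf R^n)^*$ for $r\in\mathbb R^n$, dual maps $(\lambda x.S_1)^*\cdot S_2:\sigma^*$ for $x:\sigma\vdash S_1:\tau$ and $S_2:\tau^*$, where $x$ must be a linear variable of $S_1$, and pullbacks $(\Omega\lambda x.P)\cdot S:\Omega\sigma$ for $x:\sigma\vdash P:\tau$ and $S:\Omega\tau$. Linear variables are defined by $\mathrm{lin}(x)=\{x\}$, $\mathrm{lin}(\lambda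 x.S)=\mathrm{lin}(S)\setminus\{x\}$, $\mathrm{lin}(S\,P)=\mathrm{lin}(S)\setminus FV(P)$, $\mathrm{lin}(\pi_iS)=\mathrm{lin}(\mathcal Jf\cdot S)=\mathrm{lin}(S)$, $\mathrm{lin}\langle S_1,S_2\rangle=\mathrm{lin}(S_1+S_2)=\mathrm{lin}(S_1)\cap\mathrm{lin}(S_2)$, $\mathrm{lin}((\lambda x.S_1)^*\cdot S_2)=(\mathrm{lin}(\lambda x.S_1)\setminus FV(S_2))\cup(\mathrm{lin}(S_2)\setminus FV(\lambda x.S_1))$, every variable is linear in $0$, and no variable is linear in a term of any other form. **Reduction.** $\longrightarrow^*$ is the reflexive transitive closure, in all contexts, of the following; this contains the reductions made by any evaluation strategy. Sums are taken modulo associativity, commutativity, unit $0$, and $S[P+Q/y]\equiv S[P/y]+S[Q/y]$, $S[0/y]\equiv0$ for $y\in\mathrm{lin}(S)$. (a) Administrative reductions: every non-variable subterm may be named by a let, e.g. $P\,Q\to \mathsf{let}\ x_1=P;x_2=Q;x_3=x_1x_2\ \mathsf{in}\ x_3$, similarly for all other term formers (for dual maps and pullbacks only the second component is named), an atomic term or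 abstraction $e$ becomes $\mathsf{let}\ x=e\ \mathsf{in}\ x$, and nested lets are flattened. Here $\mathsf{let}\ x=P\ \mathsf{in}\ Q$ is $(\lambda x.Q)P$. (b) $(\lambda x.S)V\to S[V/x]$; $\pi_i\langle V_1,V_2\rangle\to V_i$; $f(\underline r)\to\underline{f(r)}$; $(\mathcal Jf\cdot\underline r)\,\underline{r'}\to\underline{\mathcal J(f)(r')(r)}$; $(\lambda v.(\mathcal Jf\cdot v)\underline r)^*\cdot\underline{r'}^*\to\underline{\mathcal J(f)(r)^{\top}r'}^*$; $(\lambda v_1.V_1)^*\cdot((\lambda v_2.V_2)^*\cdot V_3)\to(\lambda v_1.V_2[V_1/v_2])^*\cdot V_3$. (c) Let series: $(\Omega\lambda y.\mathsf{let}\ x=E\ \mathsf{in}\ x)\cdot\omega\to(\Omega\lambda y.E)\cdot\omega$ and $(\Omega\lambda y.\mathsf{let}\ x=E\ \mathsf{in}\ L)\cdot\omega\to(\Omega\lambda y.\langle y,E\rangle)\cdot((\Omega\lambda\langle y,x\rangle.L)\cdot\omega)$. (d) Write $E\rhd S$ for the reduction $((\Omega\lambda y.E)\cdot\omega)V\to(\lambda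 v.S)^*\cdot(\omega\,(E[V/y]))$. Below $t_i$ is a (possibly empty) iterated projection of $t$ and $z$ does not contain $y$. If $y\notin FV(E)$ then $((\Omega\lambda y.E)\cdot\omega)V\to0$. Further $z+y_j\rhd v_j$; $y_i+y_j\rhd v_i+v_j$; $y_i\rhd v_i$; $\langle y_i,z\rangle\rhd\langle v_i,0\rangle$; $\langle z,y_j\rangle\rhd\langle0,v_j\rangle$; $\langle y_i,y_j\rangle\rhd\langle v_i,v_j\rangle$; $\mathcal Jf\cdot y_i\rhd\mathcal Jf\cdot v_i$; $f(y_i)\rhd(\mathcal Jf\cdot v_i)V_i$; $(\lambda x.L)^*\cdot y_i\rhd(\lambda x.L)^*\cdot v_i$ if $y\notin FV(L)$; $y_i\,z\rhd v_i\,z$; $\langle y,z\rangle\rhd\langle v,0\rangle$. (e) Rules with premises. Write $L\Rightarrow S$ at $V$ if $((\Omega\lambda y.L)\cdot\omega')V\longrightarrow^*(\lambda v.S)^*\cdot(\omega'\,V')$ for a fresh variable $\omega'$ not occurring in $S$ and some $V'$. If $L\Rightarrow S$ at $V$, then $(\lambda x.L)^*\cdot z\rhd(\lambda x.S)^*\cdot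 z$; $(\lambda x.L)^*\cdot y_i\rhd(\lambda x.L[V/y])^*\cdot v_i+(\lambda x.S)^*\cdot V_i$; $\lambda x.L\rhd\lambda x.S$; $\langle y,L\rangle\rhd\langle v,S\rangle$. If $V_i\longrightarrow^*\lambda z.P'$ and $P'\Rightarrow S'$ at $V_j$ (pulling back along $\lambda z.P'$, with direction variable $v'$), then $y_i\,y_j\rhd v_i\,V_j+S'[v_j/v']$; if instead $((\Omega\lambda z.P')\cdot\omega')V_j\longrightarrow^*0$, then $y_i\,y_j\rhd v_i\,V_j$. If, for a fresh variable $a$, $((\Omega\lambda x.L)\cdot z)a\longrightarrow^*(\lambda v.S)^*\cdot(z\,V')$ (where $z$ may contain $y$), then $((\Omega\lambda y.(\Omega\lambda x.L)\cdot z)\cdot\omega)V\to((\Omega\lambda y.\lambda a.(\lambda v.S)^*\cdot(z\,V'))\cdot\omega)V$. **Model.** Let $\mathcal C$ be a well-pointed differential $\lambda$-category, i.e. a Cartesian closed Cartesian differential category with operator $D$ (axioms CD1–CD7) in which currying is additive and $D[\lambda(f)]=\lambda(D[f]\circ\langle\pi_1\times0,\pi_2\times\mathrm{Id}\rangle)$,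 such that morphisms are determined by their action on elements. A morphism $f$ is linear if $D[f]=f\circ\pi_1$. Assume that $\mathbb R$ is an object of $\mathcal C$ (its elements are the real numbers with their addition, multiplication by each real is a morphism, and every morphism $\mathbb R^n\to\mathbb R^m$ is a differentiable function with $D[f]\langle v,x\rangle=\mathcal J(f)(x)(v)$), that the functions in $\mathcal F$ are morphisms, that the linear morphisms $A\to\mathbb R$ form an object $L(A,\mathbb R)$, a linear subobject of the exponential $A\Rightarrow\mathbb R$, and that $\mathcal C$ satisfies Hahn–Banach separation: for distinct elements $x,y$ of an object $A$ there is a linear $l:A\to\mathbb R$ with $l(x)\ne l(y)$. Interpret $\mathsf R$ by $\mathbb R$, $\times$ and $\Rightarrow$ by products and exponentials, $\sigma^*$ by $L([\![\sigma]\!],\mathbb R)$, $\lambda$-terms, pairs, sums, constants and $f$ in the standard way, and $[\![\mathcal Jf\cdot S]\!]\gamma=\lambda x.D[f]\langle[\![S]\!]\gamma,x\rangle$, $[\![\underline r^*]\!]\gamma=\lambda v.\sum_i r_iv_i$, $[\![(\lambda x.S_1)^*\cdot S_2]\!]\gamma=\lambda v.[\![S_2]\!]\gamma([\![S_1]\!]\langle\gamma,v\rangle)$,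 $[\![(\Omega\lambda x.P)\cdot S]\!]\gamma=\lambda x v.[\![S]\!]\gamma([\![P]\!]\langle\gamma,x\rangle)(D[[\![P]\!]\langle\gamma,-\rangle]\langle v,x\rangle)$. **Theorem.** Let $\Gamma\cup\{y:\sigma\}\vdash P_1:\tau$, $\Gamma\vdash P_2:\sigma$ and $\gamma\in[\![\Gamma]\!]$. 1. Let $\sigma=\mathsf R^n$, $\tau=\mathsf R^m$ and $1\le p\le m$. If $((\Omega\lambda y.P_1)\cdot(\lambda x.\underline{e_p}^*))\,P_2\longrightarrow^*V$, then $[\![P_1]\!]\langle\gamma,-\rangle:\mathbb R^n\to\mathbb R^m$ is differentiable at $[\![P_2]\!]\gamma$, and $[\![V]\!]\gamma\in L(\mathbb R^n,\mathbb R)$ is the functional given by the $p$-th row of its Jacobian matrix there: $([\![V]\!]\gamma)(v)=\sum_j\mathcal J([\![P_1]\!]\langle\gamma,-\rangle)([\![P_2]\!]\gamma)_{pj}\,v_j$ for all $v\in\mathbb R^n$. 2. Let $\sigma,\tau$ be arbitrary types, let $\omega:\Omega\tau$ be a fresh variable and let $l:[\![\tau]\!]\to\mathbb R$ be linear. If $((\Omega\lambda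 y.P_1)\cdot\omega)\,P_2\longrightarrow^*(\lambda v.P_1')^*\cdot(\omega\,P_2')$, then for all $v\in[\![\sigma]\!]$ $$D[l\circ[\![P_1]\!]\langle\gamma,-\rangle]\langle v,[\![P_2]\!]\gamma\rangle=l\bigl([\![P_1']\!]\langle\gamma,\lambda x.l,v\rangle\bigr).$$ -/

import Mathlib

open CategoryTheory MonoidalCategory CartesianMonoidalCategory

/-! ## Differential lambda-categories -/

/-- A Cartesian differential category: a category with chosen finite products whose homsets are
commutative monoids, with a Cartesian differential operator `D`. In `D f` the first component is
the direction and the second one is the base point. Composition is written in diagrammatic order,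
so the mathematical `g ∘ f` is `f ≫ g`. -/
class CartesianDifferentialCategory (C : Type*) [Category C] [CartesianMonoidalCategory C] where
  homAdd : ∀ A B : C, AddCommMonoid (A ⟶ B)
  comp_add : ∀ {A B E : C} (f : A ⟶ B) (g h : B ⟶ E), f ≫ (g + h) = f ≫ g + f ≫ h
  comp_zero : ∀ {A B : C} (E : C) (f : A ⟶ B), f ≫ (0 : B ⟶ E) = 0
  add_fst : ∀ {X A B : C} (f g : X ⟶ A ⊗ B), (f + g) ≫ fst A B = f ≫ fst A B + g ≫ fst A B
  add_snd : ∀ {X A B : C} (f g : X ⟶ A ⊗ B), (f + g) ≫ snd A B = f ≫ snd A B + g ≫ snd A B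
  zero_fst : ∀ X A B : C, (0 : X ⟶ A ⊗ B) ≫ fst A B = 0
  zero_snd : ∀ X A B : C, (0 : X ⟶ A ⊗ B) ≫ snd A B = 0
  /-- the Cartesian differential operator -/
  D : ∀ {A B : C}, (A ⟶ B) → (A ⊗ A ⟶ B)
  /-- [CD1] -/
  D_add : ∀ {A B : C} (f g : A ⟶ B), D (f + g) = D f + D g
  D_zero : ∀ A B : C, D (0 : A ⟶ B) = 0
  /-- [CD2] -/
  D_add_left : ∀ {X A B : C} (f : A ⟶ B) (h k v : X ⟶ A),
    lift (h + k) v ≫ D f = lift h v ≫ D f + lift k v ≫ D f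
  D_zero_left : ∀ {X A B : C} (f : A ⟶ B) (v : X ⟶ A), lift 0 v ≫ D f = 0
  /-- [CD3] -/
  D_id : ∀ A : C, D (𝟙 A) = fst A A
  D_fst : ∀ A B : C, D (fst A B) = fst (A ⊗ B) (A ⊗ B) ≫ fst A B
  D_snd : ∀ A B : C, D (snd A B) = fst (A ⊗ B) (A ⊗ B) ≫ snd A B
  /-- [CD4] -/
  D_lift : ∀ {X A B : C} (f : X ⟶ A) (g : X ⟶ B), D (lift f g) = lift (D f) (D g)
  /-- [CD5] -/
  D_comp : ∀ {A B E : C} (f : A ⟶ B) (g : B ⟶ E), D (f ≫ g) = lift (D f) (snd A A ≫ f) ≫ D g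
  /-- [CD6] -/
  D_D_linear : ∀ {X A B : C} (f : A ⟶ B) (g h k : X ⟶ A),
    lift (lift g 0) (lift h k) ≫ D (D f) = lift g k ≫ D f
  /-- [CD7] -/
  D_D_symm : ∀ {X A B : C} (f : A ⟶ B) (g h k : X ⟶ A),
    lift (lift 0 h) (lift g k) ≫ D (D f) = lift (lift 0 g) (lift h k) ≫ D (D f)

attribute [reducible, instance] CartesianDifferentialCategory.homAdd

section Closed

variable {C : Type*} [Category C] [CartesianMonoidalCategory C] [MonoidalClosed C]

/-- The exponential object `A ⇒ B`. -/
abbrev expObj (A B : C) : C := (ihom A).obj B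

/-- Currying `λ(f) : X ⟶ (A ⇒ B)` of `f : X × A ⟶ B`. -/
def lamMor {X A B : C} (f : X ⊗ A ⟶ B) : X ⟶ expObj A B :=
  MonoidalClosed.curry (lift (snd A X) (fst A X) ≫ f)

/-- Evaluation `(A ⇒ B) × A ⟶ B`. -/
def evMor (A B : C) : expObj A B ⊗ A ⟶ B :=
  lift (snd (expObj A B) A) (fst (expObj A B) A) ≫ (ihom.ev A).app B

end Closed

/-- A differential lambda-category: a Cartesian closed Cartesian differential category in which
currying is additive and `D` satisfies the (D-curry) rule. -/
class DifferentialLambdaCategory (C : Type*) [Category C] [CartesianMonoidalCategory C]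
    [MonoidalClosed C] extends CartesianDifferentialCategory C where
  lam_add : ∀ {X A B : C} (f g : X ⊗ A ⟶ B), lamMor (f + g) = lamMor f + lamMor g
  lam_zero : ∀ X A B : C, lamMor (0 : X ⊗ A ⟶ B) = 0
  D_curry : ∀ {X A B : C} (f : X ⊗ A ⟶ B),
    D (lamMor f) = lamMor
      (lift (lift (fst (X ⊗ X) A ≫ fst X X) 0) (lift (fst (X ⊗ X) A ≫ snd X X) (snd (X ⊗ X) A))
        ≫ D f)

section Linear

variable {C : Type*} [Category C] [CartesianMonoidalCategory C] [CartesianDifferentialCategory C]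

/-- A morphism is linear if `D[f] = f ∘ π₁`. -/
def IsLinearMor {A B : C} (f : A ⟶ B) : Prop :=
  CartesianDifferentialCategory.D f = fst A A ≫ f

/-- The derivative of `f : X × A ⟶ B` in its second variable, `((γ, x), v) ↦ D[f(γ, -)](v, x)`. -/
def dSnd {X A B : C} (f : X ⊗ A ⟶ B) : (X ⊗ A) ⊗ A ⟶ B :=
  lift (lift 0 (snd (X ⊗ A) A)) (fst (X ⊗ A) A) ≫ CartesianDifferentialCategory.D f

/-- `f : X × A ⟶ B` is linear in its second variable, i.e. `D[f(γ, -)](v, x) = f(γ, v)`. -/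
def IsLinearSnd {X A B : C} (f : X ⊗ A ⟶ B) : Prop :=
  dSnd f = lift (fst (X ⊗ A) A ≫ fst X A) (snd (X ⊗ A) A) ≫ f

end Linear

/-- Global elements separate morphisms, i.e. morphisms are determined by their action on the
elements of objects: up to equivalence, objects are sets with structure and morphisms are
functions. The elements of the object `A` are the morphisms `𝟙_ C ⟶ A`. -/
def WellPointed (C : Type*) [Category C] [CartesianMonoidalCategory C] : Prop :=
  ∀ ⦃A B : C⦄ (f g : A ⟶ B), (∀ x : 𝟙_ C ⟶ A, x ≫ f = x ≫ g) → f = g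

/-! ## The language -/

/-- Types `σ, τ ::= R | σ × τ | σ ⇒ τ | σ*`. -/
inductive Ty : Type
  | real : Ty
  | prod : Ty → Ty → Ty
  | arrow : Ty → Ty → Ty
  | dual : Ty → Ty

/-- `Ty.pow n` is the type `R^(n+1)`, where `R^1 = R` and `R^(n+2) = R^(n+1) × R`. -/
def Ty.pow : ℕ → Ty
  | 0 => Ty.real
  | n + 1 => Ty.prod (Ty.pow n) Ty.real

/-- The type `Ω σ = σ ⇒ σ*` of 1-forms. -/
def Ty.form (σ : Ty) : Ty := Ty.arrow σ (Ty.dual σ)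

/-- A collection of easily differentiable functions between the spaces `ℝ^(n+1)`. -/
structure FunSig where
  fns : ∀ n m : ℕ, Set ((Fin (n + 1) → ℝ) → (Fin (m + 1) → ℝ))
  smooth : ∀ n m, ∀ f ∈ fns n m, ContDiff ℝ (⊤ : ℕ∞) f

/-- De Bruijn variables of type `σ` in a context; the head of the list is the last variable. -/
inductive Var : List Ty → Ty → Type
  | zero {Γ : List Ty} {σ : Ty} : Var (σ :: Γ) σ
  | succ {Γ : List Ty} {σ τ : Ty} : Var Γ σ → Var (τ :: Γ) σ

/-- The de Bruijn index of a variable. -/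
def Var.idx {Γ : List Ty} {σ : Ty} : Var Γ σ → ℕ
  | .zero => 0
  | .succ x => x.idx + 1

/-- Terms of type `σ` in context `Γ`, up to renaming of bound variables. Sums (the pullback terms)
are allowed in every position. The side condition of dual maps is imposed by `Tm.WF` below. -/
inductive Tm (F : FunSig) : List Ty → Ty → Type
  /-- `0` -/
  | zero {Γ : List Ty} {σ : Ty} : Tm F Γ σ
  /-- `s + t` -/
  | add {Γ : List Ty} {σ : Ty} : Tm F Γ σ → Tm F Γ σ → Tm F Γ σ
  | var {Γ : List Ty} {σ : Ty} : Var Γ σ → Tm F Γ σ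
  /-- `λ x. s` -/
  | lam {Γ : List Ty} {σ τ : Ty} : Tm F (σ :: Γ) τ → Tm F Γ (Ty.arrow σ τ)
  /-- `s t` -/
  | app {Γ : List Ty} {σ τ : Ty} : Tm F Γ (Ty.arrow σ τ) → Tm F Γ σ → Tm F Γ τ
  /-- `π₁(s)` -/
  | fst {Γ : List Ty} {σ τ : Ty} : Tm F Γ (Ty.prod σ τ) → Tm F Γ σ
  /-- `π₂(s)` -/
  | snd {Γ : List Ty} {σ τ : Ty} : Tm F Γ (Ty.prod σ τ) → Tm F Γ τ
  /-- `⟨s, t⟩` -/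
  | pair {Γ : List Ty} {σ τ : Ty} : Tm F Γ σ → Tm F Γ τ → Tm F Γ (Ty.prod σ τ)
  /-- the constant of a real number -/
  | const {Γ : List Ty} : ℝ → Tm F Γ Ty.real
  /-- `f(s)` -/
  | fn {Γ : List Ty} {n m : ℕ} : F.fns n m → Tm F Γ (Ty.pow n) → Tm F Γ (Ty.pow m)
  /-- the Jacobian `J f · s`, i.e. `x ↦ J(f)(x)(s)` -/
  | jac {Γ : List Ty} {n m : ℕ} :
      F.fns n m → Tm F Γ (Ty.pow n) → Tm F Γ (Ty.arrow (Ty.pow n) (Ty.pow m))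
  /-- the dual map `(λ x. s)* · t` -/
  | dualMap {Γ : List Ty} {σ τ : Ty} :
      Tm F (σ :: Γ) τ → Tm F Γ (Ty.dual τ) → Tm F Γ (Ty.dual σ)
  /-- the pullback of the 1-form `t` along `λ x. s` -/
  | pb {Γ : List Ty} {σ τ : Ty} :
      Tm F (σ :: Γ) τ → Tm F Γ (Ty.form τ) → Tm F Γ (Ty.form σ)
  /-- the linear functional given by a vector of reals -/
  | dualVec {Γ : List Ty} {n : ℕ} : (Fin (n + 1) → ℝ) → Tm F Γ (Ty.dual (Ty.pow n))

namespace Tm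

variable {F : FunSig}

/-- The variable with index `i` occurs free. -/
def fv {Γ : List Ty} {σ : Ty} (i : ℕ) : Tm F Γ σ → Prop
  | .zero => False
  | .add s t => s.fv i ∨ t.fv i
  | .var x => x.idx = i
  | .lam s => s.fv (i + 1)
  | .app s t => s.fv i ∨ t.fv i
  | .fst s => s.fv i
  | .snd s => s.fv i
  | .pair s t => s.fv i ∨ t.fv i
  | .const _ => False
  | .fn _ s => s.fv i
  | .jac _ s => s.fv i
  | .dualMap s t => s.fv (i + 1) ∨ t.fv i
  | .pb s t => s.fv (i + 1) ∨ t.fv i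
  | .dualVec _ => False

/-- The variable with index `i` is a linear variable. On sums, all summands must be linear in it
(so every variable is linear in the empty sum `0`). -/
def lin {Γ : List Ty} {σ : Ty} (i : ℕ) : Tm F Γ σ → Prop
  | .zero => True
  | .add s t => s.lin i ∧ t.lin i
  | .var x => x.idx = i
  | .lam s => s.lin (i + 1)
  | .app s t => s.lin i ∧ ¬ t.fv i
  | .fst s => s.lin i
  | .snd s => s.lin i
  | .pair s t => s.lin i ∧ t.lin i
  | .const _ => False
  | .fn _ _ => False
  | .jac _ s => s.lin i
  | .dualMap s t => (s.lin (i + 1) ∧ ¬ t.fv i) ∨ (t.lin i ∧ ¬ s.fv (i + 1))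
  | .pb _ _ => False
  | .dualVec _ => False

/-- Well-formed terms, i.e. the typable ones: in every dual map `(λ x. s)* · t` the variable `x`
is a linear variable of `s`. -/
def WF {Γ : List Ty} {σ : Ty} : Tm F Γ σ → Prop
  | .zero => True
  | .add s t => s.WF ∧ t.WF
  | .var _ => True
  | .lam s => s.WF
  | .app s t => s.WF ∧ t.WF
  | .fst s => s.WF
  | .snd s => s.WF
  | .pair s t => s.WF ∧ t.WF
  | .const _ => True
  | .fn _ s => s.WF
  | .jac _ s => s.WF
  | .dualMap s t => s.WF ∧ t.WF ∧ s.lin 0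
  | .pb s t => s.WF ∧ t.WF
  | .dualVec _ => True

end Tm

/-! ### Renaming and substitution -/

/-- Renamings of variables. -/
def Ren (Γ Δ : List Ty) : Type := ∀ σ : Ty, Var Γ σ → Var Δ σ

/-- A renaming extended under a binder. -/
def Ren.under {Γ Δ : List Ty} {τ : Ty} (r : Ren Γ Δ) : Ren (τ :: Γ) (τ :: Δ)
  | _, .zero => .zero
  | _, .succ x => .succ (r _ x)

/-- Weakening by a fresh variable. -/
def Ren.wk {Γ : List Ty} {τ : Ty} : Ren Γ (τ :: Γ) := fun _ x => .succ x

/-- Exchange of the last two variables. -/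
def Ren.swap {Γ : List Ty} {σ τ : Ty} : Ren (σ :: τ :: Γ) (τ :: σ :: Γ)
  | _, .zero => .succ .zero
  | _, .succ .zero => .zero
  | _, .succ (.succ x) => .succ (.succ x)

/-- Renaming of terms. -/
def Tm.rename {F : FunSig} {Γ Δ : List Ty} {σ : Ty} (r : Ren Γ Δ) : Tm F Γ σ → Tm F Δ σ
  | .zero => .zero
  | .add s t => .add (s.rename r) (t.rename r)
  | .var x => .var (r _ x)
  | .lam s => .lam (s.rename r.under)
  | .app s t => .app (s.rename r) (t.rename r)
  | .fst s => .fst (s.rename r)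
  | .snd s => .snd (s.rename r)
  | .pair s t => .pair (s.rename r) (t.rename r)
  | .const c => .const c
  | .fn f s => .fn f (s.rename r)
  | .jac f s => .jac f (s.rename r)
  | .dualMap s t => .dualMap (s.rename r.under) (t.rename r)
  | .pb s t => .pb (s.rename r.under) (t.rename r)
  | .dualVec c => .dualVec c

/-- `t` in a context with one more (fresh, last) variable. -/
def Tm.wk {F : FunSig} {Γ : List Ty} {σ τ : Ty} (t : Tm F Γ σ) : Tm F (τ :: Γ) σ :=
  t.rename Ren.wk

/-- `t` in a context with one more (fresh) variable just before the last one. -/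
def Tm.wk1 {F : FunSig} {Γ : List Ty} {σ τ ρ : Ty} (t : Tm F (ρ :: Γ) σ) :
    Tm F (ρ :: τ :: Γ) σ :=
  t.rename Ren.wk.under

/-- `t` with the last two variables of its context exchanged. -/
def Tm.swap {F : FunSig} {Γ : List Ty} {σ τ ρ : Ty} (t : Tm F (ρ :: τ :: Γ) σ) :
    Tm F (τ :: ρ :: Γ) σ :=
  t.rename Ren.swap

/-- Simultaneous substitutions. -/
def Subst (F : FunSig) (Γ Δ : List Ty) : Type := ∀ σ : Ty, Var Γ σ → Tm F Δ σ

/-- A substitution extended under a binder. -/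
def Subst.under {F : FunSig} {Γ Δ : List Ty} {τ : Ty} (s : Subst F Γ Δ) : Subst F (τ :: Γ) (τ :: Δ)
  | _, .zero => .var .zero
  | _, .succ x => (s _ x).wk

/-- The substitution sending the last variable to `t`, and the others as `s` does. -/
def Subst.cons {F : FunSig} {Γ Δ : List Ty} {τ : Ty} (s : Subst F Γ Δ) (t : Tm F Δ τ) :
    Subst F (τ :: Γ) Δ
  | _, .zero => t
  | _, .succ x => s _ x

/-- The identity substitution. -/
def Subst.id {F : FunSig} {Γ : List Ty} : Subst F Γ Γ := fun _ x => .var x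

/-- The substitution `[π₁ z / y][π₂ z / x]` that replaces the last two variables by one. -/
def Subst.unpair {F : FunSig} (Γ : List Ty) (σ τ : Ty) :
    Subst F (τ :: σ :: Γ) (Ty.prod σ τ :: Γ)
  | _, .zero => .snd (.var .zero)
  | _, .succ .zero => .fst (.var .zero)
  | _, .succ (.succ x) => .var (.succ x)

/-- Capture-free substitution. -/
def Tm.subst {F : FunSig} {Γ Δ : List Ty} {σ : Ty} (r : Subst F Γ Δ) : Tm F Γ σ → Tm F Δ σ
  | .zero => .zero
  | .add s t => .add (s.subst r) (t.subst r)
  | .var x => r _ x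
  | .lam s => .lam (s.subst r.under)
  | .app s t => .app (s.subst r) (t.subst r)
  | .fst s => .fst (s.subst r)
  | .snd s => .snd (s.subst r)
  | .pair s t => .pair (s.subst r) (t.subst r)
  | .const c => .const c
  | .fn f s => .fn f (s.subst r)
  | .jac f s => .jac f (s.subst r)
  | .dualMap s t => .dualMap (s.subst r.under) (t.subst r)
  | .pb s t => .pb (s.subst r.under) (t.subst r)
  | .dualVec c => .dualVec c

/-- `s[t/x]` for the last variable `x`. -/
def Tm.inst {F : FunSig} {Γ : List Ty} {σ τ : Ty} (s : Tm F (σ :: Γ) τ) (t : Tm F Γ σ) :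
    Tm F Γ τ :=
  s.subst (Subst.id.cons t)

/-- `s[t/y]` for the variable `y` just before the last one. -/
def Tm.inst1 {F : FunSig} {Γ : List Ty} {σ τ ρ : Ty} (s : Tm F (ρ :: σ :: Γ) τ) (t : Tm F Γ σ) :
    Tm F (ρ :: Γ) τ :=
  s.subst (Subst.id.cons t).under

/-! ### Syntactic sugar -/

namespace Tm

variable {F : FunSig}

/-- The last variable of the context. -/
def v0 {Γ : List Ty} {σ : Ty} : Tm F (σ :: Γ) σ := .var .zero

/-- The variable before the last one. -/
def v1 {Γ : List Ty} {σ τ : Ty} : Tm F (τ :: σ :: Γ) σ := .var (.succ .zero)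

/-- `let x = t in s`, i.e. `(λ x. s) t`. -/
def letIn {Γ : List Ty} {σ τ : Ty} (t : Tm F Γ σ) (s : Tm F (σ :: Γ) τ) : Tm F Γ τ :=
  .app (.lam s) t

/-- The constant term of a vector. -/
def vec {Γ : List Ty} : (n : ℕ) → (Fin (n + 1) → ℝ) → Tm F Γ (Ty.pow n)
  | 0, r => .const (r 0)
  | n + 1, r => .pair (vec n (Fin.init r)) (.const (r (Fin.last (n + 1))))

/-- The constant 1-form `λ x. r*` of a vector `r`. -/
def vecForm {Γ : List Ty} {n : ℕ} (r : Fin (n + 1) → ℝ) : Tm F Γ (Ty.form (Ty.pow n)) :=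
  .lam (.dualVec r)

/-- The pullback of the 1-form `w` along `λ y. s`, applied to the point `a`. -/
def pbAt {Γ : List Ty} {σ τ : Ty} (s : Tm F (σ :: Γ) τ) (w : Tm F Γ (Ty.form τ)) (a : Tm F Γ σ) :
    Tm F Γ (Ty.dual σ) :=
  .app (.pb s w) a

end Tm

/-- An iterated projection from `σ` to `τ`; the empty iteration is allowed. -/
inductive ProjPath : Ty → Ty → Type
  | nil {σ : Ty} : ProjPath σ σ
  | fst {σ τ ρ : Ty} : ProjPath σ (Ty.prod τ ρ) → ProjPath σ τ
  | snd {σ τ ρ : Ty} : ProjPath σ (Ty.prod τ ρ) → ProjPath σ ρ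

/-- The iterated projection of a term. -/
def ProjPath.of {F : FunSig} {Γ : List Ty} {σ τ : Ty} : ProjPath σ τ → Tm F Γ σ → Tm F Γ τ
  | .nil, t => t
  | .fst p, t => .fst (p.of t)
  | .snd p, t => .snd (p.of t)

/-- The Jacobian matrix of `f` at `x`. -/
noncomputable def jacobian {n m : ℕ} (f : (Fin (n + 1) → ℝ) → (Fin (m + 1) → ℝ))
    (x : Fin (n + 1) → ℝ) : Matrix (Fin (m + 1)) (Fin (n + 1)) ℝ :=
  LinearMap.toMatrix' (fderiv ℝ f x : (Fin (n + 1) → ℝ) →ₗ[ℝ] (Fin (m + 1) → ℝ))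

/-! ### Reduction -/

open Tm in
/-- The identifications made on sums: `+` is associative and commutative with unit `0`, and
`s[a + b / y]` is `s[a/y] + s[b/y]`, and `s[0/y]` is `0`, for a linear variable `y` of `s`. -/
inductive SumEq {F : FunSig} : {Γ : List Ty} → {σ : Ty} → Tm F Γ σ → Tm F Γ σ → Prop
  | zero_add {Γ : List Ty} {σ : Ty} (s : Tm F Γ σ) : SumEq (.add .zero s) s
  | comm {Γ : List Ty} {σ : Ty} (s t : Tm F Γ σ) : SumEq (.add s t) (.add t s)
  | assoc {Γ : List Ty} {σ : Ty} (s t u : Tm F Γ σ) :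
      SumEq (.add (.add s t) u) (.add s (.add t u))
  | distrib {Γ : List Ty} {σ τ : Ty} (s : Tm F (σ :: Γ) τ) (a b : Tm F Γ σ) :
      s.WF → s.lin 0 → SumEq (s.inst (.add a b)) (.add (s.inst a) (s.inst b))
  | distrib_zero {Γ : List Ty} {σ τ : Ty} (s : Tm F (σ :: Γ) τ) :
      s.WF → s.lin 0 → SumEq (s.inst .zero) .zero

open Tm in
/-- Administrative reductions of redexes. They decompose a term into a series of `let`s binding
elementary terms. -/
inductive ARule {F : FunSig} : {Γ : List Ty} → {σ : Ty} → Tm F Γ σ → Tm F Γ σ → Prop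
  | zero {Γ : List Ty} {σ : Ty} : ARule (.zero : Tm F Γ σ) (letIn .zero v0)
  | add {Γ : List Ty} {σ : Ty} (s t : Tm F Γ σ) :
      ARule (.add s t) (letIn s (letIn t.wk (letIn (.add v1 v0) v0)))
  | var {Γ : List Ty} {σ : Ty} (x : Var Γ σ) : ARule (.var x : Tm F Γ σ) (letIn (.var x) v0)
  | lam {Γ : List Ty} {σ τ : Ty} (s : Tm F (σ :: Γ) τ) : ARule (.lam s) (letIn (.lam s) v0)
  | app {Γ : List Ty} {σ τ : Ty} (s : Tm F Γ (Ty.arrow σ τ)) (t : Tm F Γ σ) :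
      ARule (.app s t) (letIn s (letIn t.wk (letIn (.app v1 v0) v0)))
  | fst {Γ : List Ty} {σ τ : Ty} (s : Tm F Γ (Ty.prod σ τ)) :
      ARule (.fst s) (letIn s (letIn (.fst v0) v0))
  | snd {Γ : List Ty} {σ τ : Ty} (s : Tm F Γ (Ty.prod σ τ)) :
      ARule (.snd s) (letIn s (letIn (.snd v0) v0))
  | pair {Γ : List Ty} {σ τ : Ty} (s : Tm F Γ σ) (t : Tm F Γ τ) :
      ARule (.pair s t) (letIn s (letIn t.wk (letIn (.pair v1 v0) v0)))
  | const {Γ : List Ty} (r : ℝ) : ARule (.const r : Tm F Γ Ty.real) (letIn (.const r) v0)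
  | fn {Γ : List Ty} {n m : ℕ} (f : F.fns n m) (s : Tm F Γ (Ty.pow n)) :
      ARule (.fn f s) (letIn s (letIn (.fn f v0) v0))
  | jac {Γ : List Ty} {n m : ℕ} (f : F.fns n m) (s : Tm F Γ (Ty.pow n)) :
      ARule (.jac f s) (letIn s (letIn (.jac f v0) v0))
  | dualMap {Γ : List Ty} {σ τ : Ty} (s : Tm F (σ :: Γ) τ) (t : Tm F Γ (Ty.dual τ)) :
      ARule (.dualMap s t) (letIn t (letIn (.dualMap s.wk1 v0) v0))
  | pb {Γ : List Ty} {σ τ : Ty} (s : Tm F (σ :: Γ) τ) (t : Tm F Γ (Ty.form τ)) :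
      ARule (.pb s t) (letIn t (letIn (.pb s.wk1 v0) v0))
  | dualVec {Γ : List Ty} {n : ℕ} (r : Fin (n + 1) → ℝ) :
      ARule (.dualVec r : Tm F Γ (Ty.dual (Ty.pow n))) (letIn (.dualVec r) v0)
  /-- flattening of nested `let`s: `let x = (let z = e in s) in t` is `let z = e; x = s in t` -/
  | flatten {Γ : List Ty} {σ τ ρ : Ty} (e : Tm F Γ σ) (s : Tm F (σ :: Γ) τ)
      (t : Tm F (τ :: Γ) ρ) : ARule (letIn (letIn e s) t) (letIn e (letIn s t.wk1))

open Tm in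
/-- The reductions of redexes that have no premise. Terms of the form `e.wk` are those in which
the variable `y` of the pullback `λ y. …` does not occur. -/
inductive Rule {F : FunSig} : {Γ : List Ty} → {σ : Ty} → Tm F Γ σ → Tm F Γ σ → Prop
  /-- `(λ x. s) a ⟶ s[a/x]` -/
  | beta {Γ : List Ty} {σ τ : Ty} (s : Tm F (σ :: Γ) τ) (a : Tm F Γ σ) :
      Rule (.app (.lam s) a) (s.inst a)
  /-- `πᵢ⟨a, b⟩` -/
  | fst_pair {Γ : List Ty} {σ τ : Ty} (a : Tm F Γ σ) (b : Tm F Γ τ) : Rule (.fst (.pair a b)) a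
  | snd_pair {Γ : List Ty} {σ τ : Ty} (a : Tm F Γ σ) (b : Tm F Γ τ) : Rule (.snd (.pair a b)) b
  /-- `f` applied to a constant -/
  | fn_vec {Γ : List Ty} {n m : ℕ} (f : F.fns n m) (r : Fin (n + 1) → ℝ) :
      Rule (.fn f (vec n r) : Tm F Γ (Ty.pow m)) (vec m (f.1 r))
  /-- `(J f · r) r' ⟶ J(f)(r')(r)` -/
  | jac_vec {Γ : List Ty} {n m : ℕ} (f : F.fns n m) (r r' : Fin (n + 1) → ℝ) :
      Rule (.app (.jac f (vec n r)) (vec n r') : Tm F Γ (Ty.pow m))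
        (vec m ((jacobian f.1 r').mulVec r))
  /-- `(λ v. (J f · v) r)* · r'* ⟶ (J(f)(r)* r')*` -/
  | dual_jac {Γ : List Ty} {n m : ℕ} (f : F.fns n m) (r : Fin (n + 1) → ℝ)
      (r' : Fin (m + 1) → ℝ) :
      Rule (.dualMap (.app (.jac f v0) (vec n r)) (.dualVec r') : Tm F Γ (Ty.dual (Ty.pow n)))
        (.dualVec ((jacobian f.1 r).transpose.mulVec r'))
  /-- `(λ v₁. a)* · ((λ v₂. b)* · c) ⟶ (λ v₁. b[a/v₂])* · c` -/
  | dual_dual {Γ : List Ty} {σ τ ρ : Ty} (a : Tm F (σ :: Γ) τ) (b : Tm F (τ :: Γ) ρ)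
      (c : Tm F Γ (Ty.dual ρ)) :
      Rule (.dualMap a (.dualMap b c)) (.dualMap (b.wk1.inst a) c)
  /-- pullback along `λ y. let x = e in x` -/
  | pb_let_base {Γ : List Ty} {σ τ : Ty} (e : Tm F (σ :: Γ) τ) (w : Tm F Γ (Ty.form τ)) :
      Rule (.pb (letIn e v0) w) (.pb e w)
  /-- pullback along `λ y. let x = e in s` -/
  | pb_let {Γ : List Ty} {σ τ ρ : Ty} (e : Tm F (σ :: Γ) ρ) (s : Tm F (ρ :: σ :: Γ) τ)
      (w : Tm F Γ (Ty.form τ)) :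
      Rule (.pb (letIn e s) w)
        (.pb (.pair v0 e)
          (.pb (s.subst (Subst.unpair Γ σ ρ)) w))
  /-- pullback along `λ y. e` with `y` not free in `e` -/
  | pb_const {Γ : List Ty} {σ τ : Ty} (e : Tm F Γ τ) (w : Tm F Γ (Ty.form τ)) (a : Tm F Γ σ) :
      Rule (pbAt e.wk w a) .zero
  /-- pullback along `λ y. _` at `a`, body `z + πⱼ y` -/
  | pb_add_left {Γ : List Ty} {σ τ : Ty} (z : Tm F Γ τ) (q : ProjPath σ τ) (w : Tm F Γ (Ty.form τ))
      (a : Tm F Γ σ) :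
      Rule (pbAt (.add z.wk (q.of v0)) w a) (.dualMap (q.of v0) (.app w (.add z (q.of a))))
  /-- pullback along `λ y. _` at `a`, body `πᵢ y + πⱼ y` -/
  | pb_add {Γ : List Ty} {σ τ : Ty} (p q : ProjPath σ τ) (w : Tm F Γ (Ty.form τ)) (a : Tm F Γ σ) :
      Rule (pbAt (.add (p.of v0) (q.of v0)) w a)
        (.dualMap (.add (p.of v0) (q.of v0)) (.app w (.add (p.of a) (q.of a))))
  /-- pullback along `λ y. _` at `a`, body `y` and `πᵢ y` -/
  | pb_proj {Γ : List Ty} {σ τ : Ty} (p : ProjPath σ τ) (w : Tm F Γ (Ty.form τ)) (a : Tm F Γ σ) :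
      Rule (pbAt (p.of v0) w a) (.dualMap (p.of v0) (.app w (p.of a)))
  /-- pullback along `λ y. _` at `a`, body `⟨πᵢ y, z⟩` -/
  | pb_pair_left {Γ : List Ty} {σ τ ρ : Ty} (p : ProjPath σ τ) (z : Tm F Γ ρ)
      (w : Tm F Γ (Ty.form (Ty.prod τ ρ))) (a : Tm F Γ σ) :
      Rule (pbAt (.pair (p.of v0) z.wk) w a)
        (.dualMap (.pair (p.of v0) .zero) (.app w (.pair (p.of a) z)))
  /-- pullback along `λ y. _` at `a`, body `⟨z, πⱼ y⟩` -/
  | pb_pair_right {Γ : List Ty} {σ τ ρ : Ty} (z : Tm F Γ τ) (q : ProjPath σ ρ)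
      (w : Tm F Γ (Ty.form (Ty.prod τ ρ))) (a : Tm F Γ σ) :
      Rule (pbAt (.pair z.wk (q.of v0)) w a)
        (.dualMap (.pair .zero (q.of v0)) (.app w (.pair z (q.of a))))
  /-- pullback along `λ y. _` at `a`, body `⟨πᵢ y, πⱼ y⟩` -/
  | pb_pair {Γ : List Ty} {σ τ ρ : Ty} (p : ProjPath σ τ) (q : ProjPath σ ρ)
      (w : Tm F Γ (Ty.form (Ty.prod τ ρ))) (a : Tm F Γ σ) :
      Rule (pbAt (.pair (p.of v0) (q.of v0)) w a)
        (.dualMap (.pair (p.of v0) (q.of v0)) (.app w (.pair (p.of a) (q.of a))))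
  /-- pullback along `λ y. _` at `a`, body `J f · πᵢ y` -/
  | pb_jac {Γ : List Ty} {σ : Ty} {n m : ℕ} (f : F.fns n m) (p : ProjPath σ (Ty.pow n))
      (w : Tm F Γ (Ty.form (Ty.arrow (Ty.pow n) (Ty.pow m)))) (a : Tm F Γ σ) :
      Rule (pbAt (.jac f (p.of v0)) w a) (.dualMap (.jac f (p.of v0)) (.app w (.jac f (p.of a))))
  /-- pullback along `λ y. _` at `a`, body `f(πᵢ y)` -/
  | pb_fn {Γ : List Ty} {σ : Ty} {n m : ℕ} (f : F.fns n m) (p : ProjPath σ (Ty.pow n))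
      (w : Tm F Γ (Ty.form (Ty.pow m))) (a : Tm F Γ σ) :
      Rule (pbAt (.fn f (p.of v0)) w a)
        (.dualMap (.app (.jac f (p.of v0)) (p.of a).wk) (.app w (.fn f (p.of a))))
  /-- pullback along `λ y. _` at `a`, body `(λ x. s)* · πᵢ y` with `y` not free in `λ x. s` -/
  | pb_dual_left {Γ : List Ty} {σ τ ρ : Ty} (s : Tm F (ρ :: Γ) τ) (p : ProjPath σ (Ty.dual τ))
      (w : Tm F Γ (Ty.form (Ty.dual ρ))) (a : Tm F Γ σ) :
      Rule (pbAt (.dualMap s.wk1 (p.of v0)) w a)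
        (.dualMap (.dualMap s.wk1 (p.of v0)) (.app w (.dualMap s (p.of a))))
  /-- pullback along `λ y. _` at `a`, body `(πᵢ y) z` -/
  | pb_app_left {Γ : List Ty} {σ τ ρ : Ty} (p : ProjPath σ (Ty.arrow ρ τ)) (z : Tm F Γ ρ)
      (w : Tm F Γ (Ty.form τ)) (a : Tm F Γ σ) :
      Rule (pbAt (.app (p.of v0) z.wk) w a)
        (.dualMap (.app (p.of v0) z.wk) (.app w (.app (p.of a) z)))
  /-- pullback along `λ y. _` at `a`, body `⟨y, e⟩` with `y` not free in `e` -/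
  | pb_self_pair_const {Γ : List Ty} {σ τ : Ty} (e : Tm F Γ τ)
      (w : Tm F Γ (Ty.form (Ty.prod σ τ))) (a : Tm F Γ σ) :
      Rule (pbAt (.pair v0 e.wk) w a) (.dualMap (.pair v0 .zero) (.app w (.pair a e)))

open Tm in
/-- The reduction `s ⟶* t`: the reflexive and transitive closure, under all contexts, of the
administrative reductions, of the reductions without premise, of the pullback reductions with
premises, and of the identifications on sums.

The order of evaluation is left open: redexes may be contracted in every position, and
metavariables that an evaluation strategy would restrict to values, elementary terms or let series
range over all terms. So every reduction sequence of a particular strategy is an instance.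

In a premise, the fresh variable `ω'` is the variable that was added to the context; it is `v0` in
the terms below that are applied to it, and it does not occur in the tangent `s'` since the latter
is weakened by it. -/
inductive Red {F : FunSig} : {Γ : List Ty} → {σ : Ty} → Tm F Γ σ → Tm F Γ σ → Prop
  | refl {Γ : List Ty} {σ : Ty} (s : Tm F Γ σ) : Red s s
  | trans {Γ : List Ty} {σ : Ty} {s t u : Tm F Γ σ} : Red s t → Red t u → Red s u
  | ofSumEq {Γ : List Ty} {σ : Ty} {s t : Tm F Γ σ} : SumEq s t → Red s t
  | ofSumEqSymm {Γ : List Ty} {σ : Ty} {s t : Tm F Γ σ} : SumEq s t → Red t s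
  | ofARule {Γ : List Ty} {σ : Ty} {s t : Tm F Γ σ} : ARule s t → Red s t
  | ofRule {Γ : List Ty} {σ : Ty} {s t : Tm F Γ σ} : Rule s t → Red s t
  | add {Γ : List Ty} {σ : Ty} {s s' t t' : Tm F Γ σ} :
      Red s s' → Red t t' → Red (.add s t) (.add s' t')
  | lam {Γ : List Ty} {σ τ : Ty} {s s' : Tm F (σ :: Γ) τ} : Red s s' → Red (.lam s) (.lam s')
  | app {Γ : List Ty} {σ τ : Ty} {s s' : Tm F Γ (Ty.arrow σ τ)} {t t' : Tm F Γ σ} :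
      Red s s' → Red t t' → Red (.app s t) (.app s' t')
  | fst {Γ : List Ty} {σ τ : Ty} {s s' : Tm F Γ (Ty.prod σ τ)} :
      Red s s' → Red (.fst s) (.fst s')
  | snd {Γ : List Ty} {σ τ : Ty} {s s' : Tm F Γ (Ty.prod σ τ)} :
      Red s s' → Red (.snd s) (.snd s')
  | pair {Γ : List Ty} {σ τ : Ty} {s s' : Tm F Γ σ} {t t' : Tm F Γ τ} :
      Red s s' → Red t t' → Red (.pair s t) (.pair s' t')
  | fn {Γ : List Ty} {n m : ℕ} (f : F.fns n m) {s s' : Tm F Γ (Ty.pow n)} :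
      Red s s' → Red (.fn f s) (.fn f s')
  | jac {Γ : List Ty} {n m : ℕ} (f : F.fns n m) {s s' : Tm F Γ (Ty.pow n)} :
      Red s s' → Red (.jac f s) (.jac f s')
  | dualMap {Γ : List Ty} {σ τ : Ty} {s s' : Tm F (σ :: Γ) τ} {t t' : Tm F Γ (Ty.dual τ)} :
      Red s s' → Red t t' → Red (.dualMap s t) (.dualMap s' t')
  | pb {Γ : List Ty} {σ τ : Ty} {s s' : Tm F (σ :: Γ) τ} {t t' : Tm F Γ (Ty.form τ)} :
      Red s s' → Red t t' → Red (.pb s t) (.pb s' t')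
  /-- pullback along `λ y. _` at `a`, body `(λ x. s)* · z` with `y` not free in `z` -/
  | pb_dual_right {Γ : List Ty} {σ τ ρ : Ty} (s : Tm F (ρ :: σ :: Γ) τ) (z : Tm F Γ (Ty.dual τ))
      (w : Tm F Γ (Ty.form (Ty.dual ρ))) (a : Tm F Γ σ) (s' : Tm F (σ :: ρ :: Γ) τ)
      (b : Tm F (Ty.form τ :: ρ :: Γ) τ) :
      Red (pbAt s.swap.wk1 v0 a.wk.wk) (.dualMap s'.wk1 (.app v0 b)) →
      Red (pbAt (.dualMap s z.wk) w a)
        (.dualMap (.dualMap s'.swap z.wk) (.app w (.dualMap (s.inst1 a) z)))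
  /-- pullback along `λ y. _` at `a`, body `(λ x. s)* · πᵢ y` -/
  | pb_dual {Γ : List Ty} {σ τ ρ : Ty} (s : Tm F (ρ :: σ :: Γ) τ) (p : ProjPath σ (Ty.dual τ))
      (w : Tm F Γ (Ty.form (Ty.dual ρ))) (a : Tm F Γ σ) (s' : Tm F (σ :: ρ :: Γ) τ)
      (b : Tm F (Ty.form τ :: ρ :: Γ) τ) :
      Red (pbAt s.swap.wk1 v0 a.wk.wk) (.dualMap s'.wk1 (.app v0 b)) →
      Red (pbAt (.dualMap s (p.of v0)) w a)
        (.dualMap (.add (.dualMap (s.inst1 a).wk1 (p.of v0)) (.dualMap s'.swap (p.of a).wk))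
          (.app w (.dualMap (s.inst1 a) (p.of a))))
  /-- pullback along `λ y. _` at `a`, where the body is itself the pullback of `z` along `λ x. s` -/
  | pb_pb {Γ : List Ty} {σ τ ρ : Ty} (s : Tm F (ρ :: σ :: Γ) τ) (z : Tm F (σ :: Γ) (Ty.form τ))
      (w : Tm F Γ (Ty.form (Ty.form ρ))) (a : Tm F Γ σ) (s' : Tm F (ρ :: ρ :: σ :: Γ) τ)
      (b : Tm F (ρ :: σ :: Γ) τ) :
      Red (pbAt s.wk1 z.wk v0) (.dualMap s' (.app z.wk b)) →
      Red (pbAt (.pb s z) w a) (pbAt (.lam (.dualMap s' (.app z.wk b))) w a)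
  /-- pullback along `λ y. _` at `a`, body `λ x. s` -/
  | pb_lam {Γ : List Ty} {σ τ ρ : Ty} (s : Tm F (ρ :: σ :: Γ) τ)
      (w : Tm F Γ (Ty.form (Ty.arrow ρ τ))) (a : Tm F Γ σ) (s' : Tm F (σ :: ρ :: Γ) τ)
      (b : Tm F (Ty.form τ :: ρ :: Γ) τ) :
      Red (pbAt s.swap.wk1 v0 a.wk.wk) (.dualMap s'.wk1 (.app v0 b)) →
      Red (pbAt (.lam s) w a) (.dualMap (.lam s'.swap) (.app w (.lam (s.inst1 a))))
  /-- pullback along `λ y. _` at `a`, body `(πᵢ y) (πⱼ y)` where `πᵢ a` is `λ z. e` -/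
  | pb_app {Γ : List Ty} {σ τ ρ : Ty} (p : ProjPath σ (Ty.arrow ρ τ)) (q : ProjPath σ ρ)
      (w : Tm F Γ (Ty.form τ)) (a : Tm F Γ σ) (e s' : Tm F (ρ :: Γ) τ)
      (b : Tm F (Ty.form τ :: Γ) τ) :
      Red (p.of a) (.lam e) →
      Red (pbAt e.wk1 v0 (q.of a).wk) (.dualMap s'.wk1 (.app v0 b)) →
      Red (pbAt (.app (p.of v0) (q.of v0)) w a)
        (.dualMap (.add (.app (p.of v0) (q.of a).wk) (s'.wk1.inst (q.of v0)))
          (.app w (.app (p.of a) (q.of a))))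
  /-- pullback along `λ y. _` at `a`, body `(πᵢ y) (πⱼ y)` where `πᵢ a` is a constant function `λ z. e` -/
  | pb_app_const {Γ : List Ty} {σ τ ρ : Ty} (p : ProjPath σ (Ty.arrow ρ τ)) (q : ProjPath σ ρ)
      (w : Tm F Γ (Ty.form τ)) (a : Tm F Γ σ) (e : Tm F (ρ :: Γ) τ) :
      Red (p.of a) (.lam e) →
      Red (pbAt e.wk1 v0 (q.of a).wk : Tm F (Ty.form τ :: Γ) (Ty.dual ρ)) .zero →
      Red (pbAt (.app (p.of v0) (q.of v0)) w a)
        (.dualMap (.app (p.of v0) (q.of a).wk) (.app w (.app (p.of a) (q.of a))))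
  /-- pullback along `λ y. _` at `a`, body `⟨y, e⟩` -/
  | pb_self_pair {Γ : List Ty} {σ τ : Ty} (e : Tm F (σ :: Γ) τ)
      (w : Tm F Γ (Ty.form (Ty.prod σ τ))) (a : Tm F Γ σ) (s' : Tm F (σ :: Γ) τ)
      (b : Tm F (Ty.form τ :: Γ) τ) :
      Red (pbAt e.wk1 v0 a.wk) (.dualMap s'.wk1 (.app v0 b)) →
      Red (pbAt (.pair v0 e) w a) (.dualMap (.pair v0 s') (.app w (.pair a (e.inst a))))

/-! ## Interpretation -/

/-- The objects that interpret the ground type `R` and the dual types. -/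
structure TyModel (C : Type*) where
  /-- the object `ℝ` -/
  R : C
  /-- the object `L(A, ℝ)` of linear morphisms -/
  dual : C → C

section Interpretation

variable {C : Type*} [Category C] [CartesianMonoidalCategory C] [MonoidalClosed C]

/-- The interpretation of types. -/
def TyModel.ty (T : TyModel C) : Ty → C
  | .real => T.R
  | .prod σ τ => T.ty σ ⊗ T.ty τ
  | .arrow σ τ => expObj (T.ty σ) (T.ty τ)
  | .dual σ => T.dual (T.ty σ)

/-- The interpretation of contexts. -/
def TyModel.ctx (T : TyModel C) : List Ty → C
  | [] => 𝟙_ C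
  | σ :: Γ => T.ctx Γ ⊗ T.ty σ

/-- The element of `ℝ^(n+1)` with given coordinates. -/
def TyModel.ofVec (T : TyModel C) (num : (𝟙_ C ⟶ T.R) ≃ ℝ) :
    (n : ℕ) → (Fin (n + 1) → ℝ) → (𝟙_ C ⟶ T.ty (Ty.pow n))
  | 0, r => num.symm (r 0)
  | n + 1, r => lift (T.ofVec num n (Fin.init r)) (num.symm (r (Fin.last (n + 1))))

/-- The coordinates of an element of `ℝ^(n+1)`. -/
def TyModel.toVec (T : TyModel C) (num : (𝟙_ C ⟶ T.R) ≃ ℝ) :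
    (n : ℕ) → (𝟙_ C ⟶ T.ty (Ty.pow n)) → (Fin (n + 1) → ℝ)
  | 0, x => fun _ => num x
  | n + 1, x => Fin.snoc (T.toVec num n (x ≫ fst (T.ty (Ty.pow n)) T.R))
      (num (x ≫ snd (T.ty (Ty.pow n)) T.R))

/-- The function `ℝ^(n+1) → ℝ^(m+1)` underlying a morphism. -/
def TyModel.toFun (T : TyModel C) (num : (𝟙_ C ⟶ T.R) ≃ ℝ) {n m : ℕ}
    (f : T.ty (Ty.pow n) ⟶ T.ty (Ty.pow m)) (x : Fin (n + 1) → ℝ) : Fin (m + 1) → ℝ :=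
  T.toVec num m (T.ofVec num n x ≫ f)

end Interpretation

/-- What the interpretation of the language in a differential lambda-category `C` presupposes:
the real line is an object of `C`, the linear morphisms `A ⟶ ℝ` form a subobject `L(A, ℝ)` of the
exponential `A ⇒ ℝ`, and the given functions are morphisms of `C`. -/
structure DPPLModel (F : FunSig) (C : Type*) [Category C] [CartesianMonoidalCategory C]
    [MonoidalClosed C] [DifferentialLambdaCategory C] extends TyModel C where
  /-- the elements of `ℝ` are the real numbers, with their addition -/
  num : (𝟙_ C ⟶ R) ≃ ℝ
  num_add : ∀ x y : 𝟙_ C ⟶ R, num (x + y) = num x + num y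
  /-- multiplication by a real number is a morphism -/
  scal : ℝ → (R ⟶ R)
  num_scal : ∀ (r : ℝ) (x : 𝟙_ C ⟶ R), num (x ≫ scal r) = r * num x
  /-- on morphisms between the `ℝ^n`, the operator `D` is the usual derivative -/
  hasFDerivAt : ∀ {n m : ℕ} (f : toTyModel.ty (Ty.pow n) ⟶ toTyModel.ty (Ty.pow m))
    (x : Fin (n + 1) → ℝ), DifferentiableAt ℝ (toTyModel.toFun num f) x ∧
      ∀ v : Fin (n + 1) → ℝ, fderiv ℝ (toTyModel.toFun num f) x v =
        toTyModel.toVec num m (lift (toTyModel.ofVec num n v) (toTyModel.ofVec num n x) ≫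
          CartesianDifferentialCategory.D f)
  /-- the functions of the language are morphisms -/
  sym : ∀ {n m : ℕ}, F.fns n m → (toTyModel.ty (Ty.pow n) ⟶ toTyModel.ty (Ty.pow m))
  toFun_sym : ∀ {n m : ℕ} (f : F.fns n m), toTyModel.toFun num (sym f) = f.1
  /-- the inclusion `L(A, ℝ) ⟶ (A ⇒ ℝ)` -/
  incl : ∀ A : C, dual A ⟶ expObj A R
  incl_mono : ∀ A : C, Mono (incl A)
  /-- the additive and differential structure of `L(A, ℝ)` is that of `A ⇒ ℝ` -/
  incl_linear : ∀ A : C, IsLinearMor (incl A)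
  /-- `λ(h)` takes values in `L(A, ℝ)` exactly if `h` is linear in its second variable -/
  incl_factors : ∀ {X A : C} (h : X ⊗ A ⟶ R),
    (∃ g : X ⟶ dual A, g ≫ incl A = lamMor h) ↔ IsLinearSnd h

namespace DPPLModel

variable {F : FunSig} {C : Type*} [Category C] [CartesianMonoidalCategory C] [MonoidalClosed C]
  [DifferentialLambdaCategory C] (M : DPPLModel F C)

/-- The Hahn-Banach separation property: linear morphisms to `ℝ` separate the elements of every
object. -/
def HahnBanach : Prop :=
  ∀ ⦃A : C⦄ (x y : 𝟙_ C ⟶ A), x ≠ y → ∃ l : A ⟶ M.R, IsLinearMor l ∧ x ≫ l ≠ y ≫ l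

/-- Application `L(A, ℝ) × A ⟶ ℝ` of a linear morphism. -/
def evDual (A : C) : M.dual A ⊗ A ⟶ M.R :=
  lift (fst (M.dual A) A ≫ M.incl A) (snd (M.dual A) A) ≫ evMor A M.R

open Classical in
/-- The morphism `x ↦ h(x, -)` into `L(A, ℝ)`, for `h` linear in its second variable (and `0` by
convention for other `h`). -/
noncomputable def lamDual {X A : C} (h : X ⊗ A ⟶ M.R) : X ⟶ M.dual A :=
  if hl : IsLinearSnd h then ((M.incl_factors h).2 hl).choose else 0

/-- The linear functional `v ↦ ∑ i, r i * v i`. -/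
def linForm : (n : ℕ) → (Fin (n + 1) → ℝ) → (M.ty (Ty.pow n) ⟶ M.R)
  | 0, r => M.scal (r 0)
  | n + 1, r => fst (M.ty (Ty.pow n)) M.R ≫ linForm n (Fin.init r) +
      snd (M.ty (Ty.pow n)) M.R ≫ M.scal (r (Fin.last (n + 1)))

/-- The interpretation of variables. -/
def var : {Γ : List Ty} → {σ : Ty} → Var Γ σ → (M.ctx Γ ⟶ M.ty σ)
  | _, _, .zero => snd _ _
  | _, _, .succ x => fst _ _ ≫ var x

/-- The interpretation of terms. Dual maps are meaningful for well-formed terms: there, the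
morphism `(γ, v) ↦ ⟦t⟧γ (⟦s⟧(γ, v))` is linear in `v`. -/
noncomputable def den : {Γ : List Ty} → {σ : Ty} → Tm F Γ σ → (M.ctx Γ ⟶ M.ty σ)
  | _, _, .zero => 0
  | _, _, .add s t => den s + den t
  | _, _, .var x => M.var x
  | _, _, .lam s => lamMor (den s)
  | _, _, .app s t => lift (den s) (den t) ≫ evMor _ _
  | _, _, .fst s => den s ≫ fst _ _
  | _, _, .snd s => den s ≫ snd _ _
  | _, _, .pair s t => lift (den s) (den t)
  | _, _, .const r => toUnit _ ≫ M.num.symm r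
  | _, _, .fn f s => den s ≫ M.sym f
  | _, _, .jac f s => den s ≫ lamMor (CartesianDifferentialCategory.D (M.sym f))
  | _, _, .dualMap s t => M.lamDual (lift (fst _ _ ≫ den t) (den s) ≫ M.evDual _)
  | _, _, .pb s t =>
      -- `((γ, x), v) ↦ ⟦t⟧γ (⟦s⟧(γ, x)) (D[⟦s⟧(γ, -)](v, x))`
      lamMor (M.lamDual
        (lift
          (fst _ _ ≫ lift (fst _ _ ≫ den t) (den s) ≫ evMor _ _)
          (dSnd (den s)) ≫ M.evDual _))
  | _, _, .dualVec r => M.lamDual (snd _ _ ≫ M.linForm _ r)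

/-- The morphism `⟦s⟧(γ, -)`. -/
noncomputable def section_ {Γ : List Ty} {σ τ : Ty} (s : Tm F (σ :: Γ) τ) (γ : 𝟙_ C ⟶ M.ctx Γ) :
    M.ty σ ⟶ M.ty τ :=
  lift (toUnit _ ≫ γ) (𝟙 _) ≫ M.den s

/-- The constant 1-form `λ x. l`, as an element of `⟦Ω τ⟧`. -/
noncomputable def constForm {τ : Ty} (l : M.ty τ ⟶ M.R) : 𝟙_ C ⟶ M.ty (Ty.form τ) :=
  lamMor (M.lamDual (snd _ _ ≫ l))

end DPPLModel

-- Reduction is sound for the interpretation, and the theorem is read off from equal denotations.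
-- The pullback of a 1-form `w` along `f` at the point `a` is the functional `v ↦ w(f a)(D f(v,
-- a))`. So a reduct `(λ v. s')* · (w b)` is correct as soon as `s'` denotes the `tangent` of `f` at
-- `a` and `b` denotes `f a` (`sound_pbAt`). For most pullback rules this is a computation with the
-- axioms of `D`: the chain rule for let series, and the product rules `dAt_ap` and `dAt_apD` for
-- applications and dual maps.
--
-- The rules with premises need a converse: from the reduction of a pullback of a variable form `ω'`
-- to `(λ v. s')* · (ω' b)`, recover that `s'` denotes the tangent. Interpreting `ω'` by the
-- constant form `λ x. l` gives `l ∘ s' = l ∘ tangent` for every linear `l`, since `s'` does not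
-- contain `ω'`; Hahn-Banach separation and well-pointedness remove `l` (`tangent_of_den_pbAt`).
--
-- The invariant cannot be the syntactic condition on dual maps, because administrative reductions
-- destroy it: `π₁ y` is linear in `y`, but its let form is an application with `y` in the argument.
-- It is replaced by `SWF`, which asks that the denotation of the body of each dual map be linear in
-- the bound variable. Well-formed terms satisfy it by `swf_and_linearVar`, and `sound_red` shows by
-- induction that reduction preserves both it and the denotation.
--
-- For the first claim, the form `λ x. e_p*` picks the `p`-th coordinate of the derivative, which
-- the model identifies with the Fréchet derivative. For the second, `ω` is interpreted by the
-- constant form of `l`.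

attribute [reducible] TyModel.ty TyModel.ctx Ty.form Ty.pow

/-- The Yoneda principle: the pair of projections is the universal generalized element of `X ⊗ A`.
It justifies calculating with `lift x v` as if with elements. -/
theorem pair_hom_ext {C : Type*} [Category C] [CartesianMonoidalCategory C]
    {X A B : C} {f g : X ⊗ A ⟶ B} (h : ∀ ⦃Y : C⦄ (x : Y ⟶ X) (v : Y ⟶ A), lift x v ≫ f = lift x v ≫ g) :
    f = g := by
  simpa using h (fst X A) (snd X A)

/-! ### Differential calculus on generalized elements -/

section DifferentialCalculus

open CartesianDifferentialCategory

variable {C : Type*} [Category C] [CartesianMonoidalCategory C] [CartesianDifferentialCategory C]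

/-- The derivative of `f` at the (generalized) point `x` in the direction `v`. -/
def dAt {X A B : C} (f : A ⟶ B) (v x : X ⟶ A) : X ⟶ B := lift v x ≫ D f

theorem D_eq_dAt {A B : C} (f : A ⟶ B) : D f = dAt f (fst A A) (snd A A) := by
  simp [dAt]

theorem comp_dAt {X Y A B : C} (h : Y ⟶ X) (f : A ⟶ B) (v x : X ⟶ A) :
    h ≫ dAt f v x = dAt f (h ≫ v) (h ≫ x) := by
  simp [dAt, ← Category.assoc, comp_lift]

theorem lift_add_lift {X A B : C} (f f' : X ⟶ A) (g g' : X ⟶ B) :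
    lift f g + lift f' g' = lift (f + f') (g + g') := by
  apply CartesianMonoidalCategory.hom_ext <;> simp [add_fst, add_snd]

theorem lift_zero_zero {X A B : C} : lift (0 : X ⟶ A) (0 : X ⟶ B) = 0 := by
  apply CartesianMonoidalCategory.hom_ext <;> simp [zero_fst, zero_snd]

theorem dAt_add_left {X A B : C} (f : A ⟶ B) (v w x : X ⟶ A) :
    dAt f (v + w) x = dAt f v x + dAt f w x := D_add_left f v w x

theorem dAt_zero_left {X A B : C} (f : A ⟶ B) (x : X ⟶ A) : dAt f 0 x = 0 := D_zero_left f x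

theorem dAt_add {X A B : C} (f g : A ⟶ B) (v x : X ⟶ A) :
    dAt (f + g) v x = dAt f v x + dAt g v x := by
  simp [dAt, D_add, comp_add]

theorem dAt_zero {X A B : C} (v x : X ⟶ A) : dAt (0 : A ⟶ B) v x = 0 := by
  simp [dAt, D_zero, comp_zero]

theorem dAt_id {X A : C} (v x : X ⟶ A) : dAt (𝟙 A) v x = v := by simp [dAt, D_id]

theorem dAt_fst {X A B : C} (v x : X ⟶ A ⊗ B) : dAt (fst A B) v x = v ≫ fst A B := by
  simp [dAt, D_fst]

theorem dAt_snd {X A B : C} (v x : X ⟶ A ⊗ B) : dAt (snd A B) v x = v ≫ snd A B := by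
  simp [dAt, D_snd]

theorem dAt_lift {X A B E : C} (f : A ⟶ B) (g : A ⟶ E) (v x : X ⟶ A) :
    dAt (lift f g) v x = lift (dAt f v x) (dAt g v x) := by
  simp [dAt, D_lift, comp_lift]

theorem dAt_comp {X A B E : C} (f : A ⟶ B) (g : B ⟶ E) (v x : X ⟶ A) :
    dAt (f ≫ g) v x = dAt g (dAt f v x) (x ≫ f) := by
  simp only [dAt, D_comp, ← Category.assoc, comp_lift, lift_snd]

theorem dAt_D_linear {X A B : C} (f : A ⟶ B) (g h k : X ⟶ A) :
    dAt (D f) (lift g 0) (lift h k) = dAt f g k := D_D_linear f g h k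

theorem dAt_D_symm {X A B : C} (f : A ⟶ B) (g h k : X ⟶ A) :
    dAt (D f) (lift 0 h) (lift g k) = dAt (D f) (lift 0 g) (lift h k) := D_D_symm f g h k

theorem IsLinearMor.dAt_eq {X A B : C} {f : A ⟶ B} (hf : IsLinearMor f) (v x : X ⟶ A) :
    dAt f v x = v ≫ f := by
  rw [dAt, hf, lift_fst_assoc]

theorem isLinearMor_iff {A B : C} {f : A ⟶ B} :
    IsLinearMor f ↔ ∀ ⦃X : C⦄ (v x : X ⟶ A), dAt f v x = v ≫ f :=
  ⟨fun h _ v x => h.dAt_eq v x, fun h => by rw [IsLinearMor, D_eq_dAt, h]⟩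

/-- Additivity on this side of the composition is not an axiom. It holds because a linear morphism
equals its own derivative at `0`, and derivatives are additive in the direction. -/
theorem IsLinearMor.add_comp {X A B : C} {f : A ⟶ B} (hf : IsLinearMor f) (v w : X ⟶ A) :
    (v + w) ≫ f = v ≫ f + w ≫ f := by
  rw [← hf.dAt_eq (v + w) 0, dAt_add_left, hf.dAt_eq, hf.dAt_eq]

theorem IsLinearMor.zero_comp {X A B : C} {f : A ⟶ B} (hf : IsLinearMor f) :
    (0 : X ⟶ A) ≫ f = 0 := by
  rw [← hf.dAt_eq 0 0, dAt_zero_left]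

theorem isLinearMor_zero {A B : C} : IsLinearMor (0 : A ⟶ B) := by
  simp [isLinearMor_iff, dAt_zero, comp_zero]

theorem isLinearMor_id {A : C} : IsLinearMor (𝟙 A) := by simp [isLinearMor_iff, dAt_id]

theorem isLinearMor_fst {A B : C} : IsLinearMor (fst A B) := D_fst A B

theorem isLinearMor_snd {A B : C} : IsLinearMor (snd A B) := D_snd A B

theorem IsLinearMor.comp {A B E : C} {f : A ⟶ B} {g : B ⟶ E} (hf : IsLinearMor f)
    (hg : IsLinearMor g) : IsLinearMor (f ≫ g) := by
  simp [isLinearMor_iff, dAt_comp, hf.dAt_eq, hg.dAt_eq]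

theorem IsLinearMor.lift {A B E : C} {f : A ⟶ B} {g : A ⟶ E} (hf : IsLinearMor f)
    (hg : IsLinearMor g) : IsLinearMor (lift f g) := by
  simp [isLinearMor_iff, dAt_lift, hf.dAt_eq, hg.dAt_eq, comp_lift]

theorem IsLinearMor.add {A B : C} {f g : A ⟶ B} (hf : IsLinearMor f)
    (hg : IsLinearMor g) : IsLinearMor (f + g) := by
  simp [isLinearMor_iff, dAt_add, hf.dAt_eq, hg.dAt_eq, comp_add]

theorem dSnd_eq {X A B : C} (f : X ⊗ A ⟶ B) :
    dSnd f = dAt f (lift 0 (snd (X ⊗ A) A)) (fst (X ⊗ A) A) := rfl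

theorem IsLinearSnd.dAt_eq {Y X A B : C} {f : X ⊗ A ⟶ B} (hf : IsLinearSnd f)
    (v : Y ⟶ A) (x : Y ⟶ X) (a : Y ⟶ A) :
    dAt f (lift 0 v) (lift x a) = lift x v ≫ f := by
  have h := congrArg (fun t => lift (lift x a) v ≫ t) hf
  simpa [dSnd_eq, comp_dAt, comp_lift, comp_zero, ← Category.assoc] using h

theorem isLinearSnd_iff {X A B : C} {f : X ⊗ A ⟶ B} : IsLinearSnd f ↔
    ∀ ⦃Y : C⦄ (v : Y ⟶ A) (x : Y ⟶ X) (a : Y ⟶ A),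
      dAt f (lift 0 v) (lift x a) = lift x v ≫ f :=
  ⟨fun h _ v x a => h.dAt_eq v x a, fun h => by
    rw [IsLinearSnd, dSnd_eq]
    rw [← h (snd (X ⊗ A) A) (fst (X ⊗ A) A ≫ fst X A) (fst (X ⊗ A) A ≫ snd X A)]
    congr 1
    apply CartesianMonoidalCategory.hom_ext <;> simp⟩

theorem IsLinearSnd.add_comp {Y X A B : C} {f : X ⊗ A ⟶ B} (hf : IsLinearSnd f)
    (x : Y ⟶ X) (v w : Y ⟶ A) : lift x (v + w) ≫ f = lift x v ≫ f + lift x w ≫ f := by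
  rw [← hf.dAt_eq _ _ 0, ← hf.dAt_eq _ _ 0, ← hf.dAt_eq _ _ 0, ← dAt_add_left, lift_add_lift,
    add_zero]

theorem IsLinearSnd.zero_comp {Y X A B : C} {f : X ⊗ A ⟶ B} (hf : IsLinearSnd f)
    (x : Y ⟶ X) : lift x 0 ≫ f = 0 := by
  rw [← hf.dAt_eq _ _ 0, lift_zero_zero, dAt_zero_left]

theorem IsLinearSnd.comp_left {X X' A B : C} {f : X ⊗ A ⟶ B} (hf : IsLinearSnd f)
    (k : X' ⟶ X) : IsLinearSnd (lift (fst X' A ≫ k) (snd X' A) ≫ f) := by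
  rw [isLinearSnd_iff]
  intro Y v x a
  rw [dAt_comp, dAt_lift, dAt_comp]
  simp [dAt_fst, dAt_snd, dAt_zero_left, comp_lift, hf.dAt_eq, ← Category.assoc]

/-- Precomposition with `j` undoes the reparametrization by `k`. This is why weakening reflects
linearity and does not merely preserve it. -/
theorem IsLinearSnd.of_comp_left {X X' A B : C} {f : X ⊗ A ⟶ B} {k : X' ⟶ X} {j : X ⟶ X'}
    (hj : j ≫ k = 𝟙 X) (hf : IsLinearSnd (lift (fst X' A ≫ k) (snd X' A) ≫ f)) :
    IsLinearSnd f := by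
  have := hf.comp_left j
  convert this
  simp [← Category.assoc, comp_lift]
  simp [hj]

theorem isLinearSnd_snd_comp {X A B : C} {l : A ⟶ B} (hl : IsLinearMor l) :
    IsLinearSnd (snd X A ≫ l) := by
  rw [isLinearSnd_iff]
  intro Y v x a
  simp [dAt_comp, dAt_snd, hl.dAt_eq]

theorem dAt_dAt {X Y A B : C} (f : A ⟶ B) (v x : X ⟶ A) (w y : Y ⟶ X) :
    dAt (dAt f v x) w y = dAt (D f) (lift (dAt v w y) (dAt x w y)) (lift (y ≫ v) (y ≫ x)) := by
  rw [dAt.eq_def f, dAt_comp, dAt_lift, comp_lift]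

/-- The derivative of `f(γ, -)` at a point depending on a parameter is linear in the direction. -/
theorem isLinearSnd_dAt {X Z A B : C} (f : X ⊗ A ⟶ B) (k : Z ⟶ X ⊗ A) :
    IsLinearSnd (dAt f (lift 0 (snd Z A)) (fst Z A ≫ k)) := by
  rw [isLinearSnd_iff]
  intro Y v x b
  rw [dAt_dAt, dAt_lift, dAt_comp]
  simp only [dAt_zero, dAt_snd, dAt_fst, lift_fst, lift_snd, dAt_zero_left, comp_lift,
    comp_dAt, comp_zero, lift_fst_assoc]
  -- Only the direction slot of `D f` is being varied, so [CD6] applies.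
  rw [dAt_D_linear]

end DifferentialCalculus

/-! ### Exponentials: beta, eta and extensionality -/

section Exponentials

variable {C : Type*} [Category C] [CartesianMonoidalCategory C] [MonoidalClosed C]

/-- Application of generalized elements. -/
def ap {X A B : C} (f : X ⟶ expObj A B) (a : X ⟶ A) : X ⟶ B := lift f a ≫ evMor A B

theorem comp_ap {X Y A B : C} (h : Y ⟶ X) (f : X ⟶ expObj A B) (a : X ⟶ A) :
    h ≫ ap f a = ap (h ≫ f) (h ≫ a) := by
  simp [ap, ← Category.assoc, comp_lift]

/-- The beta law. The exchange of components in `h1` comes from `MonoidalClosed.curry`, which takes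
the argument on the left, while contexts here grow on the right. -/
theorem ap_lamMor {X Y A B : C} (h : Y ⟶ X) (f : X ⊗ A ⟶ B) (a : Y ⟶ A) :
    ap (h ≫ lamMor f) a = lift h a ≫ f := by
  have h1 : lift (h ≫ lamMor f) a ≫ lift (snd (expObj A B) A) (fst (expObj A B) A) =
      lift a h ≫ (A ◁ lamMor f) := by
    apply CartesianMonoidalCategory.hom_ext <;> simp
  rw [ap, evMor, ← Category.assoc, h1]
  have h2 := MonoidalClosed.uncurry_curry (lift (snd A X) (fst A X) ≫ f)
  rw [MonoidalClosed.uncurry_eq] at h2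
  rw [Category.assoc]
  erw [h2]
  rw [← Category.assoc, comp_lift]
  simp

theorem ap_lamMor' {X A B : C} (f : X ⊗ A ⟶ B) (a : X ⟶ A) :
    ap (lamMor f) a = lift (𝟙 X) a ≫ f := by
  rw [← ap_lamMor, Category.id_comp]

theorem lamMor_ap {X A B : C} (f : X ⟶ expObj A B) :
    lamMor (ap (fst X A ≫ f) (snd X A)) = f := by
  apply MonoidalClosed.uncurry_injective
  rw [lamMor, MonoidalClosed.uncurry_curry, comp_ap, ap, evMor, MonoidalClosed.uncurry_eq]
  simp only [← Category.assoc, comp_lift]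
  congr 1
  apply CartesianMonoidalCategory.hom_ext <;> simp

theorem ap_ext {X A B : C} {f g : X ⟶ expObj A B}
    (h : ap (fst X A ≫ f) (snd X A) = ap (fst X A ≫ g) (snd X A)) : f = g := by
  rw [← lamMor_ap f, h, lamMor_ap]

theorem ap_congr_of_forall {X A B : C} {f g : X ⟶ expObj A B}
    (h : ∀ ⦃Y : C⦄ (x : Y ⟶ X) (a : Y ⟶ A), ap (x ≫ f) a = ap (x ≫ g) a) : f = g :=
  ap_ext (h _ _)

theorem comp_lamMor {X Y A B : C} (h : Y ⟶ X) (f : X ⊗ A ⟶ B) :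
    h ≫ lamMor f = lamMor (lift (fst Y A ≫ h) (snd Y A) ≫ f) := by
  apply ap_ext
  rw [← Category.assoc, ap_lamMor, ap_lamMor]
  simp

end Exponentials

/-! ### Differentiation of currying and of application -/

section DifferentialExponentials

open CartesianDifferentialCategory DifferentialLambdaCategory

variable {C : Type*} [Category C] [CartesianMonoidalCategory C] [MonoidalClosed C]
  [DifferentialLambdaCategory C]

/-- By the eta law both functions are curried morphisms, and currying is additive. -/
theorem ap_add_left {X A B : C} (f g : X ⟶ expObj A B) (a : X ⟶ A) :
    ap (f + g) a = ap f a + ap g a := by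
  rw [← lamMor_ap f, ← lamMor_ap g, ← lam_add]
  simp only [ap_lamMor', comp_add]

theorem ap_zero_left {X A B : C} (a : X ⟶ A) : ap (0 : X ⟶ expObj A B) a = 0 := by
  rw [← lam_zero, ap_lamMor', comp_zero]

theorem ap_dAt_lamMor {X Y A B : C} (f : X ⊗ A ⟶ B) (v x : Y ⟶ X) (a : Y ⟶ A) :
    ap (dAt (lamMor f) v x) a = dAt f (lift v 0) (lift x a) := by
  rw [dAt, D_curry, ap_lamMor, dAt]
  simp only [← Category.assoc, comp_lift, lift_fst, lift_snd, comp_zero]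

/-- The derivative of the function `f` at the point `a` in the direction `v`. -/
def dap {X A B : C} (f : X ⟶ expObj A B) (v a : X ⟶ A) : X ⟶ B :=
  dAt (evMor A B) (lift 0 v) (lift f a)

theorem dap_zero {X A B : C} (f : X ⟶ expObj A B) (a : X ⟶ A) : dap f 0 a = 0 := by
  rw [dap, lift_zero_zero, dAt_zero_left]

/-- With `f` written as a curried `g`, application is `g ∘ ⟨id, a⟩`. Its direction `⟨v, Da⟩` splits
as `⟨v, 0⟩ + ⟨0, Da⟩`, and [CD2] gives the two summands: the function varies, or the argument
varies. -/
theorem dAt_ap_aux {X Y A B : C} (f : X ⟶ expObj A B) (a : X ⟶ A) (v x : Y ⟶ X) :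
    dAt (ap f a) v x = ap (dAt f v x) (x ≫ a) +
      dAt (ap (fst X A ≫ f) (snd X A)) (lift 0 (dAt a v x)) (lift x (x ≫ a)) := by
  obtain ⟨g, rfl⟩ : ∃ g, lamMor g = f := ⟨_, lamMor_ap f⟩
  rw [ap_lamMor', ap_lamMor, ap_dAt_lamMor, lift_fst_snd, Category.id_comp, dAt_comp, dAt_lift,
    comp_lift, ← dAt_add_left, lift_add_lift, dAt_id, Category.comp_id, add_zero, zero_add]

theorem dAt_ap {X Y A B : C} (f : X ⟶ expObj A B) (a : X ⟶ A) (v x : Y ⟶ X) :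
    dAt (ap f a) v x = ap (dAt f v x) (x ≫ a) + dap (x ≫ f) (dAt a v x) (x ≫ a) := by
  rw [dAt_ap_aux]
  congr 1
  rw [ap, dAt_comp, dAt_lift, dap]
  simp [dAt_comp, dAt_fst, dAt_snd, dAt_zero_left, comp_lift]

theorem dap_lamMor {X Y A B : C} (h : Y ⟶ X) (f : X ⊗ A ⟶ B) (v a : Y ⟶ A) :
    dap (h ≫ lamMor f) v a = dAt f (lift 0 v) (lift h a) := by
  have h1 : f = ap (fst X A ≫ lamMor f) (snd X A) := by simp [ap_lamMor]
  conv_rhs => rw [h1, dAt_ap]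
  simp [dAt_comp, dAt_fst, dAt_snd, dAt_zero_left, ap_zero_left]

/-- The curried form of [CD6]. It is why `J f · s` inherits the linear variables of `s`. -/
theorem isLinearMor_lamMor_D {A B : C} (f : A ⟶ B) : IsLinearMor (lamMor (D f)) := by
  rw [isLinearMor_iff]
  intro X v x
  apply ap_congr_of_forall
  intro Y y a
  rw [comp_dAt, ap_dAt_lamMor, dAt_D_linear, ← Category.assoc, ap_lamMor, dAt]

end DifferentialExponentials

/-! ### The objects of linear functionals -/

section Duals

open CartesianDifferentialCategory

namespace DPPLModel

variable {F : FunSig} {C : Type*} [Category C] [CartesianMonoidalCategory C] [MonoidalClosed C]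
  [DifferentialLambdaCategory C] (M : DPPLModel F C)

/-- Application of generalized elements of a dual object. -/
def apD {X A : C} (f : X ⟶ M.dual A) (a : X ⟶ A) : X ⟶ M.R := lift f a ≫ M.evDual A

theorem apD_eq_ap {X A : C} (f : X ⟶ M.dual A) (a : X ⟶ A) :
    M.apD f a = ap (f ≫ M.incl A) a := by
  simp [apD, evDual, ap, ← Category.assoc, comp_lift]

theorem comp_apD {X Y A : C} (h : Y ⟶ X) (f : X ⟶ M.dual A) (a : X ⟶ A) :
    h ≫ M.apD f a = M.apD (h ≫ f) (h ≫ a) := by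
  simp [apD, ← Category.assoc, comp_lift]

/-- The inclusion into the exponential is a monomorphism, so functionals are determined by their
values at all generalized elements. -/
theorem apD_ext {X A : C} {f g : X ⟶ M.dual A}
    (h : ∀ ⦃Y : C⦄ (x : Y ⟶ X) (a : Y ⟶ A), M.apD (x ≫ f) a = M.apD (x ≫ g) a) : f = g := by
  have := M.incl_mono A
  rw [← cancel_mono (M.incl A)]
  apply ap_congr_of_forall
  intro Y x a
  simpa [apD_eq_ap] using h x a

theorem lamDual_incl {X A : C} {h : X ⊗ A ⟶ M.R} (hl : IsLinearSnd h) :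
    M.lamDual h ≫ M.incl A = lamMor h := by
  rw [lamDual, dif_pos hl]
  exact ((M.incl_factors h).2 hl).choose_spec

theorem apD_lamDual {X Y A : C} {h : X ⊗ A ⟶ M.R} (hl : IsLinearSnd h) (x : Y ⟶ X)
    (a : Y ⟶ A) : M.apD (x ≫ M.lamDual h) a = lift x a ≫ h := by
  rw [apD_eq_ap, Category.assoc, M.lamDual_incl hl, ap_lamMor]

/-- This is the direct implication of `incl_factors`: a curried morphism that factors through the
inclusion is linear in its argument. -/
theorem isLinearSnd_apD {X A : C} (f : X ⟶ M.dual A) :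
    IsLinearSnd (M.apD (fst X A ≫ f) (snd X A)) := by
  refine (M.incl_factors _).1 ⟨f, ?_⟩
  apply ap_congr_of_forall
  intro Y x a
  rw [ap_lamMor, comp_apD, apD_eq_ap]
  simp

theorem apD_add_left {X A : C} (f g : X ⟶ M.dual A) (a : X ⟶ A) :
    M.apD (f + g) a = M.apD f a + M.apD g a := by
  simp only [apD_eq_ap, (M.incl_linear A).add_comp, ap_add_left]

theorem apD_zero_left {X A : C} (a : X ⟶ A) : M.apD (0 : X ⟶ M.dual A) a = 0 := by
  simp only [apD_eq_ap, (M.incl_linear A).zero_comp, ap_zero_left]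

theorem apD_zero_right {X A : C} (f : X ⟶ M.dual A) : M.apD f 0 = 0 := by
  have h := (M.isLinearSnd_apD f).zero_comp (𝟙 X)
  simpa [comp_apD] using h

/-- The product rule for a bilinear pairing. Unlike in `dAt_ap`, the second summand is again an
application, because functionals are linear in their argument. -/
theorem dAt_apD {X Y A : C} (f : X ⟶ M.dual A) (a : X ⟶ A) (v x : Y ⟶ X) :
    dAt (M.apD f a) v x = M.apD (dAt f v x) (x ≫ a) + M.apD (x ≫ f) (dAt a v x) := by
  have h := (M.isLinearSnd_apD f).dAt_eq (dAt a v x) x (x ≫ a)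
  rw [apD_eq_ap, Category.assoc] at h
  rw [apD_eq_ap, dAt_ap_aux, h, dAt_comp, (M.incl_linear A).dAt_eq, ← apD_eq_ap, comp_ap]
  simp [apD_eq_ap]

/-- A linear inclusion commutes with differentiation, which reduces the claim to the rule for
curried morphisms. -/
theorem apD_dAt_lamDual {X Y A : C} {h : X ⊗ A ⟶ M.R} (hl : IsLinearSnd h) (v x : Y ⟶ X)
    (a : Y ⟶ A) : M.apD (dAt (M.lamDual h) v x) a = dAt h (lift v 0) (lift x a) := by
  rw [apD_eq_ap, ← (M.incl_linear A).dAt_eq (dAt (M.lamDual h) v x) (x ≫ M.lamDual h),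
    ← dAt_comp, M.lamDual_incl hl, ap_dAt_lamMor]

/-- Linearity matters here: for nonlinear `h` the operation takes the value `0`, even if the
reparametrized morphism happens to be linear. -/
theorem comp_lamDual {X Y A : C} {h : X ⊗ A ⟶ M.R} (hl : IsLinearSnd h) (k : Y ⟶ X) :
    k ≫ M.lamDual h = M.lamDual (lift (fst Y A ≫ k) (snd Y A) ≫ h) := by
  apply M.apD_ext
  intro Z x a
  rw [M.apD_lamDual (hl.comp_left k), ← Category.assoc, M.apD_lamDual hl, ← Category.assoc]
  simp [comp_lift]

/-- Composition of an element of a dual object with a linear morphism is linear. -/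
theorem isLinearSnd_apD_comp {X A B : C} (f : X ⟶ M.dual B) {g : X ⊗ A ⟶ B}
    (hg : IsLinearSnd g) : IsLinearSnd (M.apD (fst X A ≫ f) g) := by
  rw [isLinearSnd_iff]
  intro Y v x a
  rw [dAt_apD, hg.dAt_eq, dAt_comp, dAt_fst, comp_apD]
  simp [dAt_zero_left, apD_zero_left]

end DPPLModel

end Duals

/-! ### Coordinates and linear forms on real vector spaces -/

section Vectors

open CartesianDifferentialCategory

variable {C : Type*} [Category C] [CartesianMonoidalCategory C]

theorem TyModel.toVec_ofVec [MonoidalClosed C] (T : TyModel C) (num : (𝟙_ C ⟶ T.R) ≃ ℝ) :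
    (n : ℕ) → (r : Fin (n + 1) → ℝ) → T.toVec num n (T.ofVec num n r) = r
  | 0, r => by
    funext i
    simp [ofVec, toVec, Fin.fin_one_eq_zero i]
  | n + 1, r => by
    simp [ofVec, toVec, toVec_ofVec T num n]

theorem TyModel.ofVec_toVec [MonoidalClosed C] (T : TyModel C) (num : (𝟙_ C ⟶ T.R) ≃ ℝ) :
    (n : ℕ) → (x : 𝟙_ C ⟶ T.ty (Ty.pow n)) → T.ofVec num n (T.toVec num n x) = x
  | 0, x => by simp [ofVec, toVec]
  | n + 1, x => by
    simp only [ofVec, toVec, Fin.init_snoc, Fin.snoc_last, ofVec_toVec T num n,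
      Equiv.symm_apply_apply]
    apply CartesianMonoidalCategory.hom_ext <;> simp

variable [MonoidalClosed C] [DifferentialLambdaCategory C] {F : FunSig} (M : DPPLModel F C)

namespace DPPLModel

/-- Only the action of `scal` on elements is given. On `ℝ^1` (index `0`) that action is a linear
map, which is its own Fréchet derivative; `D` agrees with this derivative on elements, and
well-pointedness concludes. -/
theorem isLinearMor_scal (hWP : WellPointed C) (r : ℝ) : IsLinearMor (M.scal r) := by
  apply hWP
  intro x
  obtain ⟨v, x, rfl⟩ : ∃ v y, lift v y = x := ⟨x ≫ fst _ _, x ≫ snd _ _, by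
    apply CartesianMonoidalCategory.hom_ext <;> simp⟩
  apply M.num.injective
  have h := (M.hasFDerivAt (n := 0) (m := 0) (M.scal r) (fun _ => M.num x)).2 (fun _ => M.num v)
  have h1 : M.toFun M.num (n := 0) (m := 0) (M.scal r) =
      (r • ContinuousLinearMap.id ℝ (Fin 1 → ℝ) : (Fin 1 → ℝ) →L[ℝ] (Fin 1 → ℝ)) := by
    funext y i
    simp [TyModel.toFun, TyModel.toVec, TyModel.ofVec, M.num_scal, Fin.fin_one_eq_zero i]
  rw [h1, ContinuousLinearMap.fderiv] at h
  have h2 := congrFun h 0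
  simp only [TyModel.toVec, TyModel.ofVec, Equiv.symm_apply_apply] at h2
  rw [← h2, lift_fst_assoc, M.num_scal]
  simp

theorem isLinearMor_linForm (hWP : WellPointed C) :
    (n : ℕ) → (r : Fin (n + 1) → ℝ) → IsLinearMor (M.linForm n r)
  | 0, r => M.isLinearMor_scal hWP (r 0)
  | n + 1, _ => (isLinearMor_fst.comp (isLinearMor_linForm hWP n _)).add
      (isLinearMor_snd.comp (M.isLinearMor_scal hWP _))

theorem num_linForm : (n : ℕ) → (r : Fin (n + 1) → ℝ) → (x : 𝟙_ C ⟶ M.ty (Ty.pow n)) →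
    M.num (x ≫ M.linForm n r) = ∑ i, r i * M.toVec M.num n x i
  | 0, r, x => by simp [linForm, TyModel.toVec, M.num_scal]
  | n + 1, r, x => by
    rw [Fin.sum_univ_castSucc]
    simp only [linForm, comp_add, M.num_add, TyModel.toVec, Fin.snoc_castSucc, Fin.snoc_last,
      ← Category.assoc, M.num_scal, num_linForm n]
    rfl

end DPPLModel

end Vectors

/-! ### Semantic well-formedness and linear variables -/

namespace DPPLModel

open CartesianDifferentialCategory


variable {F : FunSig} {C : Type*} [Category C] [CartesianMonoidalCategory C] [MonoidalClosed C]
  [DifferentialLambdaCategory C] (M : DPPLModel F C)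

theorem den_app {Γ : List Ty} {σ τ : Ty} (s : Tm F Γ (Ty.arrow σ τ)) (t : Tm F Γ σ) :
    M.den (.app s t) = ap (M.den s) (M.den t) := rfl

theorem den_dualMap {Γ : List Ty} {σ τ : Ty} (s : Tm F (σ :: Γ) τ) (t : Tm F Γ (Ty.dual τ)) :
    M.den (.dualMap s t) = M.lamDual (M.apD (fst (M.ctx Γ) (M.ty σ) ≫ M.den t) (M.den s)) := rfl

/-- A derivative is linear in its direction, so the functional in the interpretation of a pullback
is always linear and the default value of `lamDual` is never used there. Hence `SWF` imposes no
linearity condition on pullbacks. -/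
theorem isLinearSnd_pb {X A B : C} (f : X ⊗ A ⟶ B) (w : X ⊗ A ⟶ M.dual B) :
    IsLinearSnd (M.apD (fst (X ⊗ A) A ≫ w) (dSnd f)) := by
  have h := isLinearSnd_dAt f (𝟙 _)
  rw [Category.comp_id] at h
  exact M.isLinearSnd_apD_comp _ h

/-- The working form of the interpretation of pullbacks: equations between pullbacks are checked by
applying both sides to a point and a direction. -/
theorem apD_ap_pb {Γ : List Ty} {σ τ : Ty} (s : Tm F (σ :: Γ) τ) (t : Tm F Γ (Ty.form τ))
    {X : C} (x : X ⟶ M.ctx Γ) (a v : X ⟶ M.ty σ) :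
    M.apD (ap (x ≫ M.den (.pb s t)) a) v =
      M.apD (ap (x ≫ M.den t) (lift x a ≫ M.den s)) (dAt (M.den s) (lift 0 v) (lift x a)) := by
  have h := M.isLinearSnd_pb (M.den s) (ap (fst (M.ctx Γ) (M.ty σ) ≫ M.den t) (M.den s))
  simp only [den]
  rw [ap_lamMor]
  erw [M.apD_lamDual h]
  rw [comp_apD, dSnd_eq, comp_dAt]
  simp only [← Category.assoc, lift_fst, lift_snd, comp_ap, comp_lift, comp_zero]

theorem apD_dualMap {Γ : List Ty} {σ τ : Ty} {s : Tm F (σ :: Γ) τ} {t : Tm F Γ (Ty.dual τ)}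
    (hs : IsLinearSnd (X := M.ctx Γ) (A := M.ty σ) (M.den s)) {X : C} (x : X ⟶ M.ctx Γ)
    (v : X ⟶ M.ty σ) :
    M.apD (x ≫ M.den (.dualMap s t)) v = M.apD (x ≫ M.den t) (lift x v ≫ M.den s) := by
  rw [den_dualMap, M.apD_lamDual (M.isLinearSnd_apD_comp _ hs), comp_apD, lift_fst_assoc]

/-- Semantic well-formedness: in every dual map `(λ x. s)* · t`, the interpretation of `s` is
linear in `x`. -/
def SWF : {Γ : List Ty} → {σ : Ty} → Tm F Γ σ → Prop
  | _, _, .zero => True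
  | _, _, .add s t => SWF s ∧ SWF t
  | _, _, .var _ => True
  | _, _, .lam s => SWF s
  | _, _, .app s t => SWF s ∧ SWF t
  | _, _, .fst s => SWF s
  | _, _, .snd s => SWF s
  | _, _, .pair s t => SWF s ∧ SWF t
  | _, _, .const _ => True
  | _, _, .fn _ s => SWF s
  | _, _, .jac _ s => SWF s
  | Γ, _, .dualMap (σ := σ) s t =>
      SWF s ∧ SWF t ∧ IsLinearSnd (X := M.ctx Γ) (A := M.ty σ) (M.den s)
  | _, _, .pb s t => SWF s ∧ SWF t
  | _, _, .dualVec _ => True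

/-- The projection of a context onto its variable with index `i`. -/
def selVar : (Γ : List Ty) → ℕ → (M.ctx Γ ⟶ M.ctx Γ)
  | [], _ => 0
  | _ :: _, 0 => lift 0 (snd _ _)
  | _ :: Γ, i + 1 => lift (fst _ _ ≫ selVar Γ i) 0

/-- The map that replaces the value of the variable with index `i` by `0`. -/
def resetVar : (Γ : List Ty) → ℕ → (M.ctx Γ ⟶ M.ctx Γ)
  | [], _ => 𝟙 _
  | _ :: _, 0 => lift (fst _ _) 0
  | _ :: Γ, i + 1 => lift (fst _ _ ≫ resetVar Γ i) (snd _ _)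

theorem isLinearMor_resetVar : (Γ : List Ty) → (i : ℕ) → IsLinearMor (M.resetVar Γ i)
  | [], _ => isLinearMor_id
  | _ :: _, 0 => isLinearMor_fst.lift isLinearMor_zero
  | _ :: Γ, i + 1 => (isLinearMor_fst.comp (isLinearMor_resetVar Γ i)).lift isLinearMor_snd

theorem selVar_resetVar : (Γ : List Ty) → (i : ℕ) → M.selVar Γ i ≫ M.resetVar Γ i = 0
  | [], _ => (M.isLinearMor_resetVar [] 0).zero_comp
  | _ :: _, 0 => by simp [selVar, resetVar, comp_lift, comp_zero, lift_zero_zero]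
  | _ :: Γ, i + 1 => by
    simp [selVar, resetVar, comp_lift, selVar_resetVar Γ i, comp_zero, lift_zero_zero]

theorem resetVar_resetVar : (Γ : List Ty) → (i : ℕ) →
    M.resetVar Γ i ≫ M.resetVar Γ i = M.resetVar Γ i
  | [], _ => by simp [resetVar]
  | _ :: _, 0 => by simp [resetVar, comp_lift, comp_zero]
  | _ :: Γ, i + 1 => by simp [resetVar, comp_lift, resetVar_resetVar Γ i]

theorem isLinearMor_var : {Γ : List Ty} → {σ : Ty} → (x : Var Γ σ) → IsLinearMor (M.var x)
  | _, _, .zero => isLinearMor_snd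
  | _, _, .succ x => isLinearMor_fst.comp (isLinearMor_var x)

theorem resetVar_var_self : {Γ : List Ty} → {σ : Ty} → (x : Var Γ σ) →
    M.resetVar Γ x.idx ≫ M.var x = 0
  | _, _, .zero => by simp [Var.idx, resetVar, var]
  | _, _, .succ x => by simp [Var.idx, resetVar, var, resetVar_var_self x, comp_zero]

theorem resetVar_var : {Γ : List Ty} → {σ : Ty} → (x : Var Γ σ) → {i : ℕ} → x.idx ≠ i →
    M.resetVar Γ i ≫ M.var x = M.var x
  | _, _, .zero, 0, h => (h rfl).elim
  | _, _, .zero, i + 1, _ => by simp [resetVar, var]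
  | _, _, .succ x, 0, _ => by simp [resetVar, var]
  | _, _, .succ x, i + 1, h => by
    have h' : x.idx ≠ i := fun e => h (by simp [Var.idx, e])
    simp [resetVar, var, resetVar_var x h']

/-- `f` is linear in the variable with index `i`. -/
def LinearVar {Γ : List Ty} (i : ℕ) {B : C} (f : M.ctx Γ ⟶ B) : Prop :=
  ∀ ⦃X : C⦄ (v x : X ⟶ M.ctx Γ),
    dAt f (v ≫ M.selVar Γ i) x = (v ≫ M.selVar Γ i + x ≫ M.resetVar Γ i) ≫ f

theorem isLinearSnd_of_linearVar {Γ : List Ty} {σ : Ty} {B : C} {f : M.ctx (σ :: Γ) ⟶ B}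
    (h : M.LinearVar 0 f) : IsLinearSnd (X := M.ctx Γ) (A := M.ty σ) f := by
  rw [isLinearSnd_iff]
  intro Y v x a
  have h1 := h (lift 0 v) (lift x a)
  simpa [selVar, resetVar, comp_lift, comp_zero, lift_add_lift] using h1

/-- The sum is the point `x` with its coordinate `i` replaced by that of `v`, since the two summands
have complementary supports. Resetting coordinate `i` forgets `v`. The same observation shows that a
morphism invariant under the reset ignores the replacement and has derivative `0` in such
directions. -/
theorem add_comp_resetVar {Γ : List Ty} (i : ℕ) {X : C} (v x : X ⟶ M.ctx Γ) :
    (v ≫ M.selVar Γ i + x ≫ M.resetVar Γ i) ≫ M.resetVar Γ i = x ≫ M.resetVar Γ i := by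
  simp [(M.isLinearMor_resetVar Γ i).add_comp, selVar_resetVar, resetVar_resetVar, comp_zero]

theorem add_comp_of_reset {Γ : List Ty} {i : ℕ} {B : C} {f : M.ctx Γ ⟶ B}
    (hf : M.resetVar Γ i ≫ f = f) {X : C} (v x : X ⟶ M.ctx Γ) :
    (v ≫ M.selVar Γ i + x ≫ M.resetVar Γ i) ≫ f = x ≫ f := by
  rw [← hf, ← Category.assoc, add_comp_resetVar, Category.assoc]

theorem dAt_of_reset {Γ : List Ty} {i : ℕ} {B : C} {f : M.ctx Γ ⟶ B}
    (hf : M.resetVar Γ i ≫ f = f) {X : C} (v x : X ⟶ M.ctx Γ) :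
    dAt f (v ≫ M.selVar Γ i) x = 0 := by
  rw [← hf, dAt_comp, (M.isLinearMor_resetVar Γ i).dAt_eq, Category.assoc, selVar_resetVar,
    comp_zero, dAt_zero_left]

/-- Naturality of pullbacks in the context, shared by resetting, renaming and substitution. The
direction is `0` on the context, so `k` enters only through the base point. -/
theorem comp_den_pb {Γ : List Ty} {σ τ : Ty} (s : Tm F (σ :: Γ) τ) (t : Tm F Γ (Ty.form τ))
    {Δ : List Ty} (k : M.ctx Δ ⟶ M.ctx Γ) (s' : Tm F (σ :: Δ) τ) (t' : Tm F Δ (Ty.form τ))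
    (hs : M.den s' = lift (fst (M.ctx Δ) (M.ty σ) ≫ k) (snd (M.ctx Δ) (M.ty σ)) ≫ M.den s)
    (ht : M.den t' = k ≫ M.den t) : M.den (.pb s' t') = k ≫ M.den (.pb s t) := by
  apply ap_congr_of_forall
  intro Y x a
  apply M.apD_ext
  intro Z y v
  rw [comp_ap, comp_ap, ← Category.assoc, ← Category.assoc, ← Category.assoc,
    M.apD_ap_pb, M.apD_ap_pb, hs, ht, dAt_comp, dAt_lift, dAt_comp, dAt_fst, dAt_snd]
  simp only [lift_fst, lift_snd, dAt_zero_left, ← Category.assoc, comp_lift]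

theorem comp_den_dualMap {Γ : List Ty} {σ τ : Ty} {s : Tm F (σ :: Γ) τ}
    (hl : IsLinearSnd (X := M.ctx Γ) (A := M.ty σ) (M.den s)) (t : Tm F Γ (Ty.dual τ))
    {Δ : List Ty} (k : M.ctx Δ ⟶ M.ctx Γ) (s' : Tm F (σ :: Δ) τ) (t' : Tm F Δ (Ty.dual τ))
    (hs : M.den s' = lift (fst (M.ctx Δ) (M.ty σ) ≫ k) (snd (M.ctx Δ) (M.ty σ)) ≫ M.den s)
    (ht : M.den t' = k ≫ M.den t) : M.den (.dualMap s' t') = k ≫ M.den (.dualMap s t) := by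
  have hl' : IsLinearSnd (X := M.ctx Δ) (A := M.ty σ) (M.den s') := by
    rw [hs]; exact hl.comp_left k
  apply M.apD_ext
  intro Y x v
  rw [← Category.assoc, M.apD_dualMap hl', M.apD_dualMap hl, hs, ht]
  simp only [← Category.assoc, comp_lift, lift_fst, lift_snd]

theorem comp_den_dualVec (hWP : WellPointed C) {Γ Δ : List Ty} (k : M.ctx Δ ⟶ M.ctx Γ) {n : ℕ}
    (r : Fin (n + 1) → ℝ) :
    k ≫ M.den (.dualVec r : Tm F Γ _) = M.den (.dualVec r : Tm F Δ _) := by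
  simp only [den]
  rw [M.comp_lamDual (isLinearSnd_snd_comp (M.isLinearMor_linForm hWP n r)), lift_snd_assoc]

/-- Independence of a variable that is not free, expressed without changing the context: the
variable may be set to `0`. -/
theorem resetVar_den (hWP : WellPointed C) {Γ : List Ty} {σ : Ty} (s : Tm F Γ σ)
    (hs : M.SWF s) {i : ℕ} (hi : ¬ s.fv i) : M.resetVar Γ i ≫ M.den s = M.den s := by
  induction s generalizing i with
  | zero => exact comp_zero _ _
  | add s t ihs iht =>
    simp only [Tm.fv, not_or] at hi
    simp only [den, comp_add, ihs hs.1 hi.1, iht hs.2 hi.2]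
  | var x => exact M.resetVar_var x hi
  | lam s ih =>
    have h := ih hs (i := i + 1) hi
    simp only [den, comp_lamMor]
    exact congrArg lamMor h
  | app s t ihs iht =>
    simp only [Tm.fv, not_or] at hi
    rw [den_app, comp_ap, ihs hs.1 hi.1, iht hs.2 hi.2]
  | fst s ih => simp only [den, ← Category.assoc]; rw [ih hs hi]
  | snd s ih => simp only [den, ← Category.assoc]; rw [ih hs hi]
  | pair s t ihs iht =>
    simp only [Tm.fv, not_or] at hi
    simp only [den, comp_lift, ihs hs.1 hi.1, iht hs.2 hi.2]
  | const r => simp [den, ← Category.assoc]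
  | fn f s ih => simp only [den, ← Category.assoc]; rw [ih hs hi]
  | jac f s ih => simp only [den, ← Category.assoc]; rw [ih hs hi]
  | dualMap s t ihs iht =>
    simp only [Tm.fv, not_or] at hi
    exact (M.comp_den_dualMap hs.2.2 t _ s t (ihs hs.1 hi.1).symm (iht hs.2.1 hi.2).symm).symm
  | pb s t ihs iht =>
    simp only [Tm.fv, not_or] at hi
    exact (M.comp_den_pb s t _ s t (ihs hs.1 hi.1).symm (iht hs.2 hi.2).symm).symm
  | dualVec r => exact M.comp_den_dualVec hWP _ r

theorem linearVar_comp {Γ : List Ty} {i : ℕ} {A B : C} {f : M.ctx Γ ⟶ A} {g : A ⟶ B}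
    (hf : M.LinearVar i f) (hg : IsLinearMor g) : M.LinearVar i (f ≫ g) := by
  intro X v x
  rw [dAt_comp, hg.dAt_eq, hf, Category.assoc]

theorem linearVar_lift {Γ : List Ty} {i : ℕ} {A B : C} {f : M.ctx Γ ⟶ A} {g : M.ctx Γ ⟶ B}
    (hf : M.LinearVar i f) (hg : M.LinearVar i g) : M.LinearVar i (lift f g) := by
  intro X v x
  rw [dAt_lift, hf, hg, comp_lift]

/-- The two claims need each other. Semantic well-formedness of a dual map is linearity of its body,
while linearity of applications and dual maps uses `resetVar_den`, which assumes semantic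
well-formedness. -/
theorem swf_and_linearVar (hWP : WellPointed C) {Γ : List Ty} {σ : Ty} (s : Tm F Γ σ) (hs : s.WF) :
    M.SWF s ∧ ∀ i, s.lin i → M.LinearVar i (M.den s) := by
  induction s with
  | zero =>
    refine ⟨trivial, fun i _ X v x => ?_⟩
    simp only [den, dAt_zero, comp_zero]
  | add s t ihs iht =>
    refine ⟨⟨(ihs hs.1).1, (iht hs.2).1⟩, fun i hi X v x => ?_⟩
    simp only [den, dAt_add, comp_add, (ihs hs.1).2 i hi.1 v x, (iht hs.2).2 i hi.2 v x]
  | var y =>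
    refine ⟨trivial, fun i hi X v x => ?_⟩
    obtain rfl : y.idx = i := hi
    simp only [den]
    rw [(M.isLinearMor_var y).dAt_eq, (M.isLinearMor_var y).add_comp, Category.assoc,
      Category.assoc, M.resetVar_var_self, comp_zero, add_zero]
  | lam s ih =>
    refine ⟨(ih hs).1, fun i hi X v x => ?_⟩
    have h := (ih hs).2 (i + 1) hi
    simp only [den]
    apply ap_congr_of_forall
    intro Y y a
    have h1 := h (lift (y ≫ v) 0) (lift (y ≫ x) a)
    simp only [selVar, resetVar, comp_lift, comp_zero, lift_fst_assoc, lift_snd,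
      lift_add_lift, zero_add] at h1
    rw [comp_dAt, ap_dAt_lamMor, ← Category.assoc y _ (lamMor _), ap_lamMor, comp_add]
    simpa using h1
  | app s t ihs iht =>
    refine ⟨⟨(ihs hs.1).1, (iht hs.2).1⟩, fun i hi X v x => ?_⟩
    have ht := M.resetVar_den hWP t (iht hs.2).1 hi.2
    -- The argument does not involve the variable, so its derivative vanishes and with it the second
    -- summand of the product rule.
    rw [den_app, dAt_ap, (ihs hs.1).2 i hi.1 v x, comp_ap, M.dAt_of_reset ht,
      M.add_comp_of_reset ht, dap_zero, add_zero]
  | fst s ih =>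
    exact ⟨(ih hs).1, fun i hi => M.linearVar_comp ((ih hs).2 i hi) isLinearMor_fst⟩
  | snd s ih =>
    exact ⟨(ih hs).1, fun i hi => M.linearVar_comp ((ih hs).2 i hi) isLinearMor_snd⟩
  | pair s t ihs iht =>
    exact ⟨⟨(ihs hs.1).1, (iht hs.2).1⟩,
      fun i hi => M.linearVar_lift ((ihs hs.1).2 i hi.1) ((iht hs.2).2 i hi.2)⟩
  | const r => exact ⟨trivial, fun i hi => hi.elim⟩
  | fn f s ih => exact ⟨(ih hs).1, fun i hi => hi.elim⟩
  | jac f s ih =>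
    exact ⟨(ih hs).1, fun i hi => M.linearVar_comp ((ih hs).2 i hi) (isLinearMor_lamMor_D _)⟩
  | dualMap s t ihs iht =>
    obtain ⟨hs1, hs2, hs3⟩ := hs
    have hl := M.isLinearSnd_of_linearVar ((ihs hs1).2 0 hs3)
    refine ⟨⟨(ihs hs1).1, (iht hs2).1, hl⟩, fun i hi X v x => ?_⟩
    apply M.apD_ext
    intro Y y a
    rw [comp_dAt, ← Category.assoc y _ (M.den _), M.apD_dualMap hl, den_dualMap,
      M.apD_dAt_lamDual (M.isLinearSnd_apD_comp _ hl), dAt_apD, dAt_comp, dAt_fst]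
    simp only [lift_fst, lift_fst_assoc]
    -- The variable occurs in at most one of the two factors, so exactly one summand of the product
    -- rule remains to be compared.
    rcases hi with ⟨hi, ht⟩ | ⟨ht, hi⟩
    · have ht' := M.resetVar_den hWP t (iht hs2).1 ht
      have h1 := (ihs hs1).2 (i + 1) hi (lift (y ≫ v) 0) (lift (y ≫ x) a)
      simp only [selVar, resetVar, comp_lift, comp_zero, lift_fst_assoc, lift_snd,
        lift_add_lift, zero_add] at h1
      rw [← Category.assoc, M.dAt_of_reset ht', apD_zero_left, zero_add, comp_add,
        ← Category.assoc, ← Category.assoc, M.add_comp_of_reset ht']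
      rw [h1]
    · have hs' := M.resetVar_den hWP s (ihs hs1).1 hi
      have h1 := M.dAt_of_reset hs' (lift (y ≫ v) 0) (lift (y ≫ x) a)
      have h2 := M.add_comp_of_reset hs' (lift (y ≫ v) 0) (lift (y ≫ x) a)
      simp only [selVar, resetVar, comp_lift, comp_zero, lift_fst_assoc, lift_snd,
        lift_add_lift, zero_add] at h1 h2
      rw [← Category.assoc, (iht hs2).2 i ht, h1, apD_zero_right, add_zero, comp_add]
      simp only [Category.assoc] at h2 ⊢
      rw [h2]
  | pb s t ihs iht => exact ⟨⟨(ihs hs.1).1, (iht hs.2).1⟩, fun i hi => hi.elim⟩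
  | dualVec r => exact ⟨trivial, fun i hi => hi.elim⟩

end DPPLModel

/-- Its purpose is the case of a linear variable that does not occur: all instances of such a term
coincide. -/
theorem Tm.subst_congr {F : FunSig} {Γ : List Ty} {σ : Ty} (s : Tm F Γ σ) {Δ : List Ty}
    {r r' : Subst F Γ Δ} (h : ∀ ρ (x : Var Γ ρ), s.fv x.idx → r _ x = r' _ x) :
    s.subst r = s.subst r' := by
  have under : ∀ {Γ Δ : List Ty} {σ τ : Ty} {r r' : Subst F Γ Δ} (s : Tm F (σ :: Γ) τ),
      (∀ ρ (x : Var Γ ρ), s.fv (x.idx + 1) → r _ x = r' _ x) →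
      ∀ ρ (x : Var (σ :: Γ) ρ), s.fv x.idx → r.under _ x = r'.under _ x := by
    intro Γ Δ σ τ r r' s h ρ x hx
    cases x with
    | zero => rfl
    | succ x => exact congrArg Tm.wk (h _ x hx)
  induction s generalizing Δ with
  | zero => rfl
  | add s t ihs iht =>
    exact congrArg₂ Tm.add (ihs fun ρ x hx => h ρ x (.inl hx)) (iht fun ρ x hx => h ρ x (.inr hx))
  | var x => exact h _ x rfl
  | lam s ih => exact congrArg Tm.lam (ih (under s h))
  | app s t ihs iht =>
    exact congrArg₂ Tm.app (ihs fun ρ x hx => h ρ x (.inl hx)) (iht fun ρ x hx => h ρ x (.inr hx))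
  | fst s ih => exact congrArg Tm.fst (ih h)
  | snd s ih => exact congrArg Tm.snd (ih h)
  | pair s t ihs iht =>
    exact congrArg₂ Tm.pair (ihs fun ρ x hx => h ρ x (.inl hx)) (iht fun ρ x hx => h ρ x (.inr hx))
  | const r => rfl
  | fn f s ih => exact congrArg (Tm.fn f) (ih h)
  | jac f s ih => exact congrArg (Tm.jac f) (ih h)
  | dualMap s t ihs iht =>
    exact congrArg₂ Tm.dualMap (ihs (under s fun ρ x hx => h ρ x (.inl hx)))
      (iht fun ρ x hx => h ρ x (.inr hx))
  | pb s t ihs iht =>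
    exact congrArg₂ Tm.pb (ihs (under s fun ρ x hx => h ρ x (.inl hx)))
      (iht fun ρ x hx => h ρ x (.inr hx))
  | dualVec r => rfl

/-! ### Renaming and substitution lemmas -/

namespace DPPLModel

open CartesianDifferentialCategory

variable {F : FunSig} {C : Type*} [Category C] [CartesianMonoidalCategory C] [MonoidalClosed C]
  [DifferentialLambdaCategory C] (M : DPPLModel F C)

/-- The map `k × id`, which interprets renamings and substitutions under a binder. -/
def underMor {Γ Δ : List Ty} (σ : Ty) (k : M.ctx Δ ⟶ M.ctx Γ) :
    M.ctx (σ :: Δ) ⟶ M.ctx (σ :: Γ) :=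
  lift (fst (M.ctx Δ) (M.ty σ) ≫ k) (snd (M.ctx Δ) (M.ty σ))

theorem underMor_comp {Γ Δ Θ : List Ty} (σ : Ty) (j : M.ctx Θ ⟶ M.ctx Δ)
    (k : M.ctx Δ ⟶ M.ctx Γ) : M.underMor σ j ≫ M.underMor σ k = M.underMor σ (j ≫ k) := by
  simp [underMor, comp_lift]

theorem underMor_id {Γ : List Ty} (σ : Ty) : M.underMor σ (𝟙 (M.ctx Γ)) = 𝟙 _ := by
  simp [underMor]

/-- `k` interprets the renaming `r`. -/
def InterpRen {Γ Δ : List Ty} (r : Ren Γ Δ) (k : M.ctx Δ ⟶ M.ctx Γ) : Prop :=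
  ∀ σ (x : Var Γ σ), M.var (r _ x) = k ≫ M.var x

/-- `k` interprets the substitution `r`, whose terms are semantically well-formed. -/
def InterpSubst {Γ Δ : List Ty} (r : Subst F Γ Δ) (k : M.ctx Δ ⟶ M.ctx Γ) : Prop :=
  ∀ σ (x : Var Γ σ), M.SWF (r _ x) ∧ M.den (r _ x) = k ≫ M.var x

variable {M}

theorem InterpRen.under {Γ Δ : List Ty} {r : Ren Γ Δ} {k : M.ctx Δ ⟶ M.ctx Γ}
    (h : M.InterpRen r k) (σ : Ty) : M.InterpRen (r.under (τ := σ)) (M.underMor σ k) := by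
  intro τ x
  cases x with
  | zero => simp [Ren.under, underMor, var]
  | succ x => simp [Ren.under, underMor, var, h _ x]

theorem interpRen_wk {Γ : List Ty} {σ : Ty} :
    M.InterpRen (Ren.wk (τ := σ)) (fst (M.ctx Γ) (M.ty σ)) :=
  fun _ _ => rfl

variable (M) in
/-- The interpretation of the exchange of the last two variables. -/
def swapMor (Γ : List Ty) (σ τ : Ty) : M.ctx (τ :: σ :: Γ) ⟶ M.ctx (σ :: τ :: Γ) :=
  lift (lift (fst _ _ ≫ fst _ _) (snd _ _)) (fst _ _ ≫ snd _ _)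

theorem interpRen_swap {Γ : List Ty} {σ τ : Ty} :
    M.InterpRen (Ren.swap (σ := σ) (τ := τ)) (M.swapMor Γ σ τ) := by
  intro ρ x
  match x with
  | .zero => simp [Ren.swap, swapMor, var]
  | .succ .zero => simp [Ren.swap, swapMor, var]
  | .succ (.succ x) => simp [Ren.swap, swapMor, var]

theorem swf_and_den_rename (hWP : WellPointed C) {Γ : List Ty} {σ : Ty} {s : Tm F Γ σ}
    (hs : M.SWF s) {Δ : List Ty} {r : Ren Γ Δ} {k : M.ctx Δ ⟶ M.ctx Γ} (h : M.InterpRen r k) :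
    M.SWF (s.rename r) ∧ M.den (s.rename r) = k ≫ M.den s := by
  induction s generalizing Δ with
  | zero => exact ⟨trivial, (comp_zero _ _).symm⟩
  | add s t ihs iht =>
    exact ⟨⟨(ihs hs.1 h).1, (iht hs.2 h).1⟩, by
      simp only [Tm.rename, den, comp_add, (ihs hs.1 h).2, (iht hs.2 h).2]⟩
  | var x => exact ⟨trivial, h _ x⟩
  | lam s ih =>
    refine ⟨(ih hs (h.under _)).1, ?_⟩
    simp only [Tm.rename, den, comp_lamMor, (ih hs (h.under _)).2]
    rfl
  | app s t ihs iht =>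
    exact ⟨⟨(ihs hs.1 h).1, (iht hs.2 h).1⟩, by
      simp only [Tm.rename, den_app, comp_ap, (ihs hs.1 h).2, (iht hs.2 h).2]⟩
  | fst s ih => exact ⟨(ih hs h).1, by simp only [Tm.rename, den, (ih hs h).2, Category.assoc]⟩
  | snd s ih => exact ⟨(ih hs h).1, by simp only [Tm.rename, den, (ih hs h).2, Category.assoc]⟩
  | pair s t ihs iht =>
    exact ⟨⟨(ihs hs.1 h).1, (iht hs.2 h).1⟩, by
      simp only [Tm.rename, den, comp_lift, (ihs hs.1 h).2, (iht hs.2 h).2]⟩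
  | const r => exact ⟨trivial, by simp [Tm.rename, den, ← Category.assoc]⟩
  | fn f s ih => exact ⟨(ih hs h).1, by simp only [Tm.rename, den, (ih hs h).2, Category.assoc]⟩
  | jac f s ih => exact ⟨(ih hs h).1, by simp only [Tm.rename, den, (ih hs h).2, Category.assoc]⟩
  | dualMap s t ihs iht =>
    have h1 := ihs hs.1 (h.under _)
    have h2 := iht hs.2.1 h
    refine ⟨⟨h1.1, h2.1, ?_⟩, M.comp_den_dualMap hs.2.2 _ _ _ _ h1.2 h2.2⟩
    rw [h1.2]
    exact hs.2.2.comp_left k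
  | pb s t ihs iht =>
    have h1 := ihs hs.1 (h.under _)
    have h2 := iht hs.2 h
    exact ⟨⟨h1.1, h2.1⟩, M.comp_den_pb _ _ _ _ _ h1.2 h2.2⟩
  | dualVec r => exact ⟨trivial, (M.comp_den_dualVec hWP k _).symm⟩

/-- Semantic well-formedness is reflected by renamings whose interpretation has a section. -/
theorem swf_of_rename (hWP : WellPointed C) {Γ : List Ty} {σ : Ty} {s : Tm F Γ σ}
    {Δ : List Ty} {r : Ren Γ Δ} {k : M.ctx Δ ⟶ M.ctx Γ} {j : M.ctx Γ ⟶ M.ctx Δ}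
    (h : M.InterpRen r k) (hj : j ≫ k = 𝟙 _) (hs : M.SWF (s.rename r)) : M.SWF s := by
  have under : ∀ {Γ Δ : List Ty} (σ : Ty) {j : M.ctx Γ ⟶ M.ctx Δ} {k : M.ctx Δ ⟶ M.ctx Γ},
      j ≫ k = 𝟙 _ → M.underMor σ j ≫ M.underMor σ k = 𝟙 _ := by
    intro Γ Δ σ j k h
    rw [underMor_comp, h, underMor_id]
  induction s generalizing Δ with
  | zero => trivial
  | add s t ihs iht => exact ⟨ihs h hj hs.1, iht h hj hs.2⟩
  | var x => trivial
  | lam s ih => exact ih (h.under _) (under _ hj) hs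
  | app s t ihs iht => exact ⟨ihs h hj hs.1, iht h hj hs.2⟩
  | fst s ih => exact ih h hj hs
  | snd s ih => exact ih h hj hs
  | pair s t ihs iht => exact ⟨ihs h hj hs.1, iht h hj hs.2⟩
  | const r => trivial
  | fn f s ih => exact ih h hj hs
  | jac f s ih => exact ih h hj hs
  | dualMap s t ihs iht =>
    have h1 := ihs (h.under _) (under _ hj) hs.1
    refine ⟨h1, iht h hj hs.2.1, ?_⟩
    have h2 := hs.2.2
    rw [(swf_and_den_rename hWP h1 (h.under _)).2] at h2
    exact h2.of_comp_left hj
  | pb s t ihs iht => exact ⟨ihs (h.under _) (under _ hj) hs.1, iht h hj hs.2⟩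
  | dualVec r => trivial

theorem SWF.wk (hWP : WellPointed C) {Γ : List Ty} {σ τ : Ty} {s : Tm F Γ σ} (hs : M.SWF s) :
    M.SWF (s.wk (τ := τ)) := (swf_and_den_rename hWP hs interpRen_wk).1

theorem SWF.den_wk (hWP : WellPointed C) {Γ : List Ty} {σ τ : Ty} {s : Tm F Γ σ}
    (hs : M.SWF s) : M.den (s.wk (τ := τ)) = fst (M.ctx Γ) (M.ty τ) ≫ M.den s :=
  (swf_and_den_rename hWP hs interpRen_wk).2

theorem SWF.wk1 (hWP : WellPointed C) {Γ : List Ty} {σ τ ρ : Ty} {s : Tm F (ρ :: Γ) σ}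
    (hs : M.SWF s) : M.SWF (s.wk1 (τ := τ)) :=
  (swf_and_den_rename hWP hs (interpRen_wk.under _)).1

theorem SWF.den_wk1 (hWP : WellPointed C) {Γ : List Ty} {σ τ ρ : Ty} {s : Tm F (ρ :: Γ) σ}
    (hs : M.SWF s) :
    M.den (s.wk1 (τ := τ)) = M.underMor ρ (fst (M.ctx Γ) (M.ty τ)) ≫ M.den s :=
  (swf_and_den_rename hWP hs (interpRen_wk.under _)).2

theorem SWF.swap (hWP : WellPointed C) {Γ : List Ty} {σ τ ρ : Ty} {s : Tm F (ρ :: τ :: Γ) σ}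
    (hs : M.SWF s) : M.SWF s.swap :=
  (swf_and_den_rename hWP hs interpRen_swap).1

theorem SWF.den_swap (hWP : WellPointed C) {Γ : List Ty} {σ τ ρ : Ty}
    {s : Tm F (ρ :: τ :: Γ) σ} (hs : M.SWF s) : M.den s.swap = M.swapMor Γ ρ τ ≫ M.den s :=
  (swf_and_den_rename hWP hs interpRen_swap).2

/-- Giving the fresh variable the value `0` is a section of the projection that interprets
weakening. -/
theorem SWF.of_wk (hWP : WellPointed C) {Γ : List Ty} {σ τ : Ty} {s : Tm F Γ σ}
    (hs : M.SWF (s.wk (τ := τ))) : M.SWF s :=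
  swf_of_rename hWP interpRen_wk (j := lift (𝟙 _) 0) (by simp) hs

theorem SWF.of_wk1 (hWP : WellPointed C) {Γ : List Ty} {σ τ ρ : Ty} {s : Tm F (ρ :: Γ) σ}
    (hs : M.SWF (s.wk1 (τ := τ))) : M.SWF s :=
  swf_of_rename hWP (interpRen_wk.under _) (j := M.underMor ρ (lift (𝟙 _) 0))
    (by rw [underMor_comp, lift_fst, underMor_id]) hs

theorem InterpSubst.under (hWP : WellPointed C) {Γ Δ : List Ty} {r : Subst F Γ Δ}
    {k : M.ctx Δ ⟶ M.ctx Γ} (h : M.InterpSubst r k) (σ : Ty) :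
    M.InterpSubst (r.under (τ := σ)) (M.underMor σ k) := by
  intro τ x
  cases x with
  | zero => exact ⟨trivial, by simp [Subst.under, underMor, var, den]⟩
  | succ x =>
    refine ⟨(h _ x).1.wk hWP, ?_⟩
    simp only [Subst.under, underMor, var, (h _ x).1.den_wk hWP, (h _ x).2]
    simp

theorem swf_and_den_subst (hWP : WellPointed C) {Γ : List Ty} {σ : Ty} {s : Tm F Γ σ}
    (hs : M.SWF s) {Δ : List Ty} {r : Subst F Γ Δ} {k : M.ctx Δ ⟶ M.ctx Γ}
    (h : M.InterpSubst r k) : M.SWF (s.subst r) ∧ M.den (s.subst r) = k ≫ M.den s := by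
  induction s generalizing Δ with
  | zero => exact ⟨trivial, (comp_zero _ _).symm⟩
  | add s t ihs iht =>
    exact ⟨⟨(ihs hs.1 h).1, (iht hs.2 h).1⟩, by
      simp only [Tm.subst, den, comp_add, (ihs hs.1 h).2, (iht hs.2 h).2]⟩
  | var x => exact h _ x
  | lam s ih =>
    refine ⟨(ih hs (h.under hWP _)).1, ?_⟩
    simp only [Tm.subst, den, comp_lamMor, (ih hs (h.under hWP _)).2]
    rfl
  | app s t ihs iht =>
    exact ⟨⟨(ihs hs.1 h).1, (iht hs.2 h).1⟩, by
      simp only [Tm.subst, den_app, comp_ap, (ihs hs.1 h).2, (iht hs.2 h).2]⟩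
  | fst s ih => exact ⟨(ih hs h).1, by simp only [Tm.subst, den, (ih hs h).2, Category.assoc]⟩
  | snd s ih => exact ⟨(ih hs h).1, by simp only [Tm.subst, den, (ih hs h).2, Category.assoc]⟩
  | pair s t ihs iht =>
    exact ⟨⟨(ihs hs.1 h).1, (iht hs.2 h).1⟩, by
      simp only [Tm.subst, den, comp_lift, (ihs hs.1 h).2, (iht hs.2 h).2]⟩
  | const r => exact ⟨trivial, by simp [Tm.subst, den, ← Category.assoc]⟩
  | fn f s ih => exact ⟨(ih hs h).1, by simp only [Tm.subst, den, (ih hs h).2, Category.assoc]⟩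
  | jac f s ih => exact ⟨(ih hs h).1, by simp only [Tm.subst, den, (ih hs h).2, Category.assoc]⟩
  | dualMap s t ihs iht =>
    have h1 := ihs hs.1 (h.under hWP _)
    have h2 := iht hs.2.1 h
    refine ⟨⟨h1.1, h2.1, ?_⟩, M.comp_den_dualMap hs.2.2 _ _ _ _ h1.2 h2.2⟩
    rw [h1.2]
    exact hs.2.2.comp_left k
  | pb s t ihs iht =>
    have h1 := ihs hs.1 (h.under hWP _)
    have h2 := iht hs.2 h
    exact ⟨⟨h1.1, h2.1⟩, M.comp_den_pb _ _ _ _ _ h1.2 h2.2⟩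
  | dualVec r => exact ⟨trivial, (M.comp_den_dualVec hWP k _).symm⟩

theorem interpSubst_cons {Γ : List Ty} {σ : Ty} {t : Tm F Γ σ} (ht : M.SWF t) :
    M.InterpSubst (Subst.id.cons t) (lift (𝟙 (M.ctx Γ)) (M.den t)) := by
  intro τ x
  cases x with
  | zero => exact ⟨ht, by simp [Subst.cons, var]⟩
  | succ x => exact ⟨trivial, by simp [Subst.cons, Subst.id, var, den]⟩

theorem SWF.inst (hWP : WellPointed C) {Γ : List Ty} {σ τ : Ty} {s : Tm F (σ :: Γ) τ}
    {t : Tm F Γ σ} (hs : M.SWF s) (ht : M.SWF t) : M.SWF (s.inst t) :=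
  (swf_and_den_subst hWP hs (interpSubst_cons ht)).1

theorem SWF.den_inst (hWP : WellPointed C) {Γ : List Ty} {σ τ : Ty} {s : Tm F (σ :: Γ) τ}
    {t : Tm F Γ σ} (hs : M.SWF s) (ht : M.SWF t) :
    M.den (s.inst t) = lift (𝟙 (M.ctx Γ)) (M.den t) ≫ M.den s :=
  (swf_and_den_subst hWP hs (interpSubst_cons ht)).2

theorem SWF.inst1 (hWP : WellPointed C) {Γ : List Ty} {σ τ ρ : Ty}
    {s : Tm F (ρ :: σ :: Γ) τ} {t : Tm F Γ σ} (hs : M.SWF s) (ht : M.SWF t) :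
    M.SWF (s.inst1 t) :=
  (swf_and_den_subst hWP hs ((interpSubst_cons ht).under hWP _)).1

theorem SWF.den_inst1 (hWP : WellPointed C) {Γ : List Ty} {σ τ ρ : Ty}
    {s : Tm F (ρ :: σ :: Γ) τ} {t : Tm F Γ σ} (hs : M.SWF s) (ht : M.SWF t) :
    M.den (s.inst1 t) = M.underMor ρ (lift (𝟙 (M.ctx Γ)) (M.den t)) ≫ M.den s :=
  (swf_and_den_subst hWP hs ((interpSubst_cons ht).under hWP _)).2

variable (M) in
/-- The interpretation of the substitution that replaces two variables by one. -/
def unpairMor (Γ : List Ty) (σ τ : Ty) : M.ctx (Ty.prod σ τ :: Γ) ⟶ M.ctx (τ :: σ :: Γ) :=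
  lift (lift (fst _ _) (snd _ _ ≫ fst _ _)) (snd _ _ ≫ snd _ _)

theorem interpSubst_unpair {Γ : List Ty} {σ τ : Ty} :
    M.InterpSubst (Subst.unpair Γ σ τ) (M.unpairMor Γ σ τ) := by
  intro ρ x
  match x with
  | .zero => exact ⟨trivial, by simp [Subst.unpair, unpairMor, var, den]⟩
  | .succ .zero => exact ⟨trivial, by simp [Subst.unpair, unpairMor, var, den]⟩
  | .succ (.succ x) => exact ⟨trivial, by simp [Subst.unpair, unpairMor, var, den]⟩

/-- If the variable occurs, the term substituted for it is, up to weakening, a subterm of the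
result. This gives the well-formedness of summands when the distributivity of sums is used in either
direction. -/
theorem swf_of_subst (hWP : WellPointed C) {Γ : List Ty} {σ : Ty} {s : Tm F Γ σ}
    {Δ : List Ty} {r : Subst F Γ Δ} (hs : M.SWF (s.subst r)) {ρ : Ty} (x : Var Γ ρ)
    (hx : s.fv x.idx) : M.SWF (r _ x) := by
  induction s generalizing Δ with
  | zero => exact hx.elim
  | add s t ihs iht => exact hx.elim (ihs hs.1 x) (iht hs.2 x)
  | var y =>
    -- Occurrence is tested by index only; within one context the index determines the variable
    -- together with its type.
    have : ∀ {Γ : List Ty} {σ τ : Ty} (x : Var Γ σ) (y : Var Γ τ), y.idx = x.idx →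
        ∃ h : σ = τ, h ▸ x = y := by
      intro Γ σ τ x y h
      induction x with
      | zero => cases y with
        | zero => exact ⟨rfl, rfl⟩
        | succ y => simp [Var.idx] at h
      | succ x ih => cases y with
        | zero => simp [Var.idx] at h
        | succ y =>
          obtain ⟨rfl, h'⟩ := ih y (by simpa [Var.idx] using h)
          obtain rfl : x = y := h'
          exact ⟨rfl, rfl⟩
    obtain ⟨rfl, h⟩ := this x y hx
    obtain rfl : x = y := h
    exact hs
  | lam s ih => exact (ih (r := r.under) hs (.succ x) hx).of_wk hWP
  | app s t ihs iht => exact hx.elim (ihs hs.1 x) (iht hs.2 x)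
  | fst s ih => exact ih (r := r) hs x hx
  | snd s ih => exact ih (r := r) hs x hx
  | pair s t ihs iht => exact hx.elim (ihs hs.1 x) (iht hs.2 x)
  | const r => exact hx.elim
  | fn f s ih => exact ih (r := r) hs x hx
  | jac f s ih => exact ih (r := r) hs x hx
  | dualMap s t ihs iht =>
    exact hx.elim (fun hx => (ihs hs.1 (.succ x) hx).of_wk hWP) (iht hs.2.1 x)
  | pb s t ihs iht =>
    exact hx.elim (fun hx => (ihs hs.1 (.succ x) hx).of_wk hWP) (iht hs.2 x)
  | dualVec r => exact hx.elim

end DPPLModel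

/-! ### Tangents and pullbacks at a point -/

namespace DPPLModel

open CartesianDifferentialCategory

variable {F : FunSig} {C : Type*} [Category C] [CartesianMonoidalCategory C] [MonoidalClosed C]
  [DifferentialLambdaCategory C] (M : DPPLModel F C)

/-- The derivative of `f(γ, -)` at `a(γ)`, as a function of `γ` and of the direction. -/
def tangent {X A B : C} (f : X ⊗ A ⟶ B) (a : X ⟶ A) : X ⊗ A ⟶ B :=
  dAt f (lift 0 (snd X A)) (fst X A ≫ lift (𝟙 X) a)

theorem lift_tangent {X Y A B : C} (f : X ⊗ A ⟶ B) (a : X ⟶ A) (x : Y ⟶ X) (v : Y ⟶ A) :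
    lift x v ≫ tangent f a = dAt f (lift 0 v) (lift x (x ≫ a)) := by
  simp [tangent, comp_dAt, comp_lift, comp_zero]

theorem apD_den_pbAt {Γ : List Ty} {σ τ : Ty} (s : Tm F (σ :: Γ) τ) (w : Tm F Γ (Ty.form τ))
    (a : Tm F Γ σ) {Y : C} (x : Y ⟶ M.ctx Γ) (v : Y ⟶ M.ty σ) :
    M.apD (x ≫ M.den (Tm.pbAt s w a)) v =
      M.apD (ap (x ≫ M.den w) (lift x (x ≫ M.den a) ≫ M.den s))
        (lift x v ≫ tangent (M.den s) (M.den a)) := by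
  rw [Tm.pbAt, den_app, comp_ap, M.apD_ap_pb, lift_tangent]

theorem den_pbAt {Γ : List Ty} {σ τ : Ty} {s s' : Tm F (σ :: Γ) τ} {w : Tm F Γ (Ty.form τ)}
    {a : Tm F Γ σ} {b : Tm F Γ τ} (hs' : M.den s' = tangent (M.den s) (M.den a))
    (hb : M.den b = lift (𝟙 _) (M.den a) ≫ M.den s) :
    IsLinearSnd (X := M.ctx Γ) (A := M.ty σ) (M.den s') ∧
      M.den (Tm.pbAt s w a) = M.den (.dualMap s' (.app w b)) := by
  have hl : IsLinearSnd (X := M.ctx Γ) (A := M.ty σ) (M.den s') := by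
    rw [hs']
    exact isLinearSnd_dAt _ _
  refine ⟨hl, M.apD_ext fun Y x v => ?_⟩
  rw [M.apD_dualMap hl, M.apD_den_pbAt, den_app, comp_ap, hs', hb, ← Category.assoc x, comp_lift,
    Category.comp_id]

/-- Soundness of a reduction. -/
def Sound {Γ : List Ty} {σ : Ty} (s t : Tm F Γ σ) : Prop :=
  M.SWF s → M.SWF t ∧ M.den s = M.den t

/-- Each rule of the form `E ▷ S` is thereby reduced to two equations on denotations, one for the
tangent and one for the value. Linearity of the new dual map comes for free, because a tangent is
linear in its direction. -/
theorem sound_pbAt {Γ : List Ty} {σ τ : Ty} {s s' : Tm F (σ :: Γ) τ} {w : Tm F Γ (Ty.form τ)}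
    {a : Tm F Γ σ} {b : Tm F Γ τ}
    (h : M.SWF s → M.SWF a → (M.SWF s' ∧ M.SWF b) ∧
      (∀ ⦃Y : C⦄ (x : Y ⟶ M.ctx Γ) (v : Y ⟶ M.ty σ),
        lift x v ≫ M.den s' = dAt (M.den s) (lift 0 v) (lift x (x ≫ M.den a))) ∧
      M.den b = lift (𝟙 _) (M.den a) ≫ M.den s) :
    M.Sound (Tm.pbAt s w a) (.dualMap s' (.app w b)) := by
  rintro ⟨⟨hs, hw⟩, ha⟩
  obtain ⟨⟨hs', hb⟩, h1, h2⟩ := h hs ha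
  have h3 := M.den_pbAt (w := w)
    (pair_hom_ext fun Y x v => (h1 x v).trans (lift_tangent _ _ x v).symm) h2
  exact ⟨⟨hs', ⟨hw, hb⟩, h3.1⟩, h3.2⟩

theorem apD_dAt_dualMap {Γ : List Ty} {σ τ : Ty} {s : Tm F (σ :: Γ) τ} (t : Tm F Γ (Ty.dual τ))
    (hl : IsLinearSnd (X := M.ctx Γ) (A := M.ty σ) (M.den s)) {Y : C} (v x : Y ⟶ M.ctx Γ)
    (c : Y ⟶ M.ty σ) :
    M.apD (dAt (M.den (.dualMap s t)) v x) c =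
      M.apD (dAt (M.den t) v x) (lift x c ≫ M.den s) +
        M.apD (x ≫ M.den t) (dAt (M.den s) (lift v 0) (lift x c)) := by
  rw [den_dualMap, M.apD_dAt_lamDual (M.isLinearSnd_apD_comp _ hl), dAt_apD, dAt_comp, dAt_fst]
  simp only [lift_fst, lift_fst_assoc]

/-- The interpretation of iterated projections. -/
def path : {σ τ : Ty} → ProjPath σ τ → (M.ty σ ⟶ M.ty τ)
  | _, _, .nil => 𝟙 _
  | _, _, .fst p => path p ≫ fst _ _
  | _, _, .snd p => path p ≫ snd _ _

theorem isLinearMor_path : {σ τ : Ty} → (p : ProjPath σ τ) → IsLinearMor (M.path p)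
  | _, _, .nil => by simpa only [path] using isLinearMor_id
  | _, _, .fst p => by simpa only [path] using (isLinearMor_path p).comp isLinearMor_fst
  | _, _, .snd p => by simpa only [path] using (isLinearMor_path p).comp isLinearMor_snd

theorem den_path {Γ : List Ty} {σ τ : Ty} (p : ProjPath σ τ) (t : Tm F Γ σ) :
    M.den (p.of t) = M.den t ≫ M.path p := by
  induction p with
  | nil => simp only [ProjPath.of, path, Category.comp_id]
  | fst p ih => simp only [ProjPath.of, den, path, ih, Category.assoc]
  | snd p ih => simp only [ProjPath.of, den, path, ih, Category.assoc]

theorem swf_path {Γ : List Ty} {σ τ : Ty} (p : ProjPath σ τ) {t : Tm F Γ σ} (ht : M.SWF t) :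
    M.SWF (p.of t) := by
  induction p with
  | nil => exact ht
  | fst p ih => exact ih
  | snd p ih => exact ih

theorem den_v0 {Γ : List Ty} {σ : Ty} : M.den (Tm.v0 : Tm F (σ :: Γ) σ) = snd _ _ := rfl

theorem lift_den_path {Γ : List Ty} {σ τ : Ty} (p : ProjPath σ τ) {Y : C} (x : Y ⟶ M.ctx Γ)
    (v : Y ⟶ M.ty σ) : lift x v ≫ M.den (p.of (Tm.v0 : Tm F (σ :: Γ) σ)) = v ≫ M.path p := by
  rw [den_path, den_v0, lift_snd_assoc]

theorem dAt_den_path {Γ : List Ty} {σ τ : Ty} (p : ProjPath σ τ) {Y : C}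
    (v x : Y ⟶ M.ctx Γ) (w a : Y ⟶ M.ty σ) :
    dAt (M.den (p.of (Tm.v0 : Tm F (σ :: Γ) σ))) (lift v w) (lift x a) = w ≫ M.path p := by
  rw [den_path, den_v0, dAt_comp, dAt_snd, (M.isLinearMor_path p).dAt_eq, lift_snd]

variable {M} in
theorem SWF.lift_den_wk (hWP : WellPointed C) {Γ : List Ty} {σ τ : Ty} {s : Tm F Γ τ}
    (hs : M.SWF s) {Y : C} (x : Y ⟶ M.ctx Γ) (v : Y ⟶ M.ty σ) :
    lift x v ≫ M.den (s.wk (τ := σ)) = x ≫ M.den s := by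
  rw [hs.den_wk hWP, lift_fst_assoc]

variable {M} in
theorem SWF.dAt_den_wk (hWP : WellPointed C) {Γ : List Ty} {σ τ : Ty} {s : Tm F Γ τ}
    (hs : M.SWF s) {Y : C} (x : Y ⟶ M.ctx (σ :: Γ)) (v : Y ⟶ M.ty σ) :
    dAt (M.den (s.wk (τ := σ))) (lift 0 v) x = 0 := by
  rw [hs.den_wk hWP, dAt_comp, dAt_fst, lift_fst, dAt_zero_left]

variable {M} in
theorem SWF.lift_den_wk1 (hWP : WellPointed C) {Γ : List Ty} {σ τ ρ : Ty} {s : Tm F (ρ :: Γ) τ}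
    (hs : M.SWF s) {Y : C} (x : Y ⟶ M.ctx Γ) (v : Y ⟶ M.ty σ) (c : Y ⟶ M.ty ρ) :
    lift (lift x v) c ≫ M.den (s.wk1 (τ := σ)) = lift x c ≫ M.den s := by
  rw [hs.den_wk1 hWP, underMor, ← Category.assoc, comp_lift]
  simp

variable {M} in
theorem SWF.dAt_den_wk1 (hWP : WellPointed C) {Γ : List Ty} {σ τ ρ : Ty} {s : Tm F (ρ :: Γ) τ}
    (hs : M.SWF s) {Y : C} (u x : Y ⟶ M.ctx Γ) (v w : Y ⟶ M.ty σ) (d c : Y ⟶ M.ty ρ) :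
    dAt (M.den (s.wk1 (τ := σ))) (lift (lift u v) d) (lift (lift x w) c) =
      dAt (M.den s) (lift u d) (lift x c) := by
  rw [hs.den_wk1 hWP, underMor, dAt_comp, dAt_lift, dAt_comp, dAt_fst, dAt_fst, dAt_snd, comp_lift]
  simp

variable {M} in
theorem SWF.lift_den_swap (hWP : WellPointed C) {Γ : List Ty} {σ τ ρ : Ty}
    {s : Tm F (ρ :: σ :: Γ) τ} (hs : M.SWF s) {Y : C} (x : Y ⟶ M.ctx Γ) (v : Y ⟶ M.ty σ)
    (c : Y ⟶ M.ty ρ) :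
    lift (lift x c) v ≫ M.den s.swap = lift (lift x v) c ≫ M.den s := by
  rw [hs.den_swap hWP, swapMor, ← Category.assoc, comp_lift, comp_lift]
  simp

variable {M} in
theorem SWF.dAt_den_swap (hWP : WellPointed C) {Γ : List Ty} {σ τ ρ : Ty}
    {s : Tm F (ρ :: σ :: Γ) τ} (hs : M.SWF s) {Y : C} (u x : Y ⟶ M.ctx Γ) (v w : Y ⟶ M.ty σ)
    (d c : Y ⟶ M.ty ρ) :
    dAt (M.den s.swap) (lift (lift u d) v) (lift (lift x c) w) =
      dAt (M.den s) (lift (lift u v) d) (lift (lift x w) c) := by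
  rw [hs.den_swap hWP, swapMor, dAt_comp, dAt_lift, dAt_lift, dAt_comp, dAt_comp]
  simp [dAt_fst, dAt_snd, comp_lift]

variable {M} in
theorem SWF.lift_den_inst1 (hWP : WellPointed C) {Γ : List Ty} {σ τ ρ : Ty}
    {s : Tm F (ρ :: σ :: Γ) τ} {t : Tm F Γ σ} (hs : M.SWF s) (ht : M.SWF t) {Y : C}
    (x : Y ⟶ M.ctx Γ) (c : Y ⟶ M.ty ρ) :
    lift x c ≫ M.den (s.inst1 t) = lift (lift x (x ≫ M.den t)) c ≫ M.den s := by
  rw [hs.den_inst1 hWP ht, underMor, ← Category.assoc, comp_lift]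
  simp [comp_lift]

/-! ### Separation -/

theorem apD_ap_constForm {τ : Ty} {l : M.ty τ ⟶ M.R} (hl : IsLinearMor l) {X : C} (x : X ⟶ 𝟙_ C)
    (a v : X ⟶ M.ty τ) : M.apD (ap (x ≫ M.constForm l) a) v = v ≫ l := by
  rw [constForm, ap_lamMor, M.apD_lamDual (isLinearSnd_snd_comp hl), lift_snd_assoc]

/-- The pullback of a constant form `λ x. l` is the derivative composed with `l`. -/
theorem apD_pbAt_constForm (hWP : WellPointed C) {Γ : List Ty} {σ τ : Ty} {s : Tm F (σ :: Γ) τ}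
    {a : Tm F Γ σ} (hs : M.SWF s) (ha : M.SWF a) {l : M.ty τ ⟶ M.R} (hl : IsLinearMor l)
    (γ : 𝟙_ C ⟶ M.ctx Γ) (v : 𝟙_ C ⟶ M.ty σ) :
    M.apD (lift γ (M.constForm l) ≫ M.den (Tm.pbAt s.wk1 Tm.v0 a.wk)) v =
      lift γ v ≫ tangent (M.den s) (M.den a) ≫ l := by
  have h := M.apD_ap_constForm hl (𝟙 _)
  simp only [Category.id_comp] at h
  refine (M.apD_den_pbAt s.wk1 Tm.v0 a.wk (lift γ (M.constForm l)) v).trans ?_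
  rw [den_v0, lift_snd, h, lift_tangent, ha.lift_den_wk hWP, ← lift_zero_zero,
    hs.dAt_den_wk1 hWP, ← Category.assoc, lift_tangent]

/-- A constant form ignores the point at which it is taken, so `b` disappears. -/
theorem apD_dualMap_constForm {Γ : List Ty} {σ τ : Ty} {s : Tm F (σ :: Ty.form τ :: Γ) τ}
    {b : Tm F (Ty.form τ :: Γ) τ}
    (hs : IsLinearSnd (X := M.ctx (Ty.form τ :: Γ)) (A := M.ty σ) (M.den s))
    {l : M.ty τ ⟶ M.R} (hl : IsLinearMor l) (γ : 𝟙_ C ⟶ M.ctx Γ) (v : 𝟙_ C ⟶ M.ty σ) :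
    M.apD (lift γ (M.constForm l) ≫ M.den (.dualMap s (.app Tm.v0 b))) v =
      lift (lift γ (M.constForm l)) v ≫ M.den s ≫ l := by
  have h := M.apD_ap_constForm hl (𝟙 _)
  simp only [Category.id_comp] at h
  rw [M.apD_dualMap hs, den_app, comp_ap, den_v0, lift_snd, h, Category.assoc]

/-- Well-pointedness reduces the equation to elements, and linear functionals separate these. -/
theorem HahnBanach.hom_ext {M : DPPLModel F C} (hHB : M.HahnBanach) (hWP : WellPointed C)
    {X A B : C} {f g : X ⊗ A ⟶ B}
    (h : ∀ (x : 𝟙_ C ⟶ X) (v : 𝟙_ C ⟶ A) (l : B ⟶ M.R), IsLinearMor l →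
      lift x v ≫ f ≫ l = lift x v ≫ g ≫ l) : f = g := by
  apply hWP
  intro x
  by_contra hne
  obtain ⟨l, hl, hl'⟩ := hHB _ _ hne
  apply hl'
  have := h (x ≫ fst _ _) (x ≫ snd _ _) l hl
  rw [← comp_lift, lift_fst_snd, Category.comp_id] at this
  simpa using this

/-- The converse to `den_pbAt` on which all tangent premises rest. The form variable is interpreted
by constant forms, whose functionals `l` are then removed by separation. It is essential that the
tangent `s'` is weakened by the form variable and so does not depend on the chosen `l`. -/
theorem tangent_of_den_pbAt (hHB : M.HahnBanach) (hWP : WellPointed C) {Γ : List Ty} {σ τ : Ty}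
    {s s' : Tm F (σ :: Γ) τ} {a : Tm F Γ σ} {b : Tm F (Ty.form τ :: Γ) τ} (hs : M.SWF s)
    (ha : M.SWF a) (h : M.Sound (Tm.pbAt s.wk1 Tm.v0 a.wk) (.dualMap s'.wk1 (.app Tm.v0 b))) :
    M.SWF s' ∧ M.den s' = tangent (M.den s) (M.den a) := by
  obtain ⟨h1, h2⟩ := h ⟨⟨hs.wk1 hWP, trivial⟩, ha.wk hWP⟩
  have hs' : M.SWF s' := h1.1.of_wk1 hWP
  refine ⟨hs', hHB.hom_ext hWP fun γ v l hl => ?_⟩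
  rw [← M.apD_pbAt_constForm hWP hs ha hl, h2, M.apD_dualMap_constForm h1.2.2 hl,
    ← Category.assoc, ← Category.assoc, hs'.lift_den_wk1 hWP]

theorem tangent_of_den_pbAt_zero (hHB : M.HahnBanach) (hWP : WellPointed C) {Γ : List Ty}
    {σ τ : Ty} {s : Tm F (σ :: Γ) τ} {a : Tm F Γ σ} (hs : M.SWF s) (ha : M.SWF a)
    (h : M.Sound (Tm.pbAt s.wk1 Tm.v0 a.wk : Tm F (Ty.form τ :: Γ) (Ty.dual σ)) .zero) :
    tangent (M.den s) (M.den a) = 0 := by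
  obtain ⟨-, h2⟩ := h ⟨⟨hs.wk1 hWP, trivial⟩, ha.wk hWP⟩
  refine hHB.hom_ext hWP fun γ v l hl => ?_
  rw [← M.apD_pbAt_constForm hWP hs ha hl, h2, den, comp_zero, apD_zero_left, ← Category.assoc,
    comp_zero, hl.zero_comp]

end DPPLModel

/-- The derivative in the first variable of a function that is linear in its second variable is
linear in the second variable. -/
theorem IsLinearSnd.dAt_fst_linear {C : Type*} [Category C] [CartesianMonoidalCategory C]
    [CartesianDifferentialCategory C] {X Z A B : C} {f : X ⊗ A ⟶ B} (hf : IsLinearSnd f)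
    (u y : Z ⟶ X) :
    IsLinearSnd (dAt f (lift (fst Z A ≫ u) 0) (lift (fst Z A ≫ y) (snd Z A))) := by
  rw [isLinearSnd_iff]
  intro Y v z a
  -- The equation expressing linearity in the second variable is differentiated along the first one.
  -- By [CD7] the two differentiations may be exchanged, which turns the result into the goal.
  have h := congrArg (fun g => dAt g (lift (lift (z ≫ u) 0) 0) (lift (lift (z ≫ y) a) v))
    (hf.dAt_eq (snd (X ⊗ A) A) (fst (X ⊗ A) A ≫ fst X A) (fst (X ⊗ A) A ≫ snd X A))
  simp only [dAt_dAt, dAt_lift, dAt_comp, dAt_fst, dAt_snd, dAt_zero, dAt_zero_left, comp_lift,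
    lift_fst, lift_snd, lift_fst_assoc,
    CartesianDifferentialCategory.comp_zero, lift_zero_zero] at h ⊢
  rw [dAt_D_symm, h, comp_dAt]
  simp only [comp_lift, lift_fst_assoc, lift_snd, CartesianDifferentialCategory.comp_zero]

/-! ### Soundness of the reductions -/

namespace DPPLModel

open CartesianDifferentialCategory

variable {F : FunSig} {C : Type*} [Category C] [CartesianMonoidalCategory C] [MonoidalClosed C]
  [DifferentialLambdaCategory C] (M : DPPLModel F C)

variable {M} in
theorem SWF.isLinearSnd_wk1 (hWP : WellPointed C) {Γ : List Ty} {σ ρ : Ty} {s : Tm F (ρ :: Γ) σ}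
    (hs : M.SWF s) (hl : IsLinearSnd (X := M.ctx Γ) (A := M.ty ρ) (M.den s)) (τ : Ty) :
    IsLinearSnd (X := M.ctx (τ :: Γ)) (A := M.ty ρ) (M.den (s.wk1 (τ := τ))) := by
  rw [hs.den_wk1 hWP]
  exact hl.comp_left _

variable {M} in
theorem SWF.isLinearSnd_of_wk1 (hWP : WellPointed C) {Γ : List Ty} {σ ρ τ : Ty}
    {s : Tm F (ρ :: Γ) σ} (hs : M.SWF s)
    (hl : IsLinearSnd (X := M.ctx (τ :: Γ)) (A := M.ty ρ) (M.den (s.wk1 (τ := τ)))) :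
    IsLinearSnd (X := M.ctx Γ) (A := M.ty ρ) (M.den s) := by
  rw [hs.den_wk1 hWP] at hl
  exact hl.of_comp_left (j := lift (𝟙 _) 0) (lift_fst _ _)

/-! ### Identifications on sums -/

theorem den_inst_zero (hWP : WellPointed C) {Γ : List Ty} {σ τ : Ty} {s : Tm F (σ :: Γ) τ}
    (hs : s.WF) (hl : s.lin 0) : M.den (s.inst .zero) = 0 := by
  have h := M.swf_and_linearVar hWP s hs
  rw [h.1.den_inst hWP (t := .zero) trivial]
  exact (M.isLinearSnd_of_linearVar (h.2 0 hl)).zero_comp _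

theorem sound_sumEq (hWP : WellPointed C) {Γ : List Ty} {σ : Ty} {s t : Tm F Γ σ}
    (h : SumEq s t) : M.Sound s t ∧ M.Sound t s := by
  cases h with
  | zero_add =>
    exact ⟨fun h => ⟨h.2, zero_add _⟩, fun h => ⟨⟨trivial, h⟩, (zero_add _).symm⟩⟩
  | comm s t =>
    exact ⟨fun h => ⟨⟨h.2, h.1⟩, add_comm _ _⟩, fun h => ⟨⟨h.2, h.1⟩, add_comm _ _⟩⟩
  | assoc =>
    exact ⟨fun h => ⟨⟨h.1.1, h.1.2, h.2⟩, add_assoc _ _ _⟩,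
      fun h => ⟨⟨⟨h.1, h.2.1⟩, h.2.2⟩, (add_assoc _ _ _).symm⟩⟩
  | distrib s a b hs hl =>
    have hs' := M.swf_and_linearVar hWP s hs
    -- If the variable occurs in `s`, well-formedness of an instance passes to the substituted term,
    -- and hence to `a` and `b`.
    by_cases hfv : s.fv 0
    · have key : ∀ {t}, M.SWF (s.inst t) → M.SWF t :=
        fun {t} h => swf_of_subst hWP (r := Subst.id.cons t) h .zero hfv
      have hden : M.SWF a → M.SWF b →
          M.den (s.inst (.add a b)) = M.den (.add (s.inst a) (s.inst b)) := by
        intro ha hb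
        simp only [den]
        rw [hs'.1.den_inst hWP (t := .add a b) ⟨ha, hb⟩, hs'.1.den_inst hWP ha,
          hs'.1.den_inst hWP hb]
        exact (M.isLinearSnd_of_linearVar (hs'.2 0 hl)).add_comp _ _ _
      refine ⟨fun h => ?_, fun h => ?_⟩
      · obtain ⟨ha, hb⟩ := key h
        exact ⟨⟨hs'.1.inst hWP ha, hs'.1.inst hWP hb⟩, hden ha hb⟩
      · have ha := key h.1
        have hb := key h.2
        exact ⟨hs'.1.inst hWP (t := .add a b) ⟨ha, hb⟩, (hden ha hb).symm⟩
    -- Otherwise nothing is known about `a` and `b`, but all instances equal the one at `0`. By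
    -- linearity this denotes `0`, and `0 = 0 + 0`.
    · have key : ∀ t, s.inst t = s.inst .zero := fun t => s.subst_congr fun ρ x hx => by
        cases x with
        | zero => exact (hfv hx).elim
        | succ x => rfl
      have hden : M.den (s.inst .zero) = M.den (.add (s.inst .zero) (s.inst .zero)) := by
        simp only [den]
        rw [M.den_inst_zero hWP hs hl, add_zero]
      rw [key a, key b, key (.add a b)]
      exact ⟨fun h => ⟨⟨h, h⟩, hden⟩, fun h => ⟨h.1, hden.symm⟩⟩
  | distrib_zero s hs hl =>
    exact ⟨fun _ => ⟨trivial, M.den_inst_zero hWP hs hl⟩,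
      fun _ => ⟨(M.swf_and_linearVar hWP s hs).1.inst hWP (t := .zero) trivial,
        (M.den_inst_zero hWP hs hl).symm⟩⟩

/-! ### Administrative reductions -/

theorem den_letIn {Γ : List Ty} {σ τ : Ty} (t : Tm F Γ σ) (s : Tm F (σ :: Γ) τ) :
    M.den (Tm.letIn t s) = lift (𝟙 (M.ctx Γ)) (M.den t) ≫ M.den s := by
  rw [Tm.letIn, den_app, den, ap_lamMor']

theorem den_v1 {Γ : List Ty} {σ τ : Ty} :
    M.den (Tm.v1 : Tm F (τ :: σ :: Γ) σ) = fst _ _ ≫ snd _ _ := rfl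

theorem den_letIn_v0 {Γ : List Ty} {σ : Ty} (t : Tm F Γ σ) :
    M.den (Tm.letIn t Tm.v0) = M.den t := by
  rw [den_letIn, den_v0, lift_snd]

theorem sound_aRule (hWP : WellPointed C) {Γ : List Ty} {σ : Ty} {s t : Tm F Γ σ}
    (h : ARule s t) : M.Sound s t := by
  cases h with
  | zero => exact fun h => ⟨⟨trivial, h⟩, (M.den_letIn_v0 _).symm⟩
  | add s t =>
    refine fun h => ⟨⟨⟨⟨trivial, trivial, trivial⟩, h.2.wk hWP⟩, h.1⟩, ?_⟩
    simp only [den_letIn, den, den_v0, den_v1, h.2.den_wk hWP, comp_add, lift_snd, lift_fst,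
      ← Category.assoc, Category.id_comp]
  | var => exact fun h => ⟨⟨trivial, h⟩, (M.den_letIn_v0 _).symm⟩
  | lam => exact fun h => ⟨⟨trivial, h⟩, (M.den_letIn_v0 _).symm⟩
  | app s t =>
    refine fun h => ⟨⟨⟨⟨trivial, trivial, trivial⟩, h.2.wk hWP⟩, h.1⟩, ?_⟩
    simp only [den_letIn, den_app, den_v0, den_v1, h.2.den_wk hWP, comp_ap,
      lift_snd, lift_fst, ← Category.assoc, Category.id_comp]
  | fst =>
    refine fun h => ⟨⟨⟨trivial, trivial⟩, h⟩, ?_⟩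
    rw [den_letIn, den_letIn_v0]
    simp only [den, den_v0, lift_snd_assoc]
  | snd =>
    refine fun h => ⟨⟨⟨trivial, trivial⟩, h⟩, ?_⟩
    rw [den_letIn, den_letIn_v0]
    simp only [den, den_v0, lift_snd_assoc]
  | pair s t =>
    refine fun h => ⟨⟨⟨⟨trivial, trivial, trivial⟩, h.2.wk hWP⟩, h.1⟩, ?_⟩
    simp only [den_letIn, den, den_v0, den_v1, h.2.den_wk hWP, comp_lift,
      lift_snd, lift_fst, ← Category.assoc, Category.id_comp]
  | const => exact fun h => ⟨⟨trivial, h⟩, (M.den_letIn_v0 _).symm⟩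
  | fn =>
    refine fun h => ⟨⟨⟨trivial, trivial⟩, h⟩, ?_⟩
    rw [den_letIn, den_letIn_v0]
    simp only [den, den_v0, lift_snd_assoc]
  | jac =>
    refine fun h => ⟨⟨⟨trivial, trivial⟩, h⟩, ?_⟩
    rw [den_letIn, den_letIn_v0]
    simp only [den, den_v0, lift_snd_assoc]
  | dualMap s t =>
    rintro ⟨hs, ht, hl⟩
    have hl' := hs.isLinearSnd_wk1 hWP hl
    refine ⟨⟨⟨trivial, hs.wk1 hWP, trivial, hl' _⟩, ht⟩, M.apD_ext fun Y x v => ?_⟩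
    rw [den_letIn, den_letIn_v0, M.apD_dualMap hl, ← Category.assoc, M.apD_dualMap (hl' _), den_v0,
      comp_lift, hs.lift_den_wk1 hWP, lift_snd, Category.comp_id]
  | pb s t =>
    rintro ⟨hs, ht⟩
    refine ⟨⟨⟨trivial, hs.wk1 hWP, trivial⟩, ht⟩, ?_⟩
    apply ap_congr_of_forall
    intro Y x a
    apply M.apD_ext
    intro Z y v
    rw [den_letIn, den_letIn_v0, comp_ap, comp_ap, ← Category.assoc, ← Category.assoc,
      ← Category.assoc (y ≫ x), M.apD_ap_pb, M.apD_ap_pb s.wk1 Tm.v0, den_v0, comp_lift,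
      hs.lift_den_wk1 hWP, ← lift_zero_zero, hs.dAt_den_wk1 hWP, lift_snd, Category.comp_id]
  | dualVec => exact fun h => ⟨⟨trivial, h⟩, (M.den_letIn_v0 _).symm⟩
  | flatten e s t =>
    rintro ⟨ht, hs, he⟩
    refine ⟨⟨⟨ht.wk1 hWP, hs⟩, he⟩, ?_⟩
    simp only [den_letIn]
    rw [← Category.assoc, comp_lift, Category.comp_id, ht.lift_den_wk1 hWP]

/-! ### Vectors -/

theorem toVec_injective (n : ℕ) : Function.Injective (M.toVec M.num n) :=
  Function.LeftInverse.injective (M.ofVec_toVec M.num n)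

theorem den_vec {Γ : List Ty} : (n : ℕ) → (r : Fin (n + 1) → ℝ) →
    M.den (Tm.vec n r : Tm F Γ (Ty.pow n)) = toUnit _ ≫ M.ofVec M.num n r
  | 0, _ => rfl
  | n + 1, r => by
    simp only [Tm.vec, den, den_vec n, TyModel.ofVec, comp_lift]

theorem swf_vec {Γ : List Ty} : (n : ℕ) → (r : Fin (n + 1) → ℝ) →
    M.SWF (Tm.vec n r : Tm F Γ (Ty.pow n))
  | 0, _ => trivial
  | n + 1, _ => ⟨swf_vec n _, trivial⟩

theorem ofVec_sym {n m : ℕ} (f : F.fns n m) (r : Fin (n + 1) → ℝ) :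
    M.ofVec M.num n r ≫ M.sym f = M.ofVec M.num m (f.1 r) := by
  apply M.toVec_injective
  rw [M.toVec_ofVec, ← M.toFun_sym f]
  rfl

theorem fderiv_apply_eq_jacobian {n m : ℕ} (f : (Fin (n + 1) → ℝ) → (Fin (m + 1) → ℝ))
    (x v : Fin (n + 1) → ℝ) : fderiv ℝ f x v = (jacobian f x).mulVec v := by
  rw [jacobian, ← Matrix.toLin'_apply, Matrix.toLin'_toMatrix']
  rfl

theorem ofVec_D {n m : ℕ} (f : F.fns n m) (v r : Fin (n + 1) → ℝ) :
    lift (M.ofVec M.num n v) (M.ofVec M.num n r) ≫ D (M.sym f) =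
      M.ofVec M.num m ((jacobian f.1 r).mulVec v) := by
  apply M.toVec_injective
  rw [M.toVec_ofVec, ← fderiv_apply_eq_jacobian, ← M.toFun_sym f, (M.hasFDerivAt _ _).2]

theorem apD_dualVec (hWP : WellPointed C) {Γ : List Ty} {n : ℕ} (r : Fin (n + 1) → ℝ) {X : C}
    (x : X ⟶ M.ctx Γ) (v : X ⟶ M.ty (Ty.pow n)) :
    M.apD (x ≫ M.den (.dualVec r : Tm F Γ _)) v = v ≫ M.linForm n r := by
  simp only [den]
  rw [M.apD_lamDual (isLinearSnd_snd_comp (M.isLinearMor_linForm hWP n r)), lift_snd_assoc]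

/-- Well-pointedness is applied to the uncurried morphisms on `X ⊗ A`, so functionals may be
compared on elements alone, where their values are real numbers. -/
theorem apD_ext_elements (hWP : WellPointed C) {X A : C} {f g : X ⟶ M.dual A}
    (h : ∀ (x : 𝟙_ C ⟶ X) (a : 𝟙_ C ⟶ A), M.apD (x ≫ f) a = M.apD (x ≫ g) a) : f = g := by
  have key : M.apD (fst X A ≫ f) (snd X A) = M.apD (fst X A ≫ g) (snd X A) := by
    apply hWP
    intro x
    simpa only [comp_apD, Category.assoc] using h (x ≫ fst _ _) (x ≫ snd _ _)
  apply M.apD_ext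
  intro Y x a
  simpa [comp_apD] using congrArg (fun t => lift x a ≫ t) key

/-! ### Reductions without premises -/

/-- The chain rule: `λ y. let x = e in s` is `⟨y, e⟩` followed by `s`, and pullback is
contravariantly functorial. -/
theorem sound_pb_let {Γ : List Ty} {σ τ ρ : Ty} (hWP : WellPointed C) (e : Tm F (σ :: Γ) ρ)
    (s : Tm F (ρ :: σ :: Γ) τ) (w : Tm F Γ (Ty.form τ)) :
    M.Sound (.pb (.letIn e s) w) (.pb (.pair .v0 e) (.pb (s.subst (Subst.unpair Γ σ ρ)) w)) := by
  rintro ⟨⟨hs, he⟩, hw⟩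
  have h := swf_and_den_subst hWP (s := s) hs interpSubst_unpair
  refine ⟨⟨⟨trivial, he⟩, h.1, hw⟩, ?_⟩
  apply ap_congr_of_forall
  intro Y x a
  apply M.apD_ext
  intro Z y v
  rw [comp_ap, comp_ap, ← Category.assoc, ← Category.assoc, M.apD_ap_pb, M.apD_ap_pb, M.apD_ap_pb,
    h.2, unpairMor, den_letIn]
  simp only [den, den_v0, dAt_comp, dAt_lift, dAt_fst, dAt_snd, dAt_id, ← Category.assoc, comp_lift,
    lift_fst, lift_snd, Category.comp_id]

theorem isLinearSnd_comp_snd {X A B E : C} {f : X ⊗ A ⟶ B} {g : X ⊗ B ⟶ E}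
    (hf : IsLinearSnd f) (hg : IsLinearSnd g) : IsLinearSnd (lift (fst X A) f ≫ g) := by
  rw [isLinearSnd_iff]
  intro Y v x a
  rw [dAt_comp, dAt_lift, hf.dAt_eq, dAt_fst, comp_lift, lift_fst, lift_fst, hg.dAt_eq,
    ← Category.assoc, comp_lift, lift_fst]

theorem sound_dual_dual (hWP : WellPointed C) {Γ : List Ty} {σ τ ρ : Ty} (a : Tm F (σ :: Γ) τ)
    (b : Tm F (τ :: Γ) ρ) (c : Tm F Γ (Ty.dual ρ)) :
    M.Sound (.dualMap a (.dualMap b c)) (.dualMap (b.wk1.inst a) c) := by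
  rintro ⟨ha, ⟨hb, hc, hlb⟩, hla⟩
  have h1 : M.den (b.wk1.inst a) = lift (fst (M.ctx Γ) (M.ty σ)) (M.den a) ≫ M.den b := by
    rw [(hb.wk1 hWP).den_inst hWP ha]
    have := hb.lift_den_wk1 hWP (fst (M.ctx Γ) (M.ty σ)) (snd _ _) (M.den a)
    rwa [lift_fst_snd] at this
  have hl : IsLinearSnd (X := M.ctx Γ) (A := M.ty σ) (M.den (b.wk1.inst a)) := by
    rw [h1]
    exact isLinearSnd_comp_snd hla hlb
  refine ⟨⟨(hb.wk1 hWP).inst hWP ha, hc, hl⟩, M.apD_ext fun Y x v => ?_⟩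
  rw [M.apD_dualMap hla, M.apD_dualMap hlb, M.apD_dualMap hl, h1, ← Category.assoc (lift x v),
    comp_lift, lift_fst]

/-- On elements this is adjointness of the transpose: `r' · (J v) = (Jᵀ r') · v`. -/
theorem sound_dual_jac (hWP : WellPointed C) {Γ : List Ty} {n m : ℕ} (f : F.fns n m)
    (r : Fin (n + 1) → ℝ) (r' : Fin (m + 1) → ℝ) :
    M.Sound (.dualMap (.app (.jac f .v0) (.vec n r)) (.dualVec r') : Tm F Γ (Ty.dual (Ty.pow n)))
      (.dualVec ((jacobian f.1 r).transpose.mulVec r')) := by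
  rintro ⟨-, -, hl⟩
  refine ⟨trivial, M.apD_ext_elements hWP fun x v => ?_⟩
  rw [M.apD_dualMap hl, M.apD_dualVec hWP, M.apD_dualVec hWP]
  apply M.num.injective
  rw [M.num_linForm, M.num_linForm, den_app, comp_ap, den, den_v0, lift_snd_assoc, den_vec,
    ap_lamMor, ← Category.assoc (lift x v), ← M.ofVec_toVec M.num n v,
    Subsingleton.elim (lift x (M.ofVec M.num n (M.toVec M.num n v)) ≫ toUnit _) (𝟙 _),
    Category.id_comp, M.ofVec_D, M.toVec_ofVec, M.toVec_ofVec]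
  change r' ⬝ᵥ _ = _ ⬝ᵥ _
  rw [Matrix.mulVec_transpose, Matrix.dotProduct_mulVec]

theorem sound_rule (hWP : WellPointed C) {Γ : List Ty} {σ : Ty} {s t : Tm F Γ σ}
    (h : Rule s t) : M.Sound s t := by
  cases h with
  | beta s a =>
    rintro ⟨hs, ha⟩
    exact ⟨hs.inst hWP ha, by rw [hs.den_inst hWP ha]; exact M.den_letIn a s⟩
  | fst_pair a b => exact fun h => ⟨h.1, by simp only [den, lift_fst]⟩
  | snd_pair a b => exact fun h => ⟨h.2, by simp only [den, lift_snd]⟩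
  | fn_vec f r =>
    exact fun _ => ⟨M.swf_vec _ _, by
      simp only [den, den_vec, Category.assoc, M.ofVec_sym]⟩
  | jac_vec f r r' =>
    exact fun _ => ⟨M.swf_vec _ _, by
      rw [den_app, den, den_vec, den_vec, den_vec, ap_lamMor, ← M.ofVec_D, ← comp_lift,
        Category.assoc]⟩
  | dual_jac f r r' => exact M.sound_dual_jac hWP f r r'
  | dual_dual a b c => exact M.sound_dual_dual hWP a b c
  | pb_let_base e w =>
    rintro ⟨⟨-, he⟩, hw⟩
    refine ⟨⟨he, hw⟩, ?_⟩
    simp only [den, den_letIn_v0]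
  | pb_let e s w => exact M.sound_pb_let hWP e s w
  | pb_const e w a =>
    rintro ⟨⟨he, hw⟩, ha⟩
    refine ⟨trivial, M.apD_ext fun Y x v => ?_⟩
    rw [apD_den_pbAt, lift_tangent, (he.of_wk hWP).dAt_den_wk hWP, den, comp_zero,
      apD_zero_right, apD_zero_left]
  | pb_add_left z q w a =>
    refine M.sound_pbAt fun hs ha => ⟨⟨M.swf_path _ trivial, hs.1.of_wk hWP, M.swf_path _ ha⟩, ?_⟩
    have hz := hs.1.of_wk hWP
    simp only [den, dAt_add, comp_add, lift_den_path, dAt_den_path, hz.dAt_den_wk hWP,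
      hz.lift_den_wk hWP, M.den_path _ a, zero_add, Category.id_comp, implies_true, and_self]
  | pb_add p q w a =>
    refine M.sound_pbAt fun hs ha => ⟨⟨⟨M.swf_path _ trivial, M.swf_path _ trivial⟩,
      M.swf_path _ ha, M.swf_path _ ha⟩, ?_⟩
    simp only [den, dAt_add, comp_add, lift_den_path, dAt_den_path, M.den_path _ a, implies_true,
      and_self]
  | pb_proj p w a =>
    refine M.sound_pbAt fun hs ha => ⟨⟨M.swf_path _ trivial, M.swf_path _ ha⟩, ?_⟩
    simp only [lift_den_path, dAt_den_path, M.den_path _ a, implies_true, and_self]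
  | pb_pair_left p z w a =>
    refine M.sound_pbAt fun hs ha => ⟨⟨⟨M.swf_path _ trivial, trivial⟩, M.swf_path _ ha,
      hs.2.of_wk hWP⟩, ?_⟩
    have hz := hs.2.of_wk hWP
    simp only [den, dAt_lift, comp_lift, comp_zero, lift_den_path, dAt_den_path,
      hz.dAt_den_wk hWP, hz.lift_den_wk hWP, M.den_path _ a, Category.id_comp, implies_true,
      and_self]
  | pb_pair_right z q w a =>
    refine M.sound_pbAt fun hs ha => ⟨⟨⟨trivial, M.swf_path _ trivial⟩, hs.1.of_wk hWP,
      M.swf_path _ ha⟩, ?_⟩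
    have hz := hs.1.of_wk hWP
    simp only [den, dAt_lift, comp_lift, comp_zero, lift_den_path, dAt_den_path,
      hz.dAt_den_wk hWP, hz.lift_den_wk hWP, M.den_path _ a, Category.id_comp, implies_true,
      and_self]
  | pb_pair p q w a =>
    refine M.sound_pbAt fun hs ha => ⟨⟨⟨M.swf_path _ trivial, M.swf_path _ trivial⟩,
      M.swf_path _ ha, M.swf_path _ ha⟩, ?_⟩
    simp only [den, dAt_lift, comp_lift, lift_den_path, dAt_den_path, M.den_path _ a, implies_true,
      and_self]
  | pb_jac f p w a =>
    refine M.sound_pbAt fun hs ha => ⟨⟨M.swf_path _ trivial, M.swf_path _ ha⟩, ?_⟩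
    simp only [den, dAt_comp, (isLinearMor_lamMor_D (M.sym f)).dAt_eq, dAt_den_path, M.den_path _ a]
    simp only [← Category.assoc, lift_den_path, implies_true, true_and]
  | pb_fn f p w a =>
    refine M.sound_pbAt fun hs ha => ⟨⟨⟨M.swf_path _ trivial, (M.swf_path _ ha).wk hWP⟩,
      M.swf_path _ ha⟩, ?_⟩
    simp only [den, dAt_comp, dAt_den_path, M.den_path _ a]
    simp only [← Category.assoc, lift_den_path, and_true]
    intro Y x v
    rw [Category.assoc]
    change lift x v ≫ ap _ _ = _
    rw [comp_ap, ← Category.assoc, lift_den_path, ap_lamMor, (M.swf_path p ha).lift_den_wk hWP,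
      den_path, dAt, Category.assoc]
  -- The body `s` does not depend on the pulled-back variable, so only the functional contributes to
  -- the product rule.
  | pb_dual_left s p w a =>
    refine M.sound_pbAt ?_
    rintro ⟨hs, hp, hl⟩ ha
    have hs' := hs.of_wk1 hWP
    have hl' := hs'.isLinearSnd_of_wk1 hWP hl
    refine ⟨⟨⟨hs, hp, hl⟩, hs', M.swf_path p ha, hl'⟩, fun Y x v => M.apD_ext fun Z y c => ?_,
      M.apD_ext fun Z y c => ?_⟩
    · rw [← Category.assoc, comp_lift, M.apD_dualMap hl, lift_den_path, hs'.lift_den_wk1 hWP,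
        comp_dAt, comp_lift, comp_lift, M.apD_dAt_dualMap _ hl, dAt_den_path, comp_zero,
        hs'.dAt_den_wk1 hWP, hs'.lift_den_wk1 hWP, lift_zero_zero, dAt_zero_left, apD_zero_right,
        add_zero]
    · rw [M.apD_dualMap hl', ← Category.assoc, comp_lift, M.apD_dualMap hl, lift_den_path,
        hs'.lift_den_wk1 hWP, M.den_path _ a, Category.comp_id, Category.assoc]
  | pb_app_left p z w a =>
    refine M.sound_pbAt fun hs ha => ⟨⟨⟨M.swf_path _ trivial, hs.2⟩,
      M.swf_path _ ha, hs.2.of_wk hWP⟩, ?_⟩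
    have hz := hs.2.of_wk hWP
    simp only [den_app, dAt_ap, comp_ap, lift_den_path, dAt_den_path,
      hz.dAt_den_wk hWP, hz.lift_den_wk hWP, M.den_path _ a, Category.id_comp, dap_zero, add_zero,
      implies_true, and_self]
  | pb_self_pair_const e w a =>
    refine M.sound_pbAt fun hs ha => ⟨⟨⟨trivial, trivial⟩, ha, hs.2.of_wk hWP⟩, ?_⟩
    have hz := hs.2.of_wk hWP
    simp only [den, dAt_lift, comp_lift, comp_zero, den_v0, lift_snd, dAt_snd,
      hz.dAt_den_wk hWP, hz.lift_den_wk hWP, Category.id_comp, implies_true, and_self]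

/-! ### Reductions with premises -/

/-- The tangent of a term in the variable before the last one, obtained from a premise. -/
theorem tangent_of_premise (hHB : M.HahnBanach) (hWP : WellPointed C) {Γ : List Ty} {σ τ ρ : Ty}
    {s : Tm F (ρ :: σ :: Γ) τ} {a : Tm F Γ σ} {s' : Tm F (σ :: ρ :: Γ) τ}
    {b : Tm F (Ty.form τ :: ρ :: Γ) τ} (hs : M.SWF s) (ha : M.SWF a)
    (h : M.Sound (Tm.pbAt s.swap.wk1 Tm.v0 a.wk.wk) (.dualMap s'.wk1 (.app Tm.v0 b))) :
    M.SWF s' ∧ ∀ ⦃Y : C⦄ (x : Y ⟶ M.ctx Γ) (v : Y ⟶ M.ty σ) (c : Y ⟶ M.ty ρ),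
      lift (lift x c) v ≫ M.den s' =
        dAt (M.den s) (lift (lift 0 v) 0) (lift (lift x (x ≫ M.den a)) c) := by
  obtain ⟨hs', h1⟩ := M.tangent_of_den_pbAt hHB hWP (hs.swap hWP) (ha.wk hWP) h
  refine ⟨hs', fun Y x v c => ?_⟩
  rw [h1, lift_tangent, ha.lift_den_wk hWP, ← lift_zero_zero, hs.dAt_den_swap hWP]

/-- The tangent of a term that is linear in its last variable is linear in this variable. -/
theorem isLinearSnd_swap_of_tangent (hWP : WellPointed C) {Γ : List Ty} {σ τ ρ : Ty}
    {s : Tm F (ρ :: σ :: Γ) τ} {a : Tm F Γ σ} {s' : Tm F (σ :: ρ :: Γ) τ}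
    (hl : IsLinearSnd (X := M.ctx (σ :: Γ)) (A := M.ty ρ) (M.den s)) (hs' : M.SWF s')
    (h : ∀ ⦃Y : C⦄ (x : Y ⟶ M.ctx Γ) (v : Y ⟶ M.ty σ) (c : Y ⟶ M.ty ρ),
      lift (lift x c) v ≫ M.den s' =
        dAt (M.den s) (lift (lift 0 v) 0) (lift (lift x (x ≫ M.den a)) c)) :
    IsLinearSnd (X := M.ctx (σ :: Γ)) (A := M.ty ρ) (M.den s'.swap) := by
  -- The parameter is a pair of a context `γ` and a direction `v`: the differentiation goes in
  -- direction `(0, v)` at the base point `(γ, a(γ))`.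
  have h1 := hl.dAt_fst_linear (Z := M.ctx Γ ⊗ M.ty σ) (lift 0 (snd (M.ctx Γ) (M.ty σ)))
    (lift (fst (M.ctx Γ) (M.ty σ)) (fst (M.ctx Γ) (M.ty σ) ≫ M.den a))
  convert h1 using 1
  have h2 := hs'.lift_den_swap hWP (fst _ _ ≫ fst (M.ctx Γ) (M.ty σ)) (snd _ _)
    (fst _ (M.ty ρ) ≫ snd (M.ctx Γ) (M.ty σ))
  rw [h] at h2
  rw [comp_lift, comp_lift, comp_zero, ← Category.assoc, ← h2, ← comp_lift, lift_fst_snd,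
    Category.comp_id, lift_fst_snd, Category.id_comp]

theorem isLinearSnd_inst1 (hWP : WellPointed C) {Γ : List Ty} {σ τ ρ : Ty}
    {s : Tm F (ρ :: σ :: Γ) τ} {a : Tm F Γ σ} (hs : M.SWF s) (ha : M.SWF a)
    (hl : IsLinearSnd (X := M.ctx (σ :: Γ)) (A := M.ty ρ) (M.den s)) :
    IsLinearSnd (X := M.ctx Γ) (A := M.ty ρ) (M.den (s.inst1 a)) := by
  rw [hs.den_inst1 hWP ha]
  exact hl.comp_left _

theorem sound_pb_dual_right (hHB : M.HahnBanach) (hWP : WellPointed C) {Γ : List Ty}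
    {σ τ ρ : Ty} (s : Tm F (ρ :: σ :: Γ) τ) (z : Tm F Γ (Ty.dual τ))
    (w : Tm F Γ (Ty.form (Ty.dual ρ))) (a : Tm F Γ σ) (s' : Tm F (σ :: ρ :: Γ) τ)
    (b : Tm F (Ty.form τ :: ρ :: Γ) τ)
    (h : M.Sound (Tm.pbAt s.swap.wk1 Tm.v0 a.wk.wk) (.dualMap s'.wk1 (.app Tm.v0 b))) :
    M.Sound (Tm.pbAt (.dualMap s z.wk) w a)
      (.dualMap (.dualMap s'.swap z.wk) (.app w (.dualMap (s.inst1 a) z))) := by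
  refine M.sound_pbAt ?_
  rintro ⟨hs, hz', hl⟩ ha
  have hz := hz'.of_wk hWP
  obtain ⟨hs', ht⟩ := M.tangent_of_premise hHB hWP hs ha h
  have hl' := M.isLinearSnd_swap_of_tangent hWP hl hs' ht
  have hl1 := M.isLinearSnd_inst1 hWP hs ha hl
  refine ⟨⟨⟨hs'.swap hWP, hz', hl'⟩, hs.inst1 hWP ha, hz, hl1⟩,
    fun Y x v => M.apD_ext fun Z y c => ?_, M.apD_ext fun Z y c => ?_⟩
  · rw [← Category.assoc, comp_lift, M.apD_dualMap hl', hz.lift_den_wk hWP,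
      hs'.lift_den_swap hWP, ht, comp_dAt, comp_lift, comp_lift, M.apD_dAt_dualMap _ hl,
      comp_zero, hz.dAt_den_wk hWP, hz.lift_den_wk hWP, apD_zero_left, zero_add]
    simp only [Category.assoc]
  · rw [M.apD_dualMap hl1, hs.lift_den_inst1 hWP ha, ← Category.assoc, comp_lift,
      M.apD_dualMap hl, hz.lift_den_wk hWP, Category.comp_id]

/-- Both the functional and the body vary with `y`, and the two summands of the tangent are those of
the product rule. The premise supplies the derivative of the body; its linearity in `x` is needed
for the new dual map to be meaningful. -/
theorem sound_pb_dual (hHB : M.HahnBanach) (hWP : WellPointed C) {Γ : List Ty}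
    {σ τ ρ : Ty} (s : Tm F (ρ :: σ :: Γ) τ) (p : ProjPath σ (Ty.dual τ))
    (w : Tm F Γ (Ty.form (Ty.dual ρ))) (a : Tm F Γ σ) (s' : Tm F (σ :: ρ :: Γ) τ)
    (b : Tm F (Ty.form τ :: ρ :: Γ) τ)
    (h : M.Sound (Tm.pbAt s.swap.wk1 Tm.v0 a.wk.wk) (.dualMap s'.wk1 (.app Tm.v0 b))) :
    M.Sound (Tm.pbAt (.dualMap s (p.of Tm.v0)) w a)
      (.dualMap (.add (.dualMap (s.inst1 a).wk1 (p.of Tm.v0)) (.dualMap s'.swap (p.of a).wk))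
        (.app w (.dualMap (s.inst1 a) (p.of a)))) := by
  refine M.sound_pbAt ?_
  rintro ⟨hs, hp, hl⟩ ha
  obtain ⟨hs', ht⟩ := M.tangent_of_premise hHB hWP hs ha h
  have hl' := M.isLinearSnd_swap_of_tangent hWP hl hs' ht
  have hs1 := hs.inst1 hWP ha
  have hl1 := M.isLinearSnd_inst1 hWP hs ha hl
  have hl2 := hs1.isLinearSnd_wk1 hWP hl1 σ
  have hpa := M.swf_path p ha
  refine ⟨⟨⟨⟨hs1.wk1 hWP, hp, hl2⟩, hs'.swap hWP, hpa.wk hWP, hl'⟩, hs1, hpa, hl1⟩,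
    fun Y x v => M.apD_ext fun Z y c => ?_, M.apD_ext fun Z y c => ?_⟩
  · rw [den, comp_add, comp_add, apD_add_left]
    rw [← Category.assoc, ← Category.assoc, comp_lift, M.apD_dualMap hl', M.apD_dualMap hl2,
      hpa.lift_den_wk hWP, hs'.lift_den_swap hWP, ht, comp_dAt, comp_lift, comp_lift,
      M.apD_dAt_dualMap _ hl, comp_zero, lift_den_path, dAt_den_path, lift_den_path,
      hs1.lift_den_wk1 hWP, hs.lift_den_inst1 hWP ha, M.den_path _ a]
    simp only [Category.assoc]
  · rw [M.apD_dualMap hl1, hs.lift_den_inst1 hWP ha, ← Category.assoc, comp_lift,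
      M.apD_dualMap hl, lift_den_path, M.den_path _ a, Category.comp_id, Category.assoc]

theorem den_pb_congr {Γ : List Ty} {σ τ : Ty} {s s' : Tm F (σ :: Γ) τ} {w : Tm F Γ (Ty.form τ)}
    (h : M.den s = M.den s') : M.den (.pb s w) = M.den (.pb s' w) := by
  simp only [den, h]

/-- No separation is needed. The premise evaluates the inner pullback at a fresh point, so by the
eta law the abstracted reduct denotes that pullback itself; the outer pullback then only has its
body replaced by one of equal denotation. -/
theorem sound_pb_pb (hWP : WellPointed C) {Γ : List Ty} {σ τ ρ : Ty}
    (s : Tm F (ρ :: σ :: Γ) τ) (z : Tm F (σ :: Γ) (Ty.form τ))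
    (w : Tm F Γ (Ty.form (Ty.form ρ))) (a : Tm F Γ σ) (s' : Tm F (ρ :: ρ :: σ :: Γ) τ)
    (b : Tm F (ρ :: σ :: Γ) τ)
    (h : M.Sound (Tm.pbAt s.wk1 z.wk Tm.v0) (.dualMap s' (.app z.wk b))) :
    M.Sound (Tm.pbAt (.pb s z) w a) (Tm.pbAt (.lam (.dualMap s' (.app z.wk b))) w a) := by
  rintro ⟨⟨⟨hs, hz⟩, hw⟩, ha⟩
  obtain ⟨h1, h2⟩ := h ⟨⟨hs.wk1 hWP, hz.wk hWP⟩, trivial⟩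
  refine ⟨⟨⟨h1, hw⟩, ha⟩, ?_⟩
  have hsz : M.SWF (.pb s z) := ⟨hs, hz⟩
  have h3 : M.den (.lam (.dualMap s' (.app z.wk b))) = M.den (.pb s z) := by
    rw [den, ← h2]
    change lamMor (ap (M.den (Tm.wk (.pb s z))) (M.den Tm.v0)) = _
    rw [hsz.den_wk hWP, den_v0, lamMor_ap]
  simp only [Tm.pbAt, den_app]
  rw [M.den_pb_congr h3]

/-- Differentiation commutes with currying, so the tangent is taken under the abstraction at each
value of the bound variable. -/
theorem sound_pb_lam (hHB : M.HahnBanach) (hWP : WellPointed C) {Γ : List Ty} {σ τ ρ : Ty}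
    (s : Tm F (ρ :: σ :: Γ) τ)
    (w : Tm F Γ (Ty.form (Ty.arrow ρ τ))) (a : Tm F Γ σ) (s' : Tm F (σ :: ρ :: Γ) τ)
    (b : Tm F (Ty.form τ :: ρ :: Γ) τ)
    (h : M.Sound (Tm.pbAt s.swap.wk1 Tm.v0 a.wk.wk) (.dualMap s'.wk1 (.app Tm.v0 b))) :
    M.Sound (Tm.pbAt (.lam s) w a) (.dualMap (.lam s'.swap) (.app w (.lam (s.inst1 a)))) := by
  refine M.sound_pbAt fun hs ha => ?_
  replace hs : M.SWF s := hs
  obtain ⟨hs', ht⟩ := M.tangent_of_premise hHB hWP hs ha h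
  refine ⟨⟨hs'.swap hWP, hs.inst1 hWP ha⟩, fun Y x v => ap_congr_of_forall fun Z y c => ?_,
    ap_congr_of_forall fun Z y c => ?_⟩
  · simp only [den]
    rw [← Category.assoc, comp_lift, ap_lamMor, hs'.lift_den_swap hWP, ht, comp_dAt, comp_lift,
      comp_lift, ap_dAt_lamMor, comp_zero, Category.assoc]
  · simp only [den]
    rw [ap_lamMor, hs.lift_den_inst1 hWP ha, ← Category.assoc, comp_lift, ap_lamMor,
      Category.comp_id]

/-- The product rule for application: the function varies at a fixed argument, and the fixed
function is differentiated along the argument. For the second summand the function must be known as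
an abstraction `λ z. e`. -/
theorem sound_pb_app (hHB : M.HahnBanach) (hWP : WellPointed C) {Γ : List Ty} {σ τ ρ : Ty}
    (p : ProjPath σ (Ty.arrow ρ τ)) (q : ProjPath σ ρ)
    (w : Tm F Γ (Ty.form τ)) (a : Tm F Γ σ) (e s' : Tm F (ρ :: Γ) τ)
    (b : Tm F (Ty.form τ :: Γ) τ) (he : M.Sound (p.of a) (.lam e))
    (h : M.Sound (Tm.pbAt e.wk1 Tm.v0 (q.of a).wk) (.dualMap s'.wk1 (.app Tm.v0 b))) :
    M.Sound (Tm.pbAt (.app (p.of Tm.v0) (q.of Tm.v0)) w a)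
      (.dualMap (.add (.app (p.of Tm.v0) (q.of a).wk) (s'.wk1.inst (q.of Tm.v0)))
        (.app w (.app (p.of a) (q.of a)))) := by
  refine M.sound_pbAt ?_
  rintro ⟨hp, hq⟩ ha
  have hpa := M.swf_path p ha
  have hqa := M.swf_path q ha
  obtain ⟨he1, he2⟩ := he hpa
  obtain ⟨hs', ht⟩ := M.tangent_of_den_pbAt hHB hWP (s := e) he1 hqa h
  refine ⟨⟨⟨⟨hp, hqa.wk hWP⟩, (hs'.wk1 hWP).inst hWP hq⟩, hpa, hqa⟩, fun Y x v => ?_, ?_⟩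
  · rw [den, comp_add, den_app, den_app, comp_ap, dAt_ap, (hs'.wk1 hWP).den_inst hWP hq,
      ← Category.assoc (lift x v), comp_lift, Category.comp_id, hs'.lift_den_wk1 hWP, ht,
      lift_tangent]
    simp only [lift_den_path, dAt_den_path, hqa.lift_den_wk hWP]
    -- The projection of `a` is replaced by the abstraction to which it reduces, so that `dap`
    -- becomes the derivative of `e`.
    rw [Category.assoc x _ (M.path p), ← M.den_path p a, he2, den, dap_lamMor, M.den_path q a,
      Category.assoc]
  · simp only [den_app, comp_ap, lift_den_path, M.den_path _ a]

theorem sound_pb_app_const (hHB : M.HahnBanach) (hWP : WellPointed C) {Γ : List Ty}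
    {σ τ ρ : Ty} (p : ProjPath σ (Ty.arrow ρ τ)) (q : ProjPath σ ρ)
    (w : Tm F Γ (Ty.form τ)) (a : Tm F Γ σ) (e : Tm F (ρ :: Γ) τ)
    (he : M.Sound (p.of a) (.lam e))
    (h : M.Sound (Tm.pbAt e.wk1 Tm.v0 (q.of a).wk : Tm F (Ty.form τ :: Γ) (Ty.dual ρ)) .zero) :
    M.Sound (Tm.pbAt (.app (p.of Tm.v0) (q.of Tm.v0)) w a)
      (.dualMap (.app (p.of Tm.v0) (q.of a).wk) (.app w (.app (p.of a) (q.of a)))) := by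
  refine M.sound_pbAt ?_
  rintro ⟨hp, hq⟩ ha
  have hpa := M.swf_path p ha
  have hqa := M.swf_path q ha
  obtain ⟨he1, he2⟩ := he hpa
  have ht := M.tangent_of_den_pbAt_zero hHB hWP (s := e) he1 hqa h
  refine ⟨⟨⟨hp, hqa.wk hWP⟩, hpa, hqa⟩, fun Y x v => ?_, ?_⟩
  · have h0 := congrArg (fun t => lift x (v ≫ M.path q) ≫ t) ht
    simp only [lift_tangent, comp_zero] at h0
    rw [den_app, den_app, comp_ap, dAt_ap]
    simp only [lift_den_path, dAt_den_path, hqa.lift_den_wk hWP]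
    rw [Category.assoc x _ (M.path p), ← M.den_path p a, he2, den, dap_lamMor, Category.assoc,
      ← M.den_path q a, h0, add_zero]
  · simp only [den_app, comp_ap, lift_den_path, M.den_path _ a]

theorem sound_pb_self_pair (hHB : M.HahnBanach) (hWP : WellPointed C) {Γ : List Ty} {σ τ : Ty}
    (e : Tm F (σ :: Γ) τ)
    (w : Tm F Γ (Ty.form (Ty.prod σ τ))) (a : Tm F Γ σ) (s' : Tm F (σ :: Γ) τ)
    (b : Tm F (Ty.form τ :: Γ) τ)
    (h : M.Sound (Tm.pbAt e.wk1 Tm.v0 a.wk) (.dualMap s'.wk1 (.app Tm.v0 b))) :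
    M.Sound (Tm.pbAt (.pair Tm.v0 e) w a)
      (.dualMap (.pair Tm.v0 s') (.app w (.pair a (e.inst a)))) := by
  refine M.sound_pbAt ?_
  rintro ⟨-, he⟩ ha
  obtain ⟨hs', ht⟩ := M.tangent_of_den_pbAt hHB hWP he ha h
  refine ⟨⟨⟨trivial, hs'⟩, ha, he.inst hWP ha⟩, fun Y x v => ?_, ?_⟩
  · simp only [den, comp_lift, dAt_lift, den_v0, lift_snd, dAt_snd]
    rw [ht, lift_tangent]
  · simp only [den, comp_lift, den_v0, lift_snd]
    rw [he.den_inst hWP ha]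

/-- Reduction preserves the interpretation and semantic well-formedness. -/
theorem sound_red (hHB : M.HahnBanach) (hWP : WellPointed C) {Γ : List Ty} {σ : Ty}
    {s t : Tm F Γ σ} (h : Red s t) : M.Sound s t := by
  induction h with
  | refl s => exact fun h => ⟨h, rfl⟩
  | trans _ _ ih1 ih2 => exact fun h => ⟨(ih2 (ih1 h).1).1, (ih1 h).2.trans (ih2 (ih1 h).1).2⟩
  | ofSumEq h => exact (M.sound_sumEq hWP h).1
  | ofSumEqSymm h => exact (M.sound_sumEq hWP h).2
  | ofARule h => exact M.sound_aRule hWP h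
  | ofRule h => exact M.sound_rule hWP h
  | add _ _ ihs iht =>
    exact fun h => ⟨⟨(ihs h.1).1, (iht h.2).1⟩, by simp only [den, (ihs h.1).2, (iht h.2).2]⟩
  | lam _ ih => exact fun h => ⟨(ih h).1, by simp only [den, (ih h).2]⟩
  | app _ _ ihs iht =>
    exact fun h => ⟨⟨(ihs h.1).1, (iht h.2).1⟩, by simp only [den, (ihs h.1).2, (iht h.2).2]⟩
  | fst _ ih => exact fun h => ⟨(ih h).1, by simp only [den, (ih h).2]⟩
  | snd _ ih => exact fun h => ⟨(ih h).1, by simp only [den, (ih h).2]⟩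
  | pair _ _ ihs iht =>
    exact fun h => ⟨⟨(ihs h.1).1, (iht h.2).1⟩, by simp only [den, (ihs h.1).2, (iht h.2).2]⟩
  | fn f _ ih => exact fun h => ⟨(ih h).1, by simp only [den, (ih h).2]⟩
  | jac f _ ih => exact fun h => ⟨(ih h).1, by simp only [den, (ih h).2]⟩
  -- Linearity of the body is a property of its denotation alone, hence transports along the
  -- equality of denotations.
  | dualMap _ _ ihs iht =>
    exact fun h => ⟨⟨(ihs h.1).1, (iht h.2.1).1, (ihs h.1).2 ▸ h.2.2⟩, by
      simp only [den, (ihs h.1).2, (iht h.2.1).2]⟩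
  | pb _ _ ihs iht =>
    exact fun h => ⟨⟨(ihs h.1).1, (iht h.2).1⟩, by simp only [den, (ihs h.1).2, (iht h.2).2]⟩
  | pb_dual_right s z w a s' b _ ih => exact M.sound_pb_dual_right hHB hWP s z w a s' b ih
  | pb_dual s p w a s' b _ ih => exact M.sound_pb_dual hHB hWP s p w a s' b ih
  | pb_pb s z w a s' b _ ih => exact M.sound_pb_pb hWP s z w a s' b ih
  | pb_lam s w a s' b _ ih => exact M.sound_pb_lam hHB hWP s w a s' b ih
  | pb_app p q w a e s' b _ _ ih1 ih2 => exact M.sound_pb_app hHB hWP p q w a e s' b ih1 ih2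
  | pb_app_const p q w a e _ _ ih1 ih2 => exact M.sound_pb_app_const hHB hWP p q w a e ih1 ih2
  | pb_self_pair e w a s' b _ ih => exact M.sound_pb_self_pair hHB hWP e w a s' b ih

/-! ### Derivatives of sections -/

theorem dAt_section {Γ : List Ty} {σ τ : Ty} (s : Tm F (σ :: Γ) τ) (γ : 𝟙_ C ⟶ M.ctx Γ)
    (v x : 𝟙_ C ⟶ M.ty σ) :
    dAt (M.section_ s γ) v x = dAt (M.den s) (lift 0 v) (lift γ x) := by
  rw [section_, dAt_comp, dAt_lift, dAt_comp, dAt_id, comp_lift, Category.comp_id,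
    Subsingleton.elim (dAt (toUnit (M.ty σ)) v x) 0, dAt_zero_left, ← Category.assoc,
    Subsingleton.elim (x ≫ toUnit _) (𝟙 _), Category.id_comp]

theorem num_linForm_single (m : ℕ) (p : Fin (m + 1)) (x : 𝟙_ C ⟶ M.ty (Ty.pow m)) :
    M.num (x ≫ M.linForm m (Pi.single p 1)) = M.toVec M.num m x p := by
  rw [M.num_linForm]
  exact single_one_dotProduct p _

end DPPLModel

/-! ### The two claims of the theorem -/

theorem mainTheorem2 {F : FunSig} {C : Type*} [Category C] [CartesianMonoidalCategory C]
    [MonoidalClosed C] [DifferentialLambdaCategory C] (M : DPPLModel F C)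
    (hWP : WellPointed C) (hHB : M.HahnBanach) {Γ : List Ty} (γ : 𝟙_ C ⟶ M.ctx Γ) :
    (∀ {n m : ℕ} (P₁ : Tm F (Ty.pow n :: Γ) (Ty.pow m)) (P₂ : Tm F Γ (Ty.pow n))
        (p : Fin (m + 1)) (V : Tm F Γ (Ty.dual (Ty.pow n))),
        P₁.WF → P₂.WF →
        Red (Tm.pbAt P₁ (Tm.vecForm (Pi.single p 1)) P₂) V →
        DifferentiableAt ℝ (M.toFun M.num (M.section_ P₁ γ)) (M.toVec M.num n (γ ≫ M.den P₂)) ∧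
        ∀ v : Fin (n + 1) → ℝ,
          M.num (lift (γ ≫ M.den V) (M.ofVec M.num n v) ≫ M.evDual _) =
            ∑ j, jacobian (M.toFun M.num (M.section_ P₁ γ)) (M.toVec M.num n (γ ≫ M.den P₂)) p j
              * v j) ∧
    (∀ {σ τ : Ty} (P₁ : Tm F (σ :: Γ) τ) (P₂ : Tm F Γ σ) (l : M.ty τ ⟶ M.R)
        (P₁' : Tm F (σ :: Ty.form τ :: Γ) τ) (P₂' : Tm F (Ty.form τ :: Γ) τ),
        P₁.WF → P₂.WF → IsLinearMor l →
        Red (Tm.pbAt P₁.wk1 Tm.v0 P₂.wk) (.dualMap P₁' (.app Tm.v0 P₂')) →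
        ∀ v : 𝟙_ C ⟶ M.ty σ,
          lift v (γ ≫ M.den P₂) ≫ CartesianDifferentialCategory.D (M.section_ P₁ γ ≫ l) =
            lift (lift γ (M.constForm l)) v ≫ M.den P₁' ≫ l) := by
  have swf : ∀ {Δ : List Ty} {σ : Ty} (s : Tm F Δ σ), s.WF → M.SWF s :=
    fun s hs => (M.swf_and_linearVar hWP s hs).1
  refine ⟨fun {n m} P₁ P₂ p V h₁ h₂ hred => ?_, fun {σ τ} P₁ P₂ l P₁' P₂' h₁ h₂ hl hred v => ?_⟩
  · obtain ⟨hdiff, hderiv⟩ := M.hasFDerivAt (M.section_ P₁ γ) (M.toVec M.num n (γ ≫ M.den P₂))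
    refine ⟨hdiff, fun v => ?_⟩
    obtain ⟨-, hV⟩ := M.sound_red hHB hWP hred ⟨⟨swf _ h₁, trivial⟩, swf _ h₂⟩
    change M.num (M.apD (γ ≫ M.den V) (M.ofVec M.num n v)) = _
    -- The form `λ x. e_p*` turns the pullback into the `p`-th coordinate of the tangent, which is
    -- the derivative of the section at fixed `γ`.
    rw [← hV, M.apD_den_pbAt, Tm.vecForm, DPPLModel.den, ap_lamMor,
      M.apD_dualVec hWP (Γ := Ty.pow m :: Γ), M.num_linForm_single, DPPLModel.lift_tangent,
      ← M.dAt_section]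
    have h := congrFun (hderiv v) p
    rw [M.ofVec_toVec, DPPLModel.fderiv_apply_eq_jacobian] at h
    exact h.symm
  -- Here the tangent `P₁'` may contain the form variable, so no separation is possible at this last
  -- stage: the equation is kept for the single `l` whose constant form interprets that variable.
  · obtain ⟨hP, hden⟩ := M.sound_red hHB hWP hred
      ⟨⟨(swf _ h₁).wk1 hWP, trivial⟩, (swf _ h₂).wk hWP⟩
    have h := M.apD_pbAt_constForm hWP (swf _ h₁) (swf _ h₂) hl γ v
    rw [hden, M.apD_dualMap_constForm hP.2.2 hl, ← Category.assoc (lift γ v),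
      DPPLModel.lift_tangent, ← M.dAt_section] at h
    rw [h]
    exact (dAt_comp (M.section_ P₁ γ) l v _).trans (hl.dAt_eq _ _)
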